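/- **Setting.** Let $n\ge 1$ and $p>1$. Write $\langle y\rangle=(1+|y|^2)^{1/2}$, $y\,b\,y=\sum_{i,j}y_ib_{ij}y_j$, let $\|b\|$ be the operator norm of an $n\times n$ matrix, and put $$V_{ab}(y)=\Big(\frac{a+\frac12}{p-1+y\,b\,y}\Big)^{\frac1{p-1}},\qquad \phi_a^{(00)}=1,\quad \phi_a^{(0i)}=\phi_a^{(i0)}=\sqrt a\,y_i,\quad \phi_a^{(ij)}=a\,y_iy_j\quad(1\le i,j\le n).$$ Let $T>0$, let $a:[0,T]\to(0,\infty)$ be $C^1$ and let $b$ be a $C^1$ function from $[0,T]$ to the real symmetric $n\times n$ matrices with $b(\tau)\ge 0$ and $b(0)>0$. Put $c=a+\frac12$, $\kappa=\min\{\frac12,\frac{p-1}2\}$, $$\tilde\beta(\tau)=\Big(b(0)^{-1}+\frac{4p\tau}{(p-1)^2}I\Big)^{-1},\qquad \beta(\tau)=\text{the largest eigenvalue of }\tilde\beta(\tau),$$ and, for $\xi:[0,T]\times\mathbb R^n\to\mathbb R$, $$M_1(\tau)=\sup_{s\le\tau}\beta(s)^{-2}\|\langle y\rangle^{-3}\xi(s)\|_\infty,\quad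 A(\tau)=\sup_{s\le\tau}\beta(s)^{-2}\Big|a(s)-\tfrac12+\tfrac{2\,\mathrm{Tr}\,b(s)}{p-1}\Big|,\quad B(\tau)=\sup_{s\le\tau}\beta(s)^{-(1+\kappa)}\|b(s)-\tilde\beta(s)\|.$$ The rescaled equation is $$\partial_\tau v=\Big(\Delta-a(\tau)\,y\cdot\nabla-\frac{2a(\tau)}{p-1}\Big)v+|v|^{p-1}v .\tag{1}$$ A solution of (1) on $[0,T]$ means a bounded weak solution: $v$ is bounded on $[0,T]\times\mathbb R^n$, continuous in $\tau\in[0,T]$ with values in $L^1_{\rm loc}(\mathbb R^n)$, and (1) holds, integrated in time over any subinterval of $[0,T]$, against every test function $\psi\in C_c^\infty(\mathbb R^n)$. The residual of $V_{ab}$ in (1), when the parameters move with velocities $\dot a,\dot b$, is $$F(a,b;\dot a,\dot b)=\Big(\Delta-a\,y\cdot\nabla-\frac{2a}{p-1}\Big)V_{ab}+V_{ab}^p-\frac{d}{ds}\Big|_{s=0}V_{a+s\dot a,\,b+s\dot b}.$$ **Proposition.** There are $\varepsilon>0$, $C>0$ and maps $\mathcal R_b(\xi,a,b)\in\mathbb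 R^{n\times n}$, $\mathcal R_a(\xi,a,b)\in\mathbb R$ of a function $\xi$ on $\mathbb R^n$, a number $a$ and a matrix $b$, all depending only on $n$ and $p$, such that the following holds for all $T,a,b,\xi$ as above. Suppose that $\|b(0)\|\le\varepsilon$, that $\frac12\le c(0)\le 2$, that $v=V_{a(\tau)b(\tau)}+\xi(\tau)$ is a solution of (1) on $[0,T]$, that $$\xi(\tau)\perp\phi_{a(\tau)}^{(ij)}\ \text{ in } L^2(\mathbb R^n,e^{-a(\tau)|y|^2/2}dy),\qquad 0\le i,j\le n,\ 0\le\tau\le T,$$ and that $A(\tau),\,M_1(\tau),\,B(\tau)\le\beta(\tau)^{-\kappa/2}$ for $0\le\tau\le T$. Then for all $0\le\tau\le T$ $$\partial_\tau b=-\frac{4p}{(p-1)^2}b^2-\frac{2b}{p-1}\mathrm{Tr}\,b+(c-2a)b+\mathcal R_b(\xi,a,b),\qquad \frac{\partial_\tau a}{a+\frac12}=\Big(\frac12-a\Big)-\frac2{p-1}\mathrm{Tr}\,b+\mathcal R_a(\xi,a,b),\tag{2}$$ where everything is evaluated at time $\tau$, and $$\|\mathcal R_b(\xi,a,b)\|,\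 |\mathcal R_a(\xi,a,b)|\ \le\ C\big(\beta^3+\beta^3M_1(1+A)+\beta^4M_1^2+\beta^{2p}M_1^p\big),\qquad \|\mathcal R_b(0,a,b)\|,\ |\mathcal R_a(0,a,b)|\ \le\ C\beta^3 .$$ Here $\mathcal R_b(0,a,b)$ and $\mathcal R_a(0,a,b)$ are the remainders in the absence of a fluctuation: if $\dot b,\dot a$ are the velocities that (2) gives with these remainders, then $F(a,b;\dot a,\dot b)\perp\phi_a^{(ij)}$ in $L^2(\mathbb R^n,e^{-a|y|^2/2}dy)$ for all $0\le i,j\le n$. -/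

import Mathlib

open MeasureTheory Filter Topology
open scoped ContDiff Matrix.Norms.L2Operator

namespace BlowupHeat

/-- The profile `V_{ab}(y) = ((a + 1/2) / (p - 1 + y b y)) ^ (1 / (p - 1))`. -/
noncomputable def profile {n : ℕ} (p a : ℝ) (b : Matrix (Fin n) (Fin n) ℝ)
    (y : EuclideanSpace ℝ (Fin n)) : ℝ :=
  ((a + 1 / 2) / (p - 1 + ∑ i, ∑ j, y i * b i j * y j)) ^ (1 / (p - 1))

/-- The vectors `φ_a^{(ij)}`, `0 ≤ i, j ≤ n`: `φ^{(00)} = 1`, `φ^{(0i)} = φ^{(i0)} = √a y_i`,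
`φ^{(ij)} = a y_i y_j`. -/
noncomputable def phi {n : ℕ} (a : ℝ) (i j : Fin (n + 1)) (y : EuclideanSpace ℝ (Fin n)) : ℝ :=
  (Fin.cons 1 (fun k => Real.sqrt a * y k) : Fin (n + 1) → ℝ) i *
    (Fin.cons 1 (fun k => Real.sqrt a * y k) : Fin (n + 1) → ℝ) j

/-- The inner product of `L²(ℝⁿ, exp (-a |y|² / 2) dy)`. -/
noncomputable def gaussInner {n : ℕ} (a : ℝ) (f g : EuclideanSpace ℝ (Fin n) → ℝ) : ℝ :=
  ∫ y, f y * g y * Real.exp (-(a * ‖y‖ ^ 2 / 2))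

/-- The formal adjoint of `Δ - a y·∇ - 2a/(p-1)`, applied to a test function:
`Δψ + a ∇·(yψ) - 2a/(p-1) ψ`, where `∇·(yψ) = nψ + y·∇ψ`. -/
noncomputable def adjointOp {n : ℕ} (p a : ℝ) (ψ : EuclideanSpace ℝ (Fin n) → ℝ)
    (y : EuclideanSpace ℝ (Fin n)) : ℝ :=
  Laplacian.laplacian ψ y + a * (n * ψ y + fderiv ℝ ψ y y) - 2 * a / (p - 1) * ψ y

/-- `v` is a bounded weak solution on `[0, T]` of
`∂_τ v = (Δ - a y·∇ - 2a/(p-1)) v + |v|^{p-1} v`, with `a = a(τ)`: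
`v` is bounded on `[0, T] × ℝⁿ`, it is continuous in time with values in `L¹_loc`, and the equation
holds against every test function in `y`, integrated in time.
(Every bounded mild solution, and every bounded classical solution, is of this kind.) -/
structure IsWeakSolution {n : ℕ} (p T : ℝ) (a : ℝ → ℝ)
    (v : ℝ → EuclideanSpace ℝ (Fin n) → ℝ) : Prop where
  aestronglyMeasurable : ∀ τ ∈ Set.Icc 0 T, AEStronglyMeasurable (v τ) volume
  bounded : ∃ K : ℝ, ∀ τ ∈ Set.Icc 0 T, ∀ᵐ y, |v τ y| ≤ K
  continuous_L1loc : ∀ R : ℝ, ∀ σ ∈ Set.Icc 0 T,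
    Tendsto (fun τ => ∫ y in Metric.ball 0 R, |v τ y - v σ y|) (𝓝[Set.Icc 0 T] σ) (𝓝 0)
  equation : ∀ ψ : EuclideanSpace ℝ (Fin n) → ℝ, ContDiff ℝ ∞ ψ → HasCompactSupport ψ →
    ∀ σ ∈ Set.Icc 0 T, ∀ τ ∈ Set.Icc 0 T,
      (∫ y, v τ y * ψ y) - (∫ y, v σ y * ψ y) =
        ∫ s in σ..τ, ∫ y, (v s y * adjointOp p (a s) ψ y + |v s y| ^ (p - 1) * v s y * ψ y)

/-- `κ = min {1/2, (p-1)/2}`. -/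
noncomputable def kappa (p : ℝ) : ℝ := min (1 / 2) ((p - 1) / 2)

/-- `β̃(τ) = (b(0)⁻¹ + 4pτ/(p-1)² I)⁻¹`, where `b₀ = b(0)`. -/
noncomputable def betaTilde {n : ℕ} (p : ℝ) (b₀ : Matrix (Fin n) (Fin n) ℝ) (τ : ℝ) :
    Matrix (Fin n) (Fin n) ℝ :=
  (b₀⁻¹ + (4 * p * τ / (p - 1) ^ 2) • (1 : Matrix (Fin n) (Fin n) ℝ))⁻¹

/-- `β(τ)`, the largest eigenvalue of the symmetric matrix `β̃(τ)`. -/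
noncomputable def beta {n : ℕ} (p : ℝ) (b₀ : Matrix (Fin n) (Fin n) ℝ) (τ : ℝ) : ℝ :=
  sSup (spectrum ℝ (betaTilde p b₀ τ))

/-- The weighted norm `‖⟨y⟩⁻³ f‖_∞`, with `⟨y⟩ = (1 + |y|²)^{1/2}` (essential supremum). -/
noncomputable def weightedNorm {n : ℕ} (f : EuclideanSpace ℝ (Fin n) → ℝ) : ℝ :=
  (eLpNorm (fun y => (Real.sqrt (1 + ‖y‖ ^ 2) ^ 3)⁻¹ * f y) ⊤ volume).toReal

/-- `M₁(τ) = sup_{s ≤ τ} β(s)⁻² ‖⟨y⟩⁻³ ξ(s)‖_∞`. The three suprema here and below are over bounded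
sets when `ξ` is bounded on `[0, τ] × ℝⁿ`, `a`, `b` are continuous and `b(0)` is positive. -/
noncomputable def majorantM {n : ℕ} (p : ℝ) (b : ℝ → Matrix (Fin n) (Fin n) ℝ)
    (ξ : ℝ → EuclideanSpace ℝ (Fin n) → ℝ) (τ : ℝ) : ℝ :=
  sSup ((fun s => (beta p (b 0) s ^ 2)⁻¹ * weightedNorm (ξ s)) '' Set.Icc 0 τ)

/-- `A(τ) = sup_{s ≤ τ} β(s)⁻² |a(s) - 1/2 + 2 Tr b(s) / (p-1)|`. -/
noncomputable def majorantA {n : ℕ} (p : ℝ) (a : ℝ → ℝ) (b : ℝ → Matrix (Fin n) (Fin n) ℝ)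
    (τ : ℝ) : ℝ :=
  sSup ((fun s => (beta p (b 0) s ^ 2)⁻¹ * |a s - 1 / 2 + 2 * (b s).trace / (p - 1)|) ''
    Set.Icc 0 τ)

/-- `B(τ) = sup_{s ≤ τ} β(s)^{-(1+κ)} ‖b(s) - β̃(s)‖` (operator norm). -/
noncomputable def majorantB {n : ℕ} (p : ℝ) (b : ℝ → Matrix (Fin n) (Fin n) ℝ) (τ : ℝ) : ℝ :=
  sSup ((fun s => beta p (b 0) s ^ (-(1 + kappa p)) * ‖b s - betaTilde p (b 0) s‖) ''
    Set.Icc 0 τ)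

/-- `β³ + β³ M₁ (1 + A) + β⁴ M₁² + β^{2p} M₁^p` at time `τ`. -/
noncomputable def remainderSize {n : ℕ} (p : ℝ) (a : ℝ → ℝ) (b : ℝ → Matrix (Fin n) (Fin n) ℝ)
    (ξ : ℝ → EuclideanSpace ℝ (Fin n) → ℝ) (τ : ℝ) : ℝ :=
  beta p (b 0) τ ^ 3
    + beta p (b 0) τ ^ 3 * majorantM p b ξ τ * (1 + majorantA p a b τ)
    + beta p (b 0) τ ^ 4 * majorantM p b ξ τ ^ 2
    + beta p (b 0) τ ^ (2 * p) * majorantM p b ξ τ ^ p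

/-- The velocity `∂_τ a` that corresponds to the remainder `r`, i.e.
`∂_τ a / (a + 1/2) = (1/2 - a) - 2/(p-1) Tr b + r`. -/
noncomputable def velocityA {n : ℕ} (p a : ℝ) (b : Matrix (Fin n) (Fin n) ℝ) (r : ℝ) : ℝ :=
  (a + 1 / 2) * ((1 / 2 - a) - 2 / (p - 1) * b.trace + r)

/-- The velocity `∂_τ b` that corresponds to the remainder `r`; here `c = a + 1/2`. -/
noncomputable def velocityB {n : ℕ} (p a : ℝ) (b r : Matrix (Fin n) (Fin n) ℝ) :
    Matrix (Fin n) (Fin n) ℝ :=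
  -((4 * p / (p - 1) ^ 2) • (b * b)) - (2 / (p - 1) * b.trace) • b
    + ((a + 1 / 2) - 2 * a) • b + r

/-- The source term `(Δ - a y·∇ - 2a/(p-1)) V_{ab} + V_{ab}^p - ∂_τ V_{ab}` of the equation for the
fluctuation, when the parameters move with velocities `a'` and `b'`. -/
noncomputable def source {n : ℕ} (p a : ℝ) (b : Matrix (Fin n) (Fin n) ℝ) (a' : ℝ)
    (b' : Matrix (Fin n) (Fin n) ℝ) (y : EuclideanSpace ℝ (Fin n)) : ℝ :=
  Laplacian.laplacian (profile p a b) y - a * fderiv ℝ (profile p a b) y y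
    - 2 * a / (p - 1) * profile p a b y + profile p a b y ^ p
    - deriv (fun s : ℝ => profile p (a + s * a') (b + s • b') y) 0

end BlowupHeat

namespace BlowupHeat

/-! The effective equations arise by differentiating the orthogonality conditions in time. Only the
even conditions enter. They say that `ξ` is orthogonal to every `gtest a s S`, that is, to `(s + y S
y) exp (-a |y|² / 2)` with `S` symmetric. Conjugation by the Gaussian turns the adjoint of `Δ - a
y·∇ - 2a/(p-1)` into an Ornstein–Uhlenbeck operator, which preserves this finite-dimensional space
(`adjointOp_gtest`). The linear operator acting on `ξ` therefore drops out. Orthogonality also makes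
the pairings of `v` and of `V` with the moving test function `ψ` equal at all times, so their
derivatives agree. With the weak formulation extended from compactly supported functions to Gaussian
ones, this gives `modulation_identity`: the integral of `(F + |V+ξ|^{p-1}(V+ξ) - V^p) ψ` equals
`(a'/2) ∫ ξ |y|² ψ`.

Every pair of velocities can be written as (2) with unknown remainders `ra`, `rb`. Then `F = -kern ·
(q + cubicTerm)`, where `q = (p-1) ra + y (ra b - rb) y` (`source_velocity`). The identity thus
becomes a linear system for `q`. Its main part is the Gram form of quadratic polynomials in the
positive weight `kern · gauss`, and this form is coercive uniformly in the parameters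
(`exists_coercive`). If `|ξ| ≤ m (1 + |y|²)²`, the data have the following sizes. - The cubic term
is `O(‖b‖³)`. - The linearised nonlinearity is `p V^{p-1} ξ`, and `V^{p-1}` is a constant plus
`O(‖b‖)`. The constant pairs to zero, leaving `O(‖b‖ m)`. - The remainder of the linearisation is
`O(m² + m^p)` (`abs_nonlin_sub_linear_le`). - The right-hand side is `a' O(m)`, where `a'` consists
of the quantity measured by `A` and of `ra`. The part with `ra` is absorbed by coercivity when `m`
is small.

For the remainders to depend only on `(ξ, a, b)`, they are chosen as a solution of this system
whenever there is one (`IsRemainder`, `remainders`). A solution of the equation supplies existence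
at `ξ(τ)`, and coercivity supplies uniqueness, so the chosen remainders are the actual ones. At `ξ =
0` the form is injective on a finite-dimensional space, hence surjective, and the remainders exist.
The resulting source is even, which yields the odd orthogonality relations as well. Finally the
majorants give `‖b‖ ≤ 2β`, `1/4 ≤ a ≤ 1` and `m = β² M₁ ≤ β`, so a small `ε` makes all these
constants uniform. -/

variable {n : ℕ}

/-! ### Quadratic forms -/

/-- The linear map of `EuclideanSpace ℝ (Fin n)` with matrix `S`. -/
noncomputable abbrev act (S : Matrix (Fin n) (Fin n) ℝ) :
    EuclideanSpace ℝ (Fin n) →L[ℝ] EuclideanSpace ℝ (Fin n) :=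
  Matrix.toEuclideanCLM (𝕜 := ℝ) S

/-- The quadratic form `y S y`. -/
noncomputable def quad (S : Matrix (Fin n) (Fin n) ℝ) (y : EuclideanSpace ℝ (Fin n)) : ℝ :=
  ∑ i, ∑ j, y i * S i j * y j

lemma quad_eq_inner (S : Matrix (Fin n) (Fin n) ℝ) (y : EuclideanSpace ℝ (Fin n)) :
    quad S y = inner ℝ y (act S y) := by
  rw [Matrix.inner_toEuclideanCLM, quad]
  simp only [dotProduct, Matrix.mulVec, Finset.mul_sum, mul_assoc]

lemma quad_add (S S' : Matrix (Fin n) (Fin n) ℝ) (y : EuclideanSpace ℝ (Fin n)) :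
    quad (S + S') y = quad S y + quad S' y := by
  simp [quad_eq_inner, inner_add_right]

lemma quad_sub (S S' : Matrix (Fin n) (Fin n) ℝ) (y : EuclideanSpace ℝ (Fin n)) :
    quad (S - S') y = quad S y - quad S' y := by
  simp [quad_eq_inner, inner_sub_right]

lemma quad_neg (S : Matrix (Fin n) (Fin n) ℝ) (y : EuclideanSpace ℝ (Fin n)) :
    quad (-S) y = -quad S y := by
  simp [quad_eq_inner]

lemma quad_smul (r : ℝ) (S : Matrix (Fin n) (Fin n) ℝ) (y : EuclideanSpace ℝ (Fin n)) :
    quad (r • S) y = r * quad S y := by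
  simp [quad_eq_inner, inner_smul_right]

lemma quad_zero (y : EuclideanSpace ℝ (Fin n)) : quad (0 : Matrix (Fin n) (Fin n) ℝ) y = 0 := by
  simp [quad_eq_inner]

lemma quad_neg_arg (S : Matrix (Fin n) (Fin n) ℝ) (y : EuclideanSpace ℝ (Fin n)) :
    quad S (-y) = quad S y := by
  simp [quad_eq_inner]

lemma norm_act_le (S : Matrix (Fin n) (Fin n) ℝ) (y : EuclideanSpace ℝ (Fin n)) :
    ‖act S y‖ ≤ ‖S‖ * ‖y‖ := by
  have := (act S).le_opNorm y
  rwa [Matrix.l2_opNorm_toEuclideanCLM] at this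

lemma abs_quad_le (S : Matrix (Fin n) (Fin n) ℝ) (y : EuclideanSpace ℝ (Fin n)) :
    |quad S y| ≤ ‖S‖ * ‖y‖ ^ 2 := by
  rw [quad_eq_inner]
  refine (abs_real_inner_le_norm _ _).trans ?_
  nlinarith [norm_act_le S y, norm_nonneg y]

lemma quad_nonneg {S : Matrix (Fin n) (Fin n) ℝ} (hS : S.PosSemidef)
    (y : EuclideanSpace ℝ (Fin n)) : 0 ≤ quad S y := by
  rw [quad_eq_inner, Matrix.inner_toEuclideanCLM]
  simpa using hS.dotProduct_mulVec_nonneg y.ofLp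

lemma inner_act_comm {S : Matrix (Fin n) (Fin n) ℝ} (hS : S.IsHermitian)
    (x y : EuclideanSpace ℝ (Fin n)) : inner ℝ (act S x) y = inner ℝ x (act S y) := by
  rw [real_inner_comm, Matrix.inner_toEuclideanCLM, Matrix.inner_toEuclideanCLM,
    Matrix.dotProduct_mulVec, ← Matrix.mulVec_transpose, dotProduct_comm]
  congr 2

lemma quad_mul_self {S : Matrix (Fin n) (Fin n) ℝ} (hS : S.IsHermitian)
    (y : EuclideanSpace ℝ (Fin n)) : quad (S * S) y = ‖act S y‖ ^ 2 := by
  rw [quad_eq_inner, ← real_inner_self_eq_norm_sq, inner_act_comm hS]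
  simp [act]

lemma hasFDerivAt_quad {S : Matrix (Fin n) (Fin n) ℝ} (hS : S.IsHermitian)
    (y : EuclideanSpace ℝ (Fin n)) :
    HasFDerivAt (quad S) (innerSL ℝ ((2 : ℝ) • act S y)) y := by
  have h := (hasFDerivAt_id y).inner ℝ (act S).hasFDerivAt
  have e : quad S = fun t => inner ℝ (id t) (act S t) := by
    ext t; simp [quad_eq_inner]
  rw [e]
  refine h.congr_fderiv ?_
  ext v
  simp only [fderivInnerCLM_apply, ContinuousLinearMap.comp_apply, ContinuousLinearMap.prod_apply,
    innerSL_apply_apply, inner_smul_left, id]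
  rw [← inner_act_comm hS]
  simp [real_inner_comm]
  rw [real_inner_comm]; ring

lemma continuous_quad (S : Matrix (Fin n) (Fin n) ℝ) : Continuous (quad S) := by
  have e : quad S = fun t => inner ℝ t (act S t) := by
    ext t; simp [quad_eq_inner]
  rw [e]; fun_prop

lemma contDiff_quad (S : Matrix (Fin n) (Fin n) ℝ) {k : WithTop ℕ∞} :
    ContDiff ℝ k (quad S) := by
  have e : quad S = fun t => inner ℝ t (act S t) := by
    ext t; simp [quad_eq_inner]
  rw [e]; exact contDiff_id.inner ℝ (act S).contDiff

/-- The trace of an endomorphism of `EuclideanSpace ℝ (Fin n)`, in the standard basis. -/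
noncomputable def trc (L : EuclideanSpace ℝ (Fin n) →L[ℝ] EuclideanSpace ℝ (Fin n)) : ℝ :=
  ∑ i, L (EuclideanSpace.single i 1) i

lemma trc_add (L M : EuclideanSpace ℝ (Fin n) →L[ℝ] EuclideanSpace ℝ (Fin n)) :
    trc (L + M) = trc L + trc M := by simp [trc, Finset.sum_add_distrib]

lemma trc_smul (r : ℝ) (L : EuclideanSpace ℝ (Fin n) →L[ℝ] EuclideanSpace ℝ (Fin n)) :
    trc (r • L) = r * trc L := by simp [trc, Finset.mul_sum]

lemma trc_smulRight (u w : EuclideanSpace ℝ (Fin n)) :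
    trc ((innerSL ℝ u).smulRight w) = inner ℝ u w := by
  simp [trc, PiLp.inner_apply, mul_comm]

lemma trc_id : trc (ContinuousLinearMap.id ℝ (EuclideanSpace ℝ (Fin n))) = n := by
  simp [trc]

lemma trc_act (S : Matrix (Fin n) (Fin n) ℝ) : trc (act S) = S.trace := by
  simp [trc, Matrix.trace, act, Matrix.ofLp_toEuclideanCLM]

lemma abs_trc_le (L : EuclideanSpace ℝ (Fin n) →L[ℝ] EuclideanSpace ℝ (Fin n)) :
    |trc L| ≤ n * ‖L‖ := by
  rw [trc]
  refine (Finset.abs_sum_le_sum_abs _ _).trans ?_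
  refine (Finset.sum_le_card_nsmul _ _ ‖L‖ fun i _ => ?_).trans (by simp)
  rw [← Real.norm_eq_abs]
  refine (PiLp.norm_apply_le _ i).trans ((L.le_opNorm _).trans (by simp))

lemma abs_trace_le (S : Matrix (Fin n) (Fin n) ℝ) : |S.trace| ≤ n * ‖S‖ := by
  rw [← trc_act, ← Matrix.l2_opNorm_toEuclideanCLM]
  exact abs_trc_le _

/-! ### Integrability against Gaussians -/

/-- The weight `(1 + |y|²)^k exp (-a |y|² / 2)`. -/
noncomputable def momentWeight (k : ℕ) (a : ℝ) (y : EuclideanSpace ℝ (Fin n)) : ℝ :=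
  (1 + ‖y‖ ^ 2) ^ k * Real.exp (-(a * ‖y‖ ^ 2 / 2))

lemma momentWeight_nonneg (k : ℕ) (a : ℝ) (y : EuclideanSpace ℝ (Fin n)) :
    0 ≤ momentWeight k a y := by unfold momentWeight; positivity

lemma continuous_momentWeight (k : ℕ) (a : ℝ) :
    Continuous (momentWeight k a : EuclideanSpace ℝ (Fin n) → ℝ) := by
  unfold momentWeight; fun_prop

lemma momentWeight_anti (k : ℕ) {a a' : ℝ} (h : a ≤ a') (y : EuclideanSpace ℝ (Fin n)) :
    momentWeight k a' y ≤ momentWeight k a y := by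
  unfold momentWeight
  gcongr

/-- The integral of a non-integrable function is zero by convention, whereas the Gaussian integral
has a known positive value. -/
lemma integrable_exp_neg_sq {a : ℝ} (ha : 0 < a) :
    Integrable fun y : EuclideanSpace ℝ (Fin n) => Real.exp (-a * ‖y‖ ^ 2) := by
  by_contra h
  have h1 := GaussianFourier.integral_rexp_neg_mul_sq_norm (V := EuclideanSpace ℝ (Fin n)) ha
  rw [integral_undef h] at h1
  have : 0 < (Real.pi / a) ^ ((Module.finrank ℝ (EuclideanSpace ℝ (Fin n)) : ℝ) / 2) := by
    positivity
  exact this.ne h1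

lemma momentWeight_le_exp (k : ℕ) {a : ℝ} (ha : 0 < a) :
    ∃ K, 0 ≤ K ∧ ∀ y : EuclideanSpace ℝ (Fin n),
      momentWeight k a y ≤ K * Real.exp (-(a / 4) * ‖y‖ ^ 2) := by
  -- The polynomial is absorbed by half of the Gaussian, through `x ^ k / k! ≤ exp x` at `x = (a /
  -- 4) (1 + |y|²)`.
  refine ⟨k.factorial * (a / 4)⁻¹ ^ k * Real.exp (a / 4), by positivity, fun y => ?_⟩
  have h := Real.pow_div_factorial_le_exp (a / 4 * (1 + ‖y‖ ^ 2)) (by positivity) k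
  rw [div_le_iff₀ (by positivity), mul_pow] at h
  have h2 : (1 + ‖y‖ ^ 2) ^ k
      ≤ k.factorial * (a / 4)⁻¹ ^ k * Real.exp (a / 4 * (1 + ‖y‖ ^ 2)) := by
    have h3 : (1 + ‖y‖ ^ 2) ^ k = (a / 4)⁻¹ ^ k * ((a / 4) ^ k * (1 + ‖y‖ ^ 2) ^ k) := by
      rw [← mul_assoc, ← mul_pow, inv_mul_cancel₀ (by positivity), one_pow, one_mul]
    rw [h3]
    calc _ ≤ (a / 4)⁻¹ ^ k * (Real.exp (a / 4 * (1 + ‖y‖ ^ 2)) * k.factorial) := by gcongr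
      _ = _ := by ring
  unfold momentWeight
  calc _ ≤ (k.factorial * (a / 4)⁻¹ ^ k * Real.exp (a / 4 * (1 + ‖y‖ ^ 2)))
        * Real.exp (-(a * ‖y‖ ^ 2 / 2)) := by gcongr
    _ = _ := by
      rw [mul_assoc, ← Real.exp_add, mul_assoc _ (Real.exp _), ← Real.exp_add]
      ring_nf

lemma integrable_momentWeight (k : ℕ) {a : ℝ} (ha : 0 < a) :
    Integrable (momentWeight k a : EuclideanSpace ℝ (Fin n) → ℝ) := by
  obtain ⟨K, -, hK⟩ := momentWeight_le_exp (n := n) k ha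
  refine ((integrable_exp_neg_sq (n := n) (a := a / 4) (by positivity)).const_mul K).mono'
    (continuous_momentWeight k a).aestronglyMeasurable (Eventually.of_forall fun y => ?_)
  rw [Real.norm_eq_abs, abs_of_nonneg (momentWeight_nonneg _ _ _)]
  exact hK y

lemma momentWeight_bounded (k : ℕ) {a : ℝ} (ha : 0 < a) :
    ∃ K, 0 ≤ K ∧ ∀ y : EuclideanSpace ℝ (Fin n), momentWeight k a y ≤ K := by
  obtain ⟨K, h0, hK⟩ := momentWeight_le_exp (n := n) k ha
  refine ⟨K, h0, fun y => (hK y).trans (mul_le_of_le_one_right h0 ?_)⟩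
  rw [Real.exp_le_one_iff]
  nlinarith [sq_nonneg ‖y‖]

lemma integrable_of_le_momentWeight {k : ℕ} {a K : ℝ} (ha : 0 < a)
    {f : EuclideanSpace ℝ (Fin n) → ℝ} (hf : AEStronglyMeasurable f volume)
    (h : ∀ᵐ y, |f y| ≤ K * momentWeight k a y) : Integrable f :=
  ((integrable_momentWeight k ha).const_mul K).mono' hf (by simpa using h)

/-- The moments `∫ (1 + |y|²)^k exp (-a |y|² / 2)`. -/
noncomputable def moment (n k : ℕ) (a : ℝ) : ℝ :=
  ∫ y : EuclideanSpace ℝ (Fin n), momentWeight k a y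

lemma moment_nonneg (k : ℕ) (a : ℝ) : 0 ≤ moment n k a :=
  integral_nonneg fun _ => momentWeight_nonneg _ _ _

lemma abs_integral_le_moment {k : ℕ} {a K : ℝ} (ha : 0 < a)
    {f : EuclideanSpace ℝ (Fin n) → ℝ} (h : ∀ᵐ y, |f y| ≤ K * momentWeight k a y) :
    |∫ y, f y| ≤ K * moment n k a := by
  rw [moment, ← integral_const_mul, ← Real.norm_eq_abs]
  exact norm_integral_le_of_norm_le ((integrable_momentWeight k ha).const_mul K) (by simpa using h)

/-! ### Gradients and Hessians -/

/-- `G` is the gradient and `H` the Hessian of `f`. -/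
structure HasGradHess (f : EuclideanSpace ℝ (Fin n) → ℝ)
    (G : EuclideanSpace ℝ (Fin n) → EuclideanSpace ℝ (Fin n))
    (H : EuclideanSpace ℝ (Fin n) → EuclideanSpace ℝ (Fin n) →L[ℝ] EuclideanSpace ℝ (Fin n)) :
    Prop where
  grad : ∀ y, HasFDerivAt f (innerSL ℝ (G y)) y
  hess : ∀ y, HasFDerivAt G (H y) y

/-- The vector that represents a linear functional. -/
noncomputable def rieszVec : (EuclideanSpace ℝ (Fin n) →L[ℝ] ℝ) →L[ℝ] EuclideanSpace ℝ (Fin n) :=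
  ∑ i, (ContinuousLinearMap.apply ℝ ℝ (EuclideanSpace.single i (1 : ℝ))).smulRight
    (EuclideanSpace.single i (1 : ℝ))

lemma inner_rieszVec (φ : EuclideanSpace ℝ (Fin n) →L[ℝ] ℝ) (v : EuclideanSpace ℝ (Fin n)) :
    inner ℝ (rieszVec φ) v = φ v := by
  have h : v = ∑ i, v i • EuclideanSpace.single i (1 : ℝ) := by
    ext j
    simp [Finset.sum_apply, Pi.single_apply]
  conv_rhs => rw [h, map_sum]
  simp [rieszVec, sum_inner, inner_smul_left, EuclideanSpace.inner_single_left, mul_comm]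

namespace HasGradHess

variable {f g : EuclideanSpace ℝ (Fin n) → ℝ}
  {G G' : EuclideanSpace ℝ (Fin n) → EuclideanSpace ℝ (Fin n)}
  {H H' : EuclideanSpace ℝ (Fin n) → EuclideanSpace ℝ (Fin n) →L[ℝ] EuclideanSpace ℝ (Fin n)}

lemma fderiv_apply (h : HasGradHess f G H) (y v : EuclideanSpace ℝ (Fin n)) :
    fderiv ℝ f y v = inner ℝ (G y) v := by
  rw [(h.grad y).fderiv, innerSL_apply_apply]

lemma laplacian_eq (h : HasGradHess f G H) (y : EuclideanSpace ℝ (Fin n)) :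
    Laplacian.laplacian f y = trc (H y) := by
  rw [InnerProductSpace.laplacian_eq_iteratedFDeriv_orthonormalBasis f
    (EuclideanSpace.basisFun (Fin n) ℝ)]
  refine Finset.sum_congr rfl fun i _ => ?_
  rw [iteratedFDeriv_two_apply]
  have e : fderiv ℝ f = fun y => innerSL ℝ (G y) := funext fun y => (h.grad y).fderiv
  rw [e]
  have h2 : HasFDerivAt (fun y => innerSL ℝ (G y)) ((innerSL ℝ).comp (H y)) y :=
    (innerSL ℝ (E := EuclideanSpace ℝ (Fin n))).hasFDerivAt.comp y (h.hess y)
  rw [h2.fderiv]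
  simp [EuclideanSpace.inner_single_right]

lemma continuous (h : HasGradHess f G H) : Continuous f :=
  continuous_iff_continuousAt.2 fun y => (h.grad y).continuousAt

lemma continuous_grad (h : HasGradHess f G H) : Continuous G :=
  continuous_iff_continuousAt.2 fun y => (h.hess y).continuousAt

lemma smul_grad {k : EuclideanSpace ℝ (Fin n) → ℝ} {Gk : EuclideanSpace ℝ (Fin n)}
    {L : EuclideanSpace ℝ (Fin n) →L[ℝ] EuclideanSpace ℝ (Fin n)} {y : EuclideanSpace ℝ (Fin n)}
    (hk : HasFDerivAt k (innerSL ℝ Gk) y) (hG : HasFDerivAt G L y) :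
    HasFDerivAt (fun y => k y • G y) (k y • L + (innerSL ℝ Gk).smulRight (G y)) y :=
  hk.smul hG

lemma mul (hf : HasGradHess f G H) (hg : HasGradHess g G' H') :
    HasGradHess (fun y => f y * g y) (fun y => f y • G' y + g y • G y)
      (fun y => (f y • H' y + (innerSL ℝ (G y)).smulRight (G' y))
        + (g y • H y + (innerSL ℝ (G' y)).smulRight (G y))) where
  grad y := ((hf.grad y).mul (hg.grad y)).congr_fderiv (by ext v; simp)
  hess y := (smul_grad (hf.grad y) (hg.hess y)).add (smul_grad (hg.grad y) (hf.hess y))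

/-- A smooth function with its gradient and Hessian. -/
lemma of_contDiff (hf : ContDiff ℝ ∞ f) :
    HasGradHess f (fun y => rieszVec (fderiv ℝ f y))
      (fderiv ℝ fun y => rieszVec (fderiv ℝ f y)) where
  grad y := by
    have h := (hf.differentiable (by simp) y).hasFDerivAt
    refine h.congr_fderiv ?_
    ext v
    simp [inner_rieszVec]
  hess y := by
    have h1 : ContDiff ℝ 1 (fderiv ℝ f) := hf.fderiv_right (by norm_cast)
    have h2 : ContDiff ℝ 1 fun y => rieszVec (fderiv ℝ f y) := rieszVec.contDiff.comp h1
    exact (h2.differentiable (by simp) y).hasFDerivAt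

lemma comp_smul (h : HasGradHess f G H) (r : ℝ) :
    HasGradHess (fun y => f (r • y)) (fun y => r • G (r • y)) (fun y => (r * r) • H (r • y)) where
  grad y := by
    have hs : HasFDerivAt (fun y : EuclideanSpace ℝ (Fin n) => r • y)
      (r • ContinuousLinearMap.id ℝ _) y := (hasFDerivAt_id y).const_smul r
    refine ((h.grad (r • y)).comp y hs).congr_fderiv ?_
    ext v; simp
  hess y := by
    have hs : HasFDerivAt (fun y : EuclideanSpace ℝ (Fin n) => r • y)
      (r • ContinuousLinearMap.id ℝ _) y := (hasFDerivAt_id y).const_smul r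
    refine (((h.hess (r • y)).comp y hs).const_smul r).congr_fderiv ?_
    ext1 v; simp [smul_smul]

end HasGradHess

/-- The divergence theorem for integrable vector fields on the whole space. -/
lemma integral_trc_eq_zero {Z : EuclideanSpace ℝ (Fin n) → EuclideanSpace ℝ (Fin n)}
    {Z' : EuclideanSpace ℝ (Fin n) → EuclideanSpace ℝ (Fin n) →L[ℝ] EuclideanSpace ℝ (Fin n)}
    (hZ : ∀ y, HasFDerivAt Z (Z' y) y) (hi : Integrable Z)
    (hi' : ∀ i, Integrable fun y => Z' y (EuclideanSpace.single i 1) i) :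
    ∫ y, trc (Z' y) = 0 := by
  simp only [trc]
  rw [integral_finsetSum _ fun i _ => hi' i]
  refine Finset.sum_eq_zero fun i _ => ?_
  have hproj : ∀ y, HasFDerivAt (fun y => Z y i) ((EuclideanSpace.proj i).comp (Z' y)) y :=
    fun y => (EuclideanSpace.proj (𝕜 := ℝ) i).hasFDerivAt.comp y (hZ y)
  have hpi : Integrable fun y => Z y i := (EuclideanSpace.proj (𝕜 := ℝ) i).integrable_comp hi
  -- Integration by parts against the constant function `1`, one coordinate at a time.
  have := integral_bilinear_hasFDerivAt_right_eq_neg_left_of_integrable (μ := volume)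
    (f := fun _ : EuclideanSpace ℝ (Fin n) => (1 : ℝ)) (f' := fun _ => 0)
    (g := fun y => Z y i) (g' := fun y => (EuclideanSpace.proj i).comp (Z' y))
    (v := EuclideanSpace.single i 1) (B := ContinuousLinearMap.mul ℝ ℝ)
    (by simp) (by simpa using hi' i) (by simpa using hpi)
    (fun y _ => hasFDerivAt_const _ _) (fun y _ => hproj y)
  simpa using this

/-! ### Quadratic polynomials times Gaussians -/

/-- The quadratic polynomial `s + y S y`. -/
noncomputable def qpoly (s : ℝ) (S : Matrix (Fin n) (Fin n) ℝ)
    (y : EuclideanSpace ℝ (Fin n)) : ℝ := s + quad S y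

/-- The Gaussian `exp (-a |y|² / 2)`. -/
noncomputable def gauss (a : ℝ) (y : EuclideanSpace ℝ (Fin n)) : ℝ :=
  Real.exp (-(a * ‖y‖ ^ 2 / 2))

lemma gauss_pos (a : ℝ) (y : EuclideanSpace ℝ (Fin n)) : 0 < gauss a y := Real.exp_pos _

lemma hasFDerivAt_gauss (a : ℝ) (y : EuclideanSpace ℝ (Fin n)) :
    HasFDerivAt (gauss a) (innerSL ℝ (-(a * gauss a y) • y)) y := by
  have h : HasFDerivAt (fun y : EuclideanSpace ℝ (Fin n) => ‖y‖ ^ 2) (2 • innerSL ℝ y) y :=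
    (hasStrictFDerivAt_norm_sq y).hasFDerivAt
  have h2 := ((h.const_mul a).mul_const (1 / 2)).neg.exp
  have e : gauss a = fun y : EuclideanSpace ℝ (Fin n) => Real.exp (-(a * ‖y‖ ^ 2 * (1 / 2))) := by
    ext y; rw [gauss]; ring_nf
  rw [e]
  refine h2.congr_fderiv ?_
  ext v
  simp
  ring

lemma contDiff_gauss (a : ℝ) {k : WithTop ℕ∞} :
    ContDiff ℝ k (gauss a : EuclideanSpace ℝ (Fin n) → ℝ) := by
  unfold gauss
  exact (((contDiff_norm_sq ℝ).const_smul a |>.div_const 2).neg).exp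

/-- The test function `(s + y S y) exp (-a |y|² / 2)`. -/
noncomputable def gtest (a s : ℝ) (S : Matrix (Fin n) (Fin n) ℝ)
    (y : EuclideanSpace ℝ (Fin n)) : ℝ := qpoly s S y * gauss a y

/-- The gradient of `gtest`. -/
noncomputable def gtestGrad (a s : ℝ) (S : Matrix (Fin n) (Fin n) ℝ)
    (y : EuclideanSpace ℝ (Fin n)) : EuclideanSpace ℝ (Fin n) :=
  gauss a y • ((2 : ℝ) • act S y - (a * qpoly s S y) • y)

/-- The Hessian of `gtest`. -/
noncomputable def gtestHess (a s : ℝ) (S : Matrix (Fin n) (Fin n) ℝ)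
    (y : EuclideanSpace ℝ (Fin n)) : EuclideanSpace ℝ (Fin n) →L[ℝ] EuclideanSpace ℝ (Fin n) :=
  gauss a y • ((2 : ℝ) • act S - ((a * qpoly s S y) • ContinuousLinearMap.id ℝ _
      + (innerSL ℝ (a • (2 : ℝ) • act S y)).smulRight y))
    + (innerSL ℝ (-(a * gauss a y) • y)).smulRight
        ((2 : ℝ) • act S y - (a * qpoly s S y) • y)

lemma hasFDerivAt_qpoly (s : ℝ) {S : Matrix (Fin n) (Fin n) ℝ} (hS : S.IsHermitian)
    (y : EuclideanSpace ℝ (Fin n)) :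
    HasFDerivAt (qpoly s S) (innerSL ℝ ((2 : ℝ) • act S y)) y :=
  (hasFDerivAt_quad hS y).const_add s

lemma hasGradHess_gtest (a s : ℝ) {S : Matrix (Fin n) (Fin n) ℝ} (hS : S.IsHermitian) :
    HasGradHess (gtest a s S) (gtestGrad a s S) (gtestHess a s S) where
  grad y := by
    refine ((hasFDerivAt_qpoly s hS y).mul (hasFDerivAt_gauss a y)).congr_fderiv ?_
    ext v
    simp [gtestGrad]
    ring
  hess y := by
    have h1 : HasFDerivAt (fun y => a * qpoly s S y) (innerSL ℝ (a • (2 : ℝ) • act S y)) y := by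
      refine ((hasFDerivAt_qpoly s hS y).const_mul a).congr_fderiv ?_
      ext v; simp
    have h2 := HasGradHess.smul_grad h1 (hasFDerivAt_id y)
    have h3 := ((act S).hasFDerivAt (x := y)).const_smul (2 : ℝ)
    exact HasGradHess.smul_grad (hasFDerivAt_gauss a y) (h3.sub h2)

/-- On `gtest`, the adjoint operator acts within the quadratic polynomials times the Gaussian. -/
lemma adjointOp_gtest (p a s : ℝ) {S : Matrix (Fin n) (Fin n) ℝ} (hS : S.IsHermitian)
    (y : EuclideanSpace ℝ (Fin n)) :
    adjointOp p a (gtest a s S) y =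
      gtest a (2 * S.trace - 2 * a / (p - 1) * s) ((-(2 * a + 2 * a / (p - 1))) • S) y := by
  have h := hasGradHess_gtest a s hS
  -- For `ψ = q gauss`, the terms `a² |y|² q` and `a n q` from the Laplacian cancel against those of
  -- `a ∇·(yψ)`. What is left is `Δq - a y·∇q - 2a/(p-1) q`, which preserves the degree of `q`.
  rw [adjointOp, h.laplacian_eq, h.fderiv_apply]
  simp only [gtestHess, gtestGrad, sub_eq_add_neg, ← neg_one_smul ℝ (_ + _ : _ →L[ℝ] _),
    trc_add, trc_smul,
      trc_smulRight, trc_id, trc_act]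
  simp only [gtest, qpoly, quad_smul]
  simp only [quad_eq_inner, inner_add_left, inner_add_right,
    inner_smul_left, inner_smul_right, inner_neg_left, inner_neg_right, real_inner_comm y (act S y),
    real_inner_self_eq_norm_sq]
  simp
  ring

/-! ### The profile -/

section Profile

variable {p a : ℝ} {b : Matrix (Fin n) (Fin n) ℝ}

/-- The denominator `p - 1 + y b y` of the profile. -/
noncomputable def den (p : ℝ) (b : Matrix (Fin n) (Fin n) ℝ) (y : EuclideanSpace ℝ (Fin n)) : ℝ :=
  p - 1 + quad b y

lemma profile_eq (p a : ℝ) (b : Matrix (Fin n) (Fin n) ℝ) (y : EuclideanSpace ℝ (Fin n)) :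
    profile p a b y = ((a + 1 / 2) / den p b y) ^ (1 / (p - 1)) := rfl

lemma le_den (hb : b.PosSemidef) (y : EuclideanSpace ℝ (Fin n)) : p - 1 ≤ den p b y := by
  have := quad_nonneg hb y
  unfold den; linarith

lemma den_pos (hp : 1 < p) (hb : b.PosSemidef) (y : EuclideanSpace ℝ (Fin n)) : 0 < den p b y :=
  (sub_pos.2 hp).trans_le (le_den hb y)

lemma profile_pos (hp : 1 < p) (ha : 0 < a) (hb : b.PosSemidef) (y : EuclideanSpace ℝ (Fin n)) :
    0 < profile p a b y := by
  have := den_pos hp hb y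
  rw [profile_eq]; positivity

lemma profile_le (hp : 1 < p) (ha : 0 < a) (hb : b.PosSemidef) (y : EuclideanSpace ℝ (Fin n)) :
    profile p a b y ≤ ((a + 1 / 2) / (p - 1)) ^ (1 / (p - 1)) := by
  have h1 := den_pos hp hb y
  have h2 := sub_pos.2 hp
  rw [profile_eq]
  have := le_den (p := p) hb y
  gcongr

lemma profile_rpow_sub_one (hp : 1 < p) (ha : 0 < a) (hb : b.PosSemidef)
    (y : EuclideanSpace ℝ (Fin n)) :
    profile p a b y ^ (p - 1) = (a + 1 / 2) / den p b y := by
  have h1 := den_pos hp hb y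
  have h2 := sub_pos.2 hp
  rw [profile_eq, ← Real.rpow_mul (by positivity), one_div_mul_cancel h2.ne', Real.rpow_one]

lemma profile_rpow (hp : 1 < p) (ha : 0 < a) (hb : b.PosSemidef)
    (y : EuclideanSpace ℝ (Fin n)) :
    profile p a b y ^ p = profile p a b y * ((a + 1 / 2) / den p b y) := by
  rw [← profile_rpow_sub_one hp ha hb, mul_comm, ← Real.rpow_add_one (profile_pos hp ha hb y).ne',
    sub_add_cancel]

lemma hasFDerivAt_den (hb : b.IsHermitian) (y : EuclideanSpace ℝ (Fin n)) :
    HasFDerivAt (den p b) (innerSL ℝ ((2 : ℝ) • act b y)) y :=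
  (hasFDerivAt_quad hb y).const_add _

lemma continuous_den (p : ℝ) (b : Matrix (Fin n) (Fin n) ℝ) : Continuous (den p b) :=
  continuous_const.add (continuous_quad b)

/-- The derivative of `(c, x) ↦ (c / x) ^ r`, along a curve. -/
lemma hasDerivWithinAt_div_rpow {c x : ℝ → ℝ} {c' x' t r : ℝ} {I : Set ℝ}
    (hc : HasDerivWithinAt c c' I t) (hx : HasDerivWithinAt x x' I t) (hc0 : 0 < c t)
    (hx0 : 0 < x t) :
    HasDerivWithinAt (fun t => (c t / x t) ^ r)
      ((c t / x t) ^ r * (r * (c' / c t - x' / x t))) I t := by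
  have h := (hc.div hx hx0.ne').rpow_const (p := r) (Or.inl (div_pos hc0 hx0).ne')
  refine h.congr_deriv ?_
  simp only [Pi.div_apply]
  rw [Real.rpow_sub_one (div_pos hc0 hx0).ne']
  field_simp

lemma hasDerivAt_const_div_rpow {c x r : ℝ} (hc : 0 < c) (hx : 0 < x) :
    HasDerivAt (fun x => (c / x) ^ r) (-(r * (c / x) ^ r / x)) x := by
  have h := hasDerivWithinAt_div_rpow (r := r) (hasDerivWithinAt_const x Set.univ c)
    (hasDerivWithinAt_id x Set.univ) hc hx
  rw [hasDerivWithinAt_univ] at h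
  refine h.congr_deriv ?_
  simp only [id]
  ring

lemma hasFDerivAt_profile (hp : 1 < p) (ha : 0 < a) (hb : b.PosSemidef)
    (y : EuclideanSpace ℝ (Fin n)) :
    HasFDerivAt (profile p a b)
      (innerSL ℝ ((-(2 / (p - 1)) * (profile p a b y / den p b y)) • act b y)) y := by
  have hd := den_pos hp hb y
  have h := (hasDerivAt_const_div_rpow (c := a + 1 / 2) (r := 1 / (p - 1)) (by positivity)
    hd).comp_hasFDerivAt y (hasFDerivAt_den (p := p) hb.1 y)
  refine h.congr_fderiv ?_
  ext v
  simp [profile_eq]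
  ring

/-- The gradient of the profile. -/
noncomputable def profileGrad (p a : ℝ) (b : Matrix (Fin n) (Fin n) ℝ)
    (y : EuclideanSpace ℝ (Fin n)) : EuclideanSpace ℝ (Fin n) :=
  (-(2 / (p - 1)) * (profile p a b y / den p b y)) • act b y

/-- The Hessian of the profile. -/
noncomputable def profileHess (p a : ℝ) (b : Matrix (Fin n) (Fin n) ℝ)
    (y : EuclideanSpace ℝ (Fin n)) : EuclideanSpace ℝ (Fin n) →L[ℝ] EuclideanSpace ℝ (Fin n) :=
  (-(2 / (p - 1)) * (profile p a b y / den p b y)) • act b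
    + (innerSL ℝ ((4 * p / (p - 1) ^ 2 * (profile p a b y / den p b y ^ 2)) • act b y)).smulRight
        (act b y)

lemma hasGradHess_profile (hp : 1 < p) (ha : 0 < a) (hb : b.PosSemidef) :
    HasGradHess (profile p a b) (profileGrad p a b) (profileHess p a b) where
  grad := hasFDerivAt_profile hp ha hb
  hess y := by
    have hd := den_pos hp hb y
    have h2 := sub_pos.2 hp
    refine HasGradHess.smul_grad ?_ (act b).hasFDerivAt
    have hinv := (hasDerivAt_inv hd.ne').comp_hasFDerivAt y (hasFDerivAt_den (p := p) hb.1 y)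
    have h := ((hasFDerivAt_profile hp ha hb y).mul hinv).const_mul (-(2 / (p - 1)))
    refine h.congr_fderiv ?_
    ext v
    simp
    field_simp
    ring

/-- The operator `Δ - a y·∇ - 2a/(p-1)`, applied to the profile, plus the nonlinearity. -/
lemma source_eq (hp : 1 < p) (ha : 0 < a) (hb : b.PosSemidef) (a' : ℝ)
    (b' : Matrix (Fin n) (Fin n) ℝ) (y : EuclideanSpace ℝ (Fin n)) :
    Laplacian.laplacian (profile p a b) y - a * fderiv ℝ (profile p a b) y y
        - 2 * a / (p - 1) * profile p a b y + profile p a b y ^ p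
        - profile p a b y
          * (1 / (p - 1) * (a' / (a + 1 / 2) - quad b' y / den p b y)) =
      profile p a b y / ((p - 1) * den p b y) *
        (4 * p / (p - 1) * ‖act b y‖ ^ 2 / den p b y - 2 * b.trace + (p - 1) * (1 / 2 - a)
          - a' / (a + 1 / 2) * den p b y + quad b' y) := by
  have h := hasGradHess_profile hp ha hb
  rw [h.laplacian_eq, h.fderiv_apply, profile_rpow hp ha hb]
  simp only [profileGrad, profileHess, trc_add, trc_smul, trc_act, trc_smulRight, inner_smul_left,
    real_inner_self_eq_norm_sq, real_inner_comm y (act b y), ← quad_eq_inner]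
  have hd := den_pos hp hb y
  have h2 := sub_pos.2 hp
  have e : quad b y = den p b y - (p - 1) := by unfold den; ring
  rw [e]
  simp only [conj_trivial]
  field_simp
  ring

lemma hasDerivWithinAt_quad {B : ℝ → Matrix (Fin n) (Fin n) ℝ} {B' : Matrix (Fin n) (Fin n) ℝ}
    {t : ℝ} {I : Set ℝ} (hB : HasDerivWithinAt B B' I t) (y : EuclideanSpace ℝ (Fin n)) :
    HasDerivWithinAt (fun t => quad (B t) y) (quad B' y) I t := by
  let L : Matrix (Fin n) (Fin n) ℝ →ₗ[ℝ] ℝ :=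
    { toFun := fun S => quad S y
      map_add' := fun S S' => quad_add S S' y
      map_smul' := fun r S => quad_smul r S y }
  exact (L.toContinuousLinearMap.hasFDerivAt (x := B t)).comp_hasDerivWithinAt t hB

lemma hasDerivWithinAt_profile (hp : 1 < p) {α : ℝ → ℝ} {B : ℝ → Matrix (Fin n) (Fin n) ℝ} {α' : ℝ}
    {B' : Matrix (Fin n) (Fin n) ℝ} {t : ℝ} {I : Set ℝ} (hα : HasDerivWithinAt α α' I t)
    (hB : HasDerivWithinAt B B' I t) (ha : 0 < α t) (hb : (B t).PosSemidef)
    (y : EuclideanSpace ℝ (Fin n)) :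
    HasDerivWithinAt (fun t => profile p (α t) (B t) y)
      (profile p (α t) (B t) y
        * (1 / (p - 1) * (α' / (α t + 1 / 2) - quad B' y / den p (B t) y))) I t :=
  hasDerivWithinAt_div_rpow (hα.add_const _) ((hasDerivWithinAt_quad hB y).const_add _)
    (by positivity) (den_pos hp hb y)

/-- The line `b + s b'` may leave the cone of positive matrices, but the derivative at `s = 0` only
needs positivity there. -/
lemma source_eq_expanded (hp : 1 < p) (ha : 0 < a) (hb : b.PosSemidef) (a' : ℝ)
    (b' : Matrix (Fin n) (Fin n) ℝ) (y : EuclideanSpace ℝ (Fin n)) :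
    source p a b a' b' y =
      profile p a b y / ((p - 1) * den p b y) *
        (4 * p / (p - 1) * ‖act b y‖ ^ 2 / den p b y - 2 * b.trace + (p - 1) * (1 / 2 - a)
          - a' / (a + 1 / 2) * den p b y + quad b' y) := by
  rw [← source_eq hp ha hb, source]
  congr 1
  have h1 : HasDerivWithinAt (fun s : ℝ => a + s * a') a' Set.univ 0 :=
    (((hasDerivAt_id (0 : ℝ)).mul_const a').const_add a).hasDerivWithinAt.congr_deriv (by simp)
  have h2 : HasDerivWithinAt (fun s : ℝ => b + s • b') b' Set.univ 0 :=
    (((hasDerivAt_id (0 : ℝ)).smul_const b').const_add b).hasDerivWithinAt.congr_deriv (by simp)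
  have h := hasDerivWithinAt_profile hp h1 h2 (by simpa using ha) (by simpa using hb) y
  rw [hasDerivWithinAt_univ] at h
  rw [h.deriv]
  simp

/-- The source term, in terms of the remainders of the effective equations. -/
lemma source_velocity (hp : 1 < p) (ha : 0 < a) (hb : b.PosSemidef) (ra : ℝ)
    (rb : Matrix (Fin n) (Fin n) ℝ) (y : EuclideanSpace ℝ (Fin n)) :
    source p a b (velocityA p a b ra) (velocityB p a b rb) y =
      -(profile p a b y / ((p - 1) * den p b y) *
        (qpoly ((p - 1) * ra) (ra • b - rb) y
          + 4 * p / (p - 1) ^ 2 * ‖act b y‖ ^ 2 * quad b y / den p b y)) := by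
  rw [source_eq_expanded hp ha hb]
  have hd := den_pos hp hb y
  have h2 := sub_pos.2 hp
  simp only [velocityA, velocityB, qpoly, quad_sub, quad_add, quad_smul, quad_neg,
    quad_mul_self hb.1]
  -- The explicit part of (2) is exactly what cancels the constant and the quadratic polynomial in
  -- the bracket. Its `b²` term replaces `1 / den` by `1 / (p - 1)`, and the error of this
  -- replacement is the term of third order in `b`.
  have e : quad b y = den p b y - (p - 1) := by unfold den; ring
  rw [e]
  field_simp
  ring

end Profile

/-! ### Bounds for test functions and integration by parts -/

lemma norm_sub_add_add_le {F : Type*} [SeminormedAddCommGroup F] (A B C D : F) :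
    ‖A - (B + C) + D‖ ≤ ‖A‖ + (‖B‖ + ‖C‖) + ‖D‖ :=
  norm_add_le_of_le (norm_sub_le_of_le le_rfl (norm_add_le _ _)) le_rfl

lemma norm_smulRight_innerSL (u w : EuclideanSpace ℝ (Fin n)) :
    ‖(innerSL ℝ u).smulRight w‖ = ‖u‖ * ‖w‖ := by
  rw [ContinuousLinearMap.norm_smulRight_apply, innerSL_apply_norm]

lemma norm_le_one_add_sq (y : EuclideanSpace ℝ (Fin n)) : ‖y‖ ≤ 1 + ‖y‖ ^ 2 := by
  nlinarith [sq_nonneg (‖y‖ - 1), norm_nonneg y]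

lemma abs_qpoly_le (s : ℝ) (S : Matrix (Fin n) (Fin n) ℝ) (y : EuclideanSpace ℝ (Fin n)) :
    |qpoly s S y| ≤ (|s| + ‖S‖) * (1 + ‖y‖ ^ 2) := by
  have h1 := abs_add_le s (quad S y)
  have h2 := abs_quad_le S y
  unfold qpoly
  nlinarith [norm_nonneg S, abs_nonneg s, sq_nonneg ‖y‖, mul_nonneg (abs_nonneg s) (sq_nonneg ‖y‖)]

lemma abs_gtest_le (a s : ℝ) (S : Matrix (Fin n) (Fin n) ℝ) (y : EuclideanSpace ℝ (Fin n)) :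
    |gtest a s S y| ≤ (|s| + ‖S‖) * momentWeight 1 a y := by
  rw [gtest, abs_mul, abs_of_pos (gauss_pos a y), momentWeight, pow_one, ← mul_assoc]
  exact mul_le_mul_of_nonneg_right (abs_qpoly_le s S y) (gauss_pos a y).le

/-- Gaussian bounds for a function, its gradient and its Hessian. -/
structure GaussBound (g : EuclideanSpace ℝ (Fin n) → ℝ)
    (G : EuclideanSpace ℝ (Fin n) → EuclideanSpace ℝ (Fin n))
    (H : EuclideanSpace ℝ (Fin n) → EuclideanSpace ℝ (Fin n) →L[ℝ] EuclideanSpace ℝ (Fin n))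
    (K α : ℝ) : Prop where
  fn : ∀ y, |g y| ≤ K * momentWeight 2 α y
  grad : ∀ y, ‖G y‖ ≤ K * momentWeight 2 α y
  hess : ∀ y, ‖H y‖ ≤ K * momentWeight 2 α y

/-- Each derivative of the Gaussian brings a factor `a y`, so two derivatives produce polynomials of
degree at most four. Hence the exponent `2` in the weight. The constant is the one that the Hessian
requires. -/
lemma gaussBound_gtest {a : ℝ} (ha : 0 < a) (s : ℝ) (S : Matrix (Fin n) (Fin n) ℝ) :
    GaussBound (gtest a s S) (gtestGrad a s S) (gtestHess a s S)
      ((|s| + ‖S‖) * (2 + 5 * a + a ^ 2)) a := by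
  set N := |s| + ‖S‖ with hN
  have hSN : ‖S‖ ≤ N := by simp [hN]
  have hN0 : 0 ≤ N := by positivity
  have key : ∀ (y : EuclideanSpace ℝ (Fin n)) (r : ℝ),
      r ≤ N * (2 + 5 * a + a ^ 2) * (1 + ‖y‖ ^ 2) ^ 2 →
      gauss a y * r ≤ N * (2 + 5 * a + a ^ 2) * momentWeight 2 a y := fun y r h => by
    rw [momentWeight, ← mul_assoc, mul_comm (gauss a y)]
    exact mul_le_mul_of_nonneg_right h (gauss_pos a y).le
  have hX : ∀ y : EuclideanSpace ℝ (Fin n), 1 ≤ 1 + ‖y‖ ^ 2 := fun y => by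
    nlinarith [sq_nonneg ‖y‖]
  have hact : ∀ y, ‖act S y‖ ≤ N * ‖y‖ := fun y => (norm_act_le S y).trans (by gcongr)
  have hq := abs_qpoly_le s S
  rw [← hN] at hq
  have hinner : ∀ y, ‖(2 : ℝ) • act S y - (a * qpoly s S y) • y‖
      ≤ N * ‖y‖ * (2 + a * (1 + ‖y‖ ^ 2)) := fun y => by
    refine (norm_sub_le _ _).trans ?_
    rw [norm_smul, norm_smul, Real.norm_eq_abs, Real.norm_eq_abs, abs_mul, abs_of_pos ha,
      abs_of_pos (by norm_num : (0 : ℝ) < 2)]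
    have := mul_le_mul_of_nonneg_right (hq y) (norm_nonneg y)
    nlinarith [hact y, mul_le_mul_of_nonneg_left this ha.le]
  refine ⟨fun y => ?_, fun y => ?_, fun y => ?_⟩
  · rw [gtest, mul_comm, abs_mul, abs_of_pos (gauss_pos a y)]
    refine key y _ ((hq y).trans ?_)
    have h1 : (1 : ℝ) ≤ 2 + 5 * a + a ^ 2 := by nlinarith
    calc N * (1 + ‖y‖ ^ 2) = N * 1 * (1 + ‖y‖ ^ 2) ^ 1 := by ring
      _ ≤ _ := by gcongr <;> first | exact hX y | norm_num
  · rw [gtestGrad, norm_smul, Real.norm_eq_abs, abs_of_pos (gauss_pos a y)]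
    refine key y _ ((hinner y).trans ?_)
    have := norm_le_one_add_sq y
    set X := 1 + ‖y‖ ^ 2 with hXd
    have h1 := hX y
    rw [← hXd] at h1
    calc N * ‖y‖ * (2 + a * X) ≤ N * X * ((2 + a) * X) := by
            gcongr
            nlinarith
      _ = N * (2 + a) * X ^ 2 := by ring
      _ ≤ _ := mul_le_mul_of_nonneg_right
          (mul_le_mul_of_nonneg_left (by nlinarith) hN0) (by positivity)
  -- The Gaussian is factored out so that only a polynomial bound remains.
  · have e : gtestHess a s S y = gauss a y • (((2 : ℝ) • act S -
        ((a * qpoly s S y) • ContinuousLinearMap.id ℝ _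
        + (innerSL ℝ (a • (2 : ℝ) • act S y)).smulRight y))
        + (innerSL ℝ (-a • y)).smulRight
        ((2 : ℝ) • act S y - (a * qpoly s S y) • y)) := by
      rw [gtestHess, smul_add (gauss a y)]
      congr 1
      ext1 v
      simp only [ContinuousLinearMap.smulRight_apply, innerSL_apply_apply, inner_smul_left,
        smul_apply, smul_smul, conj_trivial]
      congr 1
      ring
    rw [e, norm_smul, Real.norm_eq_abs, abs_of_pos (gauss_pos a y)]
    refine key y _ ?_
    refine (norm_sub_add_add_le _ _ _ _).trans ?_
    rw [norm_smulRight_innerSL, norm_smulRight_innerSL, norm_smul, norm_smul, norm_smul, norm_smul,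
      norm_smul, Matrix.l2_opNorm_toEuclideanCLM]
    simp only [Real.norm_eq_abs, abs_mul, abs_neg, abs_of_pos ha,
      abs_of_pos (by norm_num : (0 : ℝ) < 2)]
    have hid : ‖ContinuousLinearMap.id ℝ (EuclideanSpace ℝ (Fin n))‖ ≤ 1 :=
      ContinuousLinearMap.norm_id_le
    have h1 := hX y
    have hy2 : ‖y‖ * ‖y‖ ≤ 1 + ‖y‖ ^ 2 := by nlinarith
    set X := 1 + ‖y‖ ^ 2 with hXd
    calc _ ≤ 2 * N + (a * (N * X) * 1 + a * (2 * (N * ‖y‖)) * ‖y‖)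
          + a * ‖y‖ * (N * ‖y‖ * (2 + a * X)) := by
            gcongr
            · exact hq y
            · exact hact y
            · exact hinner y
      _ = 2 * N + a * (N * X) + 2 * a * N * (‖y‖ * ‖y‖) + a * N * (2 + a * X) * (‖y‖ * ‖y‖) := by
            ring
      _ ≤ 2 * N + a * (N * X) + 2 * a * N * X + a * N * (2 + a * X) * X := by gcongr
      _ = N * (2 * (1 * 1) + 5 * a * (1 * X) + a ^ 2 * X ^ 2) := by ring
      _ ≤ N * (2 * (X * X) + 5 * a * (X * X) + a ^ 2 * X ^ 2) := by gcongr
      _ = _ := by ring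

lemma HasGradHess.adjointOp_eq {g : EuclideanSpace ℝ (Fin n) → ℝ}
    {G : EuclideanSpace ℝ (Fin n) → EuclideanSpace ℝ (Fin n)}
    {H : EuclideanSpace ℝ (Fin n) → EuclideanSpace ℝ (Fin n) →L[ℝ] EuclideanSpace ℝ (Fin n)}
    (h : HasGradHess g G H) (p a : ℝ) (y : EuclideanSpace ℝ (Fin n)) :
    adjointOp p a g y = trc (H y) + a * (n * g y + inner ℝ (G y) y) - 2 * a / (p - 1) * g y := by
  rw [adjointOp, h.laplacian_eq, h.fderiv_apply]

/-- The Fréchet derivative of any map here is measurable, so continuity of second derivatives is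
never needed. -/
lemma HasGradHess.measurable_hess {g : EuclideanSpace ℝ (Fin n) → ℝ}
    {G : EuclideanSpace ℝ (Fin n) → EuclideanSpace ℝ (Fin n)}
    {H : EuclideanSpace ℝ (Fin n) → EuclideanSpace ℝ (Fin n) →L[ℝ] EuclideanSpace ℝ (Fin n)}
    (h : HasGradHess g G H) : Measurable H := by
  have e : H = fderiv ℝ G := funext fun y => (h.hess y).fderiv.symm
  rw [e]
  exact measurable_fderiv ℝ G

lemma continuous_trc :
    Continuous (trc : (EuclideanSpace ℝ (Fin n) →L[ℝ] EuclideanSpace ℝ (Fin n)) → ℝ) := by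
  unfold trc
  fun_prop

lemma mul_momentWeight (k : ℕ) (α : ℝ) (y : EuclideanSpace ℝ (Fin n)) :
    (1 + ‖y‖ ^ 2) * momentWeight k α y = momentWeight (k + 1) α y := by
  unfold momentWeight; ring

/-- Green's identity: the integrand is the divergence of `f ∇g - g ∇f + a f g y`. Polynomial growth
of `f` against Gaussian decay of `g` makes this field and its derivatives integrable, so there is no
boundary term. -/
lemma HasGradHess.integral_adjointOp {f g : EuclideanSpace ℝ (Fin n) → ℝ}
    {G G' : EuclideanSpace ℝ (Fin n) → EuclideanSpace ℝ (Fin n)}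
    {H H' : EuclideanSpace ℝ (Fin n) → EuclideanSpace ℝ (Fin n) →L[ℝ] EuclideanSpace ℝ (Fin n)}
    (hf : HasGradHess f G H) (hg : HasGradHess g G' H') (p a : ℝ) {α K K' : ℝ} (hα : 0 < α)
    (hfb : ∀ y, |f y| ≤ K * (1 + ‖y‖ ^ 2)) (hGb : ∀ y, ‖G y‖ ≤ K * (1 + ‖y‖ ^ 2))
    (hHb : ∀ y, ‖H y‖ ≤ K * (1 + ‖y‖ ^ 2)) (hgb : GaussBound g G' H' K' α) :
    ∫ y, (f y * adjointOp p a g y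
      - (Laplacian.laplacian f y - a * fderiv ℝ f y y - 2 * a / (p - 1) * f y) * g y) = 0 := by
  have hfun : (fun y => f y * adjointOp p a g y
      - (Laplacian.laplacian f y - a * fderiv ℝ f y y - 2 * a / (p - 1) * f y) * g y) =
      fun y => trc (((f y • H' y + (innerSL ℝ (G y)).smulRight (G' y))
        - (g y • H y + (innerSL ℝ (G' y)).smulRight (G y)))
        + ((a * (f y * g y)) • ContinuousLinearMap.id ℝ _
          + (innerSL ℝ (a • (f y • G' y + g y • G y))).smulRight y)) := by
    ext y
    rw [hg.adjointOp_eq, hf.laplacian_eq, hf.fderiv_apply]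
    simp only [sub_eq_add_neg, ← neg_one_smul ℝ (_ + _ : _ →L[ℝ] _), trc_add, trc_smul,
      trc_smulRight, trc_id,
      inner_add_left, inner_smul_left, real_inner_comm (G y) (G' y), conj_trivial]
    ring
  have hfc := hf.continuous
  have hgc := hg.continuous
  have hGc := hf.continuous_grad
  have hGc' := hg.continuous_grad
  have hK : 0 ≤ K := by
    have := (abs_nonneg _).trans (hfb 0)
    simpa using this
  have hgw := hgb.fn
  have hGw := hgb.grad
  have hHw := hgb.hess
  have hw0 := momentWeight_nonneg (n := n) 2 α
  rw [hfun]
  refine integral_trc_eq_zero (Z := fun y => (f y • G' y - g y • G y) + (a * (f y * g y)) • y)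
    (fun y => ?_) ?_ fun i => ?_
  · have h1 := HasGradHess.smul_grad (hf.grad y) (hg.hess y)
    have h2 := HasGradHess.smul_grad (hg.grad y) (hf.hess y)
    have h3 : HasFDerivAt (fun y => a * (f y * g y)) (innerSL ℝ (a • (f y • G' y + g y • G y))) y :=
      (((hf.mul hg).grad y).const_mul a).congr_fderiv (by ext v; simp)
    exact (h1.sub h2).add (HasGradHess.smul_grad h3 (hasFDerivAt_id y))
  · refine ((integrable_momentWeight (n := n) 4 hα).const_mul ((2 + |a|) * (K * K'))).mono'
      (by fun_prop) (Eventually.of_forall fun y => ?_)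
    refine (norm_add_le_of_le (norm_sub_le_of_le (norm_smul_le _ _) (norm_smul_le _ _))
      (norm_smul_le _ _)).trans ?_
    simp only [Real.norm_eq_abs, abs_mul]
    rw [← mul_momentWeight 3, ← mul_momentWeight 2]
    set X := 1 + ‖y‖ ^ 2
    have hy : ‖y‖ ≤ X := norm_le_one_add_sq y
    have hX : 1 ≤ X := by simp [X]
    have hg0 : 0 ≤ K' * momentWeight 2 α y := (abs_nonneg _).trans (hgw y)
    calc _ ≤ K * X * (K' * momentWeight 2 α y) + (K' * momentWeight 2 α y) * (K * X)
          + |a| * ((K * X) * (K' * momentWeight 2 α y)) * X := by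
            gcongr <;> first | exact hfb y | exact hGw y | exact hgw y | exact hGb y
      _ = (2 * (X * 1) + |a| * (X * X)) * (K * (K' * momentWeight 2 α y)) := by ring
      _ ≤ (2 * (X * X) + |a| * (X * X)) * (K * (K' * momentWeight 2 α y)) := by gcongr
      _ = _ := by ring
  · have hHm := hf.measurable_hess
    have hHm' := hg.measurable_hess
    have hmeas : Measurable fun y => (((f y • H' y + (innerSL ℝ (G y)).smulRight (G' y))
        - (g y • H y + (innerSL ℝ (G' y)).smulRight (G y)))
        + ((a * (f y * g y)) • ContinuousLinearMap.id ℝ (EuclideanSpace ℝ (Fin n))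
          + (innerSL ℝ (a • (f y • G' y + g y • G y))).smulRight y))
        (EuclideanSpace.single i 1) i := by
      simp only [add_apply, sub_apply,
        smul_apply, ContinuousLinearMap.smulRight_apply, innerSL_apply_apply,
        PiLp.add_apply, PiLp.sub_apply, PiLp.smul_apply]
      have m1 : Measurable fun y => H y (EuclideanSpace.single i 1) i :=
        (EuclideanSpace.proj (𝕜 := ℝ) i).continuous.measurable.comp
          (hHm.apply_continuousLinearMap _)
      have m2 : Measurable fun y => H' y (EuclideanSpace.single i 1) i :=
        (EuclideanSpace.proj (𝕜 := ℝ) i).continuous.measurable.comp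
          (hHm'.apply_continuousLinearMap _)
      have c1 : Continuous fun y => G y i := (EuclideanSpace.proj (𝕜 := ℝ) i).continuous.comp hGc
      have c2 : Continuous fun y => G' y i := (EuclideanSpace.proj (𝕜 := ℝ) i).continuous.comp hGc'
      have c3 : Continuous fun y : EuclideanSpace ℝ (Fin n) => y i :=
        (EuclideanSpace.proj (𝕜 := ℝ) i).continuous
      simp only [smul_eq_mul]
      have := hfc.measurable
      have := hgc.measurable
      refine ((((by fun_prop : Measurable f).mul m2).add ?_).sub
        (((by fun_prop : Measurable g).mul m1).add ?_)).add ?_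
      all_goals exact (by fun_prop : Continuous _).measurable
    refine ((integrable_momentWeight (n := n) 4 hα).const_mul ((4 + 3 * |a|) * (K * K'))).mono'
      hmeas.aestronglyMeasurable (Eventually.of_forall fun y => ?_)
    refine (PiLp.norm_apply_le _ i).trans ((ContinuousLinearMap.le_opNorm _ _).trans ?_)
    rw [PiLp.norm_single, norm_one, mul_one]
    refine (norm_add_le_of_le (norm_sub_le_of_le (norm_add_le_of_le (norm_smul_le _ _) le_rfl)
      (norm_add_le_of_le (norm_smul_le _ _) le_rfl))
      (norm_add_le_of_le (norm_smul_le _ _) le_rfl)).trans ?_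
    rw [norm_smulRight_innerSL, norm_smulRight_innerSL, norm_smulRight_innerSL, norm_smul]
    have hadd : ‖f y • G' y + g y • G y‖ ≤ |f y| * ‖G' y‖ + |g y| * ‖G y‖ := by
      refine (norm_add_le _ _).trans (by rw [norm_smul, norm_smul]; rfl)
    simp only [Real.norm_eq_abs, abs_mul]
    rw [← mul_momentWeight 3, ← mul_momentWeight 2]
    have hid : ‖ContinuousLinearMap.id ℝ (EuclideanSpace ℝ (Fin n))‖ ≤ 1 :=
      ContinuousLinearMap.norm_id_le
    set X := 1 + ‖y‖ ^ 2
    have hy : ‖y‖ ≤ X := norm_le_one_add_sq y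
    have hX : 1 ≤ X := by simp [X]
    have hg0 : 0 ≤ K' * momentWeight 2 α y := (abs_nonneg _).trans (hgw y)
    set W := K' * momentWeight 2 α y with hW
    calc _ ≤ (K * X * W + K * X * W) + (W * (K * X) + W * (K * X))
          + (|a| * ((K * X) * W) * 1 + |a| * ((K * X) * W + W * (K * X)) * X) := by
            gcongr
            any_goals first
              | exact hfb y
              | exact hGw y
              | exact hgw y
              | exact hGb y
              | exact hHw y
              | exact hHb y
            refine hadd.trans ?_
            gcongr <;> first | exact hfb y | exact hGw y | exact hgw y | exact hGb y
      _ = (4 * (X * 1) + |a| * (X * 1) + 2 * |a| * (X * X)) * (K * W) := by ring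
      _ ≤ (4 * (X * X) + |a| * (X * X) + 2 * |a| * (X * X)) * (K * W) := by gcongr
      _ = _ := by rw [hW]; ring

lemma profile_grad_hess_bound {p a : ℝ} {b : Matrix (Fin n) (Fin n) ℝ} (hp : 1 < p) (ha : 0 < a)
    (hb : b.PosSemidef) :
    ∃ K, ∀ y, |profile p a b y| ≤ K * (1 + ‖y‖ ^ 2) ∧ ‖profileGrad p a b y‖ ≤ K * (1 + ‖y‖ ^ 2) ∧
      ‖profileHess p a b y‖ ≤ K * (1 + ‖y‖ ^ 2) := by
  have hq := sub_pos.2 hp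
  set V := ((a + 1 / 2) / (p - 1)) ^ (1 / (p - 1)) with hV
  have hV0 : 0 ≤ V := by positivity
  have hp0 : 0 < p := by linarith
  set k1 := 2 / (p - 1) * (V / (p - 1)) * ‖b‖
  set k2 := 4 * p / (p - 1) ^ 2 * (V / (p - 1) ^ 2) * ‖b‖ ^ 2
  have hk1 : 0 ≤ k1 := by positivity
  have hk2 : 0 ≤ k2 := by positivity
  refine ⟨V + k1 + k2, fun y => ?_⟩
  have h0 := profile_pos hp ha hb y
  have h1 := profile_le hp ha hb y
  rw [← hV] at h1
  have hd := le_den (p := p) hb y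
  have hd0 := den_pos hp hb y
  have hX : 1 ≤ 1 + ‖y‖ ^ 2 := by simp
  have hy := norm_le_one_add_sq y
  have hact := norm_act_le b y
  refine ⟨?_, ?_, ?_⟩
  · rw [abs_of_pos h0]
    nlinarith
  · rw [profileGrad, norm_smul, Real.norm_eq_abs, abs_mul, abs_neg, abs_of_pos (by positivity),
      abs_of_pos (by positivity)]
    calc _ ≤ 2 / (p - 1) * (V / (p - 1)) * (‖b‖ * (1 + ‖y‖ ^ 2)) := by
          gcongr
          exact hact.trans (by gcongr)
      _ = k1 * (1 + ‖y‖ ^ 2) := by simp only [k1]; ring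
      _ ≤ _ := by gcongr; linarith
  · rw [profileHess]
    refine (norm_add_le _ _).trans ?_
    rw [norm_smulRight_innerSL, norm_smul, norm_smul, Matrix.l2_opNorm_toEuclideanCLM,
      Real.norm_eq_abs,
      Real.norm_eq_abs, abs_mul, abs_neg, abs_of_pos (by positivity),
      abs_of_pos (by positivity), abs_of_pos (by positivity)]
    calc _ ≤ 2 / (p - 1) * (V / (p - 1)) * ‖b‖
          + 4 * p / (p - 1) ^ 2 * (V / (p - 1) ^ 2) * (‖b‖ * ‖y‖) * (‖b‖ * ‖y‖) := by
            gcongr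
      _ = k1 * 1 + k2 * ‖y‖ ^ 2 := by simp only [k1, k2]; ring
      _ ≤ _ := by nlinarith [sq_nonneg ‖y‖, mul_nonneg hk1 (sq_nonneg ‖y‖)]

lemma integral_profile_adjointOp {p a : ℝ} {b : Matrix (Fin n) (Fin n) ℝ} (hp : 1 < p)
    (ha : 0 < a) (hb : b.PosSemidef) (s : ℝ) {S : Matrix (Fin n) (Fin n) ℝ} (hS : S.IsHermitian) :
    ∫ y, (profile p a b y * adjointOp p a (gtest a s S) y
      - (Laplacian.laplacian (profile p a b) y - a * fderiv ℝ (profile p a b) y y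
        - 2 * a / (p - 1) * profile p a b y) * gtest a s S y) = 0 := by
  obtain ⟨K, hK⟩ := profile_grad_hess_bound hp ha hb
  exact (hasGradHess_profile hp ha hb).integral_adjointOp (hasGradHess_gtest a s hS) p a ha
    (fun y => (hK y).1) (fun y => (hK y).2.1) (fun y => (hK y).2.2) (gaussBound_gtest ha s S)

/-! ### The nonlinearity -/

/-- The nonlinearity `|u|^{p-1} u`. -/
noncomputable def nonlin (p u : ℝ) : ℝ := |u| ^ (p - 1) * u

lemma nonlin_of_pos {p u : ℝ} (hu : 0 < u) : nonlin p u = u ^ p := by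
  rw [nonlin, abs_of_pos hu, ← Real.rpow_add_one hu.ne', sub_add_cancel]

lemma nonlin_neg (p u : ℝ) : nonlin p (-u) = -nonlin p u := by simp [nonlin]

lemma abs_nonlin {p : ℝ} (u : ℝ) : |nonlin p u| = |u| ^ (p - 1) * |u| := by
  rw [nonlin, abs_mul, abs_of_nonneg (Real.rpow_nonneg (abs_nonneg u) _)]

/-- On the positive axis this is the power rule, and oddness gives the negative axis. At the origin
the difference quotient is `|x| ^ (p - 1)`, which tends to zero because `p > 1`. -/
lemma hasDerivAt_nonlin {p : ℝ} (hp : 1 < p) (u : ℝ) :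
    HasDerivAt (nonlin p) (p * |u| ^ (p - 1)) u := by
  have hpos : ∀ u : ℝ, 0 < u → HasDerivAt (nonlin p) (p * |u| ^ (p - 1)) u := fun u hu => by
    have h := Real.hasDerivAt_rpow_const (x := u) (p := p) (Or.inl hu.ne')
    rw [abs_of_pos hu]
    refine h.congr_of_eventuallyEq ?_
    filter_upwards [lt_mem_nhds hu] with x hx using nonlin_of_pos hx
  rcases lt_trichotomy u 0 with hu | rfl | hu
  · have h := ((hpos (-u) (neg_pos.2 hu)).scomp u (hasDerivAt_neg u)).neg
    refine (h.congr_of_eventuallyEq (Eventually.of_forall fun x => ?_)).congr_deriv ?_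
    · simp [nonlin_neg]
    · simp
  · rw [hasDerivAt_iff_tendsto_slope]
    have h : Tendsto (fun x : ℝ => |x| ^ (p - 1)) (𝓝 0) (𝓝 (p * |(0 : ℝ)| ^ (p - 1))) := by
      have hc : Continuous fun x : ℝ => |x| ^ (p - 1) :=
        continuous_abs.rpow_const fun _ => Or.inr (by linarith)
      have := hc.tendsto 0
      simpa [Real.zero_rpow (sub_pos.2 hp).ne'] using this
    refine (h.mono_left nhdsWithin_le_nhds).congr' ?_
    filter_upwards [self_mem_nhdsWithin] with x hx
    have hx : x ≠ 0 := hx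
    simp [slope_def_field, nonlin, hx]
  · exact hpos u hu

lemma continuous_nonlin {p : ℝ} (hp : 1 < p) : Continuous (nonlin p) :=
  continuous_iff_continuousAt.2 fun u => (hasDerivAt_nonlin hp u).continuousAt

lemma abs_nonlin_sub_le {p K x y : ℝ} (hp : 1 < p) (hx : |x| ≤ K) (hy : |y| ≤ K) :
    |nonlin p x - nonlin p y| ≤ p * K ^ (p - 1) * |x - y| := by
  have h := (convex_Icc (-K) K).norm_image_sub_le_of_norm_hasDerivWithin_le (f := nonlin p)
    (f' := fun u => p * |u| ^ (p - 1)) (C := p * K ^ (p - 1))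
    (fun u _ => (hasDerivAt_nonlin hp u).hasDerivWithinAt) (fun u hu => ?_)
    (abs_le.1 hy) (abs_le.1 hx)
  · simpa using h
  · have hu' : |u| ≤ K := abs_le.2 hu
    have hp0 : 0 < p := by linarith
    have hp1 : 0 ≤ p - 1 := by linarith
    rw [Real.norm_eq_abs, abs_mul, abs_of_pos hp0,
      abs_of_nonneg (Real.rpow_nonneg (abs_nonneg u) _)]
    gcongr

lemma abs_nonlin_le {p K x : ℝ} (hp : 1 < p) (hx : |x| ≤ K) :
    |nonlin p x| ≤ K ^ (p - 1) * K := by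
  have hp1 : 0 ≤ p - 1 := by linarith
  have := abs_nonneg x
  rw [abs_nonlin]
  have : 0 ≤ K := this.trans hx
  gcongr

/-! ### Convergence of bounded functions against Gaussians -/

section L1loc

variable {u : ℝ → EuclideanSpace ℝ (Fin n) → ℝ} {I : Set ℝ} {K α σ : ℝ}

/-- Inside a ball the weight is bounded and convergence in `L¹_loc` applies. Outside the ball of
radius `R` the uniform bound on `u` and one extra power of `1 + |y|²` give a tail of order `R⁻²`,
uniformly in time. -/
lemma tendsto_integral_abs_sub_mul_momentWeight (hα : 0 < α)
    (hm : ∀ t ∈ I, AEStronglyMeasurable (u t) volume) (hK : ∀ t ∈ I, ∀ᵐ y, |u t y| ≤ K)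
    (hσ : σ ∈ I) (hc : ∀ R : ℝ,
      Tendsto (fun t => ∫ y in Metric.ball 0 R, |u t y - u σ y|) (𝓝[I] σ) (𝓝 0)) (k : ℕ) :
    Tendsto (fun t => ∫ y, |u t y - u σ y| * momentWeight k α y) (𝓝[I] σ) (𝓝 0) := by
  obtain ⟨Kw, hKw0, hKw⟩ := momentWeight_bounded (n := n) k hα
  have hK0 : 0 ≤ K := by
    obtain ⟨y, hy⟩ := (hK σ hσ).exists
    exact (abs_nonneg _).trans hy
  have hsub : ∀ t ∈ I, ∀ᵐ y, |u t y - u σ y| ≤ 2 * K := fun t ht => by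
    filter_upwards [hK t ht, hK σ hσ] with y h1 h2
    exact (abs_sub _ _).trans (by linarith)
  have hms : ∀ t ∈ I, AEStronglyMeasurable (fun y => |u t y - u σ y|) volume := fun t ht =>
    ((hm t ht).sub (hm σ hσ)).norm
  have hw := continuous_momentWeight (n := n)
  have hwn := momentWeight_nonneg (n := n)
  -- splitting the integral at radius `R`
  have hsplit : ∀ R : ℝ, 0 < R → ∀ t ∈ I, ∫ y, |u t y - u σ y| * momentWeight k α y ≤
      Kw * (∫ y in Metric.ball 0 R, |u t y - u σ y|) + 2 * K * moment n (k + 1) α / R ^ 2 := by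
    intro R hR t ht
    have hball : IntegrableOn (fun y => |u t y - u σ y|) (Metric.ball 0 R) := by
      refine Measure.integrableOn_of_bounded (M := 2 * K) (measure_ball_lt_top).ne (hms t ht) ?_
      exact ae_restrict_of_ae (by simpa using hsub t ht)
    have hind : Integrable ((Metric.ball 0 R).indicator fun y => |u t y - u σ y|) :=
      hball.integrable_indicator measurableSet_ball
    have hmom := integrable_momentWeight (n := n) (k + 1) hα
    rw [← integral_indicator measurableSet_ball, moment, ← integral_const_mul,
      ← integral_const_mul, ← integral_div, ← integral_add (hind.const_mul _)
        ((hmom.const_mul _).div_const _)]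
    refine integral_mono_of_nonneg (Eventually.of_forall fun y => by
      have := hwn k α y; positivity) ((hind.const_mul _).add
        ((hmom.const_mul _).div_const _)) ?_
    filter_upwards [hsub t ht] with y hy
    by_cases hyR : y ∈ Metric.ball (0 : EuclideanSpace ℝ (Fin n)) R
    · rw [Set.indicator_of_mem hyR, mul_comm]
      have h1 : 0 ≤ 2 * K * momentWeight (k + 1) α y / R ^ 2 := by
        have := hwn (k + 1) α y
        positivity
      have h2 := mul_le_mul_of_nonneg_right (hKw y) (abs_nonneg (u t y - u σ y))
      linarith
    · rw [Set.indicator_of_notMem hyR, mul_zero, zero_add]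
      have hyR' : R ≤ ‖y‖ := by simpa using hyR
      have h3 : R ^ 2 ≤ 1 + ‖y‖ ^ 2 := by nlinarith [hR.le]
      rw [le_div_iff₀ (by positivity), ← mul_momentWeight, mul_assoc]
      calc |u t y - u σ y| * (momentWeight k α y * R ^ 2)
          ≤ 2 * K * (momentWeight k α y * (1 + ‖y‖ ^ 2)) := by
            have := hwn k α y
            gcongr
        _ = _ := by ring
  rw [Metric.tendsto_nhds]
  intro ε hε
  set m := 2 * K * moment n (k + 1) α with hmdef
  have hm0 : 0 ≤ m := by have := moment_nonneg (n := n) (k + 1) α; positivity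
  -- The radius is at least `1`, so that its square dominates `2 (m + 1) / ε`.
  obtain ⟨R, hR, hRε⟩ : ∃ R : ℝ, 0 < R ∧ m / R ^ 2 < ε / 2 := by
    refine ⟨2 * (m + 1) / ε + 1, by positivity, ?_⟩
    have hR1 : 1 ≤ 2 * (m + 1) / ε + 1 := by
      have : 0 ≤ 2 * (m + 1) / ε := by positivity
      linarith
    have hR2 : 2 * (m + 1) / ε ≤ (2 * (m + 1) / ε + 1) ^ 2 := by nlinarith
    rw [div_lt_iff₀ (by positivity)]
    calc m < ε / 2 * (2 * (m + 1) / ε) := by field_simp; linarith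
      _ ≤ _ := by gcongr
  have hlim := ((hc R).const_mul Kw)
  rw [mul_zero] at hlim
  filter_upwards [(Metric.tendsto_nhds.1 hlim) (ε / 2) (by positivity), self_mem_nhdsWithin]
    with t h1 ht
  rw [Real.dist_0_eq_abs] at h1 ⊢
  rw [abs_of_nonneg (integral_nonneg fun y => by have := hwn k α y; positivity)]
  have := hsplit R hR t ht
  have := (abs_lt.1 h1).2
  linarith

lemma tendsto_integral_abs_sub_mul (hα : 0 < α)
    (hm : ∀ t ∈ I, AEStronglyMeasurable (u t) volume) (hK : ∀ t ∈ I, ∀ᵐ y, |u t y| ≤ K)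
    (hσ : σ ∈ I) (hc : ∀ R : ℝ,
      Tendsto (fun t => ∫ y in Metric.ball 0 R, |u t y - u σ y|) (𝓝[I] σ) (𝓝 0))
    {F : ℝ → EuclideanSpace ℝ (Fin n) → ℝ} {k : ℕ} {C : ℝ}
    (hF : ∀ t ∈ I, ∀ᵐ y, |F t y| ≤ C * |u t y - u σ y| * momentWeight k α y) :
    Tendsto (fun t => ∫ y, F t y) (𝓝[I] σ) (𝓝 0) := by
  have h := (tendsto_integral_abs_sub_mul_momentWeight hα hm hK hσ hc k).const_mul C
  rw [mul_zero] at h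
  refine squeeze_zero_norm' ?_ h
  filter_upwards [self_mem_nhdsWithin] with t ht
  rw [← integral_const_mul]
  refine norm_integral_le_of_norm_le ?_ ?_
  · refine Integrable.const_mul ?_ _
    refine integrable_of_le_momentWeight (k := k) (K := 2 * K) hα
      (((hm t ht).sub (hm σ hσ)).norm.mul (continuous_momentWeight k α).aestronglyMeasurable) ?_
    filter_upwards [hK t ht, hK σ hσ] with y h1 h2
    have := momentWeight_nonneg k α y
    rw [abs_mul, abs_abs, abs_of_nonneg this]
    gcongr
    exact (abs_sub _ _).trans (by linarith)
  · filter_upwards [hF t ht] with y hy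
    rw [Real.norm_eq_abs, ← mul_assoc]; exact hy

lemma integrable_mul_of_le_momentWeight {w f : EuclideanSpace ℝ (Fin n) → ℝ} {k : ℕ} {C : ℝ}
    (hα : 0 < α) (hw : AEStronglyMeasurable w volume) (hwK : ∀ᵐ y, |w y| ≤ K)
    (hf : AEStronglyMeasurable f volume) (hfb : ∀ y, |f y| ≤ C * momentWeight k α y) :
    Integrable fun y => w y * f y := by
  refine integrable_of_le_momentWeight (k := k) (K := K * C) hα (hw.mul hf) ?_
  filter_upwards [hwK] with y hy
  rw [abs_mul, mul_assoc]
  have := (abs_nonneg _).trans (hfb y)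
  have := (abs_nonneg _).trans hy
  gcongr
  exact hfb y

lemma continuousWithinAt_integral_mul (hα : 0 < α)
    (hm : ∀ t ∈ I, AEStronglyMeasurable (u t) volume) (hK : ∀ t ∈ I, ∀ᵐ y, |u t y| ≤ K)
    (hσ : σ ∈ I) (hc : ∀ R : ℝ,
      Tendsto (fun t => ∫ y in Metric.ball 0 R, |u t y - u σ y|) (𝓝[I] σ) (𝓝 0))
    {f : EuclideanSpace ℝ (Fin n) → ℝ} {k : ℕ} {C : ℝ} (hf : AEStronglyMeasurable f volume)
    (hfb : ∀ y, |f y| ≤ C * momentWeight k α y) :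
    ContinuousWithinAt (fun t => ∫ y, u t y * f y) I σ := by
  have h := tendsto_integral_abs_sub_mul (C := C) (k := k)
    (F := fun t y => u t y * f y - u σ y * f y)
    hα hm hK hσ hc (fun t _ => Eventually.of_forall fun y => ?_)
  · rw [ContinuousWithinAt, ← tendsto_sub_nhds_zero_iff]
    refine h.congr' ?_
    filter_upwards [self_mem_nhdsWithin] with t ht
    exact integral_sub (integrable_mul_of_le_momentWeight hα (hm t ht) (hK t ht) hf hfb)
      (integrable_mul_of_le_momentWeight hα (hm σ hσ) (hK σ hσ) hf hfb)
  · rw [← sub_mul, abs_mul, mul_comm C, mul_assoc]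
    gcongr
    exact hfb y

/-- The nonlinearity is Lipschitz on `[-K, K]`, so it inherits the Gaussian `L¹` continuity of `u`.
-/
lemma continuousWithinAt_integral_nonlin {p : ℝ} (hp : 1 < p) (hα : 0 < α)
    (hm : ∀ t ∈ I, AEStronglyMeasurable (u t) volume) (hK : ∀ t ∈ I, ∀ᵐ y, |u t y| ≤ K)
    (hσ : σ ∈ I) (hc : ∀ R : ℝ,
      Tendsto (fun t => ∫ y in Metric.ball 0 R, |u t y - u σ y|) (𝓝[I] σ) (𝓝 0))
    {f : EuclideanSpace ℝ (Fin n) → ℝ} {k : ℕ} {C : ℝ} (hf : AEStronglyMeasurable f volume)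
    (hfb : ∀ y, |f y| ≤ C * momentWeight k α y) :
    ContinuousWithinAt (fun t => ∫ y, nonlin p (u t y) * f y) I σ := by
  have hK0 : 0 ≤ K := by
    obtain ⟨y, hy⟩ := (hK σ hσ).exists
    exact (abs_nonneg _).trans hy
  have hi : ∀ t ∈ I, Integrable fun y => nonlin p (u t y) * f y := fun t ht => by
    refine integrable_mul_of_le_momentWeight (K := K ^ (p - 1) * K) hα
      ((continuous_nonlin hp).comp_aestronglyMeasurable (hm t ht)) ?_ hf hfb
    filter_upwards [hK t ht] with y hy using abs_nonlin_le hp hy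
  have h := tendsto_integral_abs_sub_mul
    (F := fun t y => nonlin p (u t y) * f y - nonlin p (u σ y) * f y) (C := p * K ^ (p - 1) * C)
    (k := k) hα hm hK hσ hc (fun t ht => ?_)
  · rw [ContinuousWithinAt, ← tendsto_sub_nhds_zero_iff]
    refine h.congr' ?_
    filter_upwards [self_mem_nhdsWithin] with t ht
    exact integral_sub (hi t ht) (hi σ hσ)
  · filter_upwards [hK t ht, hK σ hσ] with y h1 h2
    rw [← sub_mul, abs_mul]
    have hp0 : 0 < p := by linarith
    calc _ ≤ (p * K ^ (p - 1) * |u t y - u σ y|) * (C * momentWeight k α y) := by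
          gcongr
          · exact abs_nonlin_sub_le hp h1 h2
          · exact hfb y
      _ = _ := by ring

end L1loc

/-! ### The weak formulation against Gaussian test functions -/

section Rate

variable {p α K K' a : ℝ} {g : EuclideanSpace ℝ (Fin n) → ℝ}
  {G : EuclideanSpace ℝ (Fin n) → EuclideanSpace ℝ (Fin n)}
  {H : EuclideanSpace ℝ (Fin n) → EuclideanSpace ℝ (Fin n) →L[ℝ] EuclideanSpace ℝ (Fin n)}

/-- The rate of change of `∫ v ψ` that the rescaled equation prescribes. -/
noncomputable def weakRate (p a : ℝ) (w ψ : EuclideanSpace ℝ (Fin n) → ℝ) : ℝ :=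
  ∫ y, (w y * adjointOp p a ψ y + nonlin p (w y) * ψ y)

/-- The constant in the bound for `adjointOp`. -/
noncomputable def adjointConst (n : ℕ) (p a : ℝ) : ℝ := n + |a| * (n + 1) + 2 * |a| / (p - 1)

lemma HasGradHess.abs_adjointOp_le (h : HasGradHess g G H) (hb : GaussBound g G H K' α)
    (hp : 1 < p) (y : EuclideanSpace ℝ (Fin n)) :
    |adjointOp p a g y| ≤ K' * adjointConst n p a * momentWeight 3 α y := by
  have hq := sub_pos.2 hp
  rw [h.adjointOp_eq, ← mul_momentWeight]
  have h1 := hb.fn y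
  have h2 := hb.grad y
  have h3 := hb.hess y
  set W := K' * momentWeight 2 α y with hW
  have hW0 : 0 ≤ W := (abs_nonneg _).trans h1
  set X := 1 + ‖y‖ ^ 2 with hX
  have hX1 : 1 ≤ X := by simp [hX]
  have hy : ‖y‖ ≤ X := norm_le_one_add_sq y
  have ht : |trc (H y)| ≤ n * (W * X) :=
    (abs_trc_le _).trans (by gcongr; nlinarith)
  have hin : |inner ℝ (G y) y| ≤ W * X := (abs_real_inner_le_norm _ _).trans (by gcongr)
  have hg : |g y| ≤ W * X := h1.trans (by nlinarith)
  have e1 : |a * (n * g y + inner ℝ (G y) y)| ≤ |a| * (n * (W * X) + W * X) := by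
    rw [abs_mul]
    gcongr
    refine (abs_add_le _ _).trans ?_
    rw [abs_mul, Nat.abs_cast]
    gcongr
  have e2 : |2 * a / (p - 1) * g y| ≤ 2 * |a| / (p - 1) * (W * X) := by
    rw [abs_mul, abs_div, abs_mul, abs_of_pos hq, abs_of_pos (by norm_num : (0 : ℝ) < 2)]
    gcongr
  have := abs_sub (trc (H y) + a * (n * g y + inner ℝ (G y) y)) (2 * a / (p - 1) * g y)
  have := abs_add_le (trc (H y)) (a * (n * g y + inner ℝ (G y) y))
  calc _ ≤ n * (W * X) + |a| * (n * (W * X) + W * X) + 2 * |a| / (p - 1) * (W * X) := by linarith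
    _ = _ := by rw [hW, adjointConst]; ring

lemma HasGradHess.measurable_adjointOp (h : HasGradHess g G H) (p a : ℝ) :
    Measurable (adjointOp p a g) := by
  have e : adjointOp p a g = fun y =>
    trc (H y) + a * (n * g y + inner ℝ (G y) y) - 2 * a / (p - 1) * g y :=
    funext fun y => h.adjointOp_eq p a y
  have h1 := continuous_trc.measurable.comp h.measurable_hess
  have h2 := h.continuous
  have h3 := h.continuous_grad
  rw [e]
  refine (h1.add ?_).sub ?_ <;> exact (by fun_prop : Continuous _).measurable

lemma GaussBound.fn_le_three (hb : GaussBound g G H K' α) (y : EuclideanSpace ℝ (Fin n)) :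
    |g y| ≤ K' * momentWeight 3 α y := by
  have h := hb.fn y
  have h0 := (abs_nonneg _).trans h
  rw [← mul_momentWeight]
  nlinarith [mul_nonneg h0 (sq_nonneg ‖y‖)]

lemma HasGradHess.abs_rate_integrand_le (h : HasGradHess g G H) (hb : GaussBound g G H K' α)
    (hp : 1 < p) {w : ℝ} (hw : |w| ≤ K) (y : EuclideanSpace ℝ (Fin n)) :
    |w * adjointOp p a g y + nonlin p w * g y| ≤
      (K * (K' * adjointConst n p a) + K ^ (p - 1) * K * K') * momentWeight 3 α y := by
  have h1 := h.abs_adjointOp_le (a := a) hb hp y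
  have h2 := hb.fn_le_three y
  have h3 := abs_nonlin_le hp hw
  refine (abs_add_le _ _).trans ?_
  rw [abs_mul, abs_mul]
  have := (abs_nonneg _).trans hw
  have := (abs_nonneg _).trans h3
  calc _ ≤ K * (K' * adjointConst n p a * momentWeight 3 α y)
        + K ^ (p - 1) * K * (K' * momentWeight 3 α y) := by gcongr
    _ = _ := by ring

lemma HasGradHess.integrable_rate (h : HasGradHess g G H) (hb : GaussBound g G H K' α)
    (hp : 1 < p) (hα : 0 < α) {w : EuclideanSpace ℝ (Fin n) → ℝ}
    (hm : AEStronglyMeasurable w volume) (hw : ∀ᵐ y, |w y| ≤ K) :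
    Integrable (fun y => w y * adjointOp p a g y) ∧
    Integrable (fun y => nonlin p (w y) * g y) :=
  ⟨integrable_mul_of_le_momentWeight hα hm hw
    (h.measurable_adjointOp p a).aestronglyMeasurable (h.abs_adjointOp_le hb hp),
  integrable_mul_of_le_momentWeight (K := K ^ (p - 1) * K) hα
    ((continuous_nonlin hp).comp_aestronglyMeasurable hm)
    (by filter_upwards [hw] with y hy using abs_nonlin_le hp hy)
    h.continuous.aestronglyMeasurable hb.fn⟩

lemma HasGradHess.abs_weakRate_le (h : HasGradHess g G H) (hb : GaussBound g G H K' α)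
    (hp : 1 < p) (hα : 0 < α) {w : EuclideanSpace ℝ (Fin n) → ℝ}
    (hw : ∀ᵐ y, |w y| ≤ K) :
    |weakRate p a w g| ≤
      (K * (K' * adjointConst n p a) + K ^ (p - 1) * K * K') * moment n 3 α :=
  abs_integral_le_moment hα
    (by filter_upwards [hw] with y hy using h.abs_rate_integrand_le hb hp hy y)

lemma HasGradHess.continuousOn_weakRate (h : HasGradHess g G H) (hb : GaussBound g G H K' α)
    (hp : 1 < p) (hα : 0 < α) {v : ℝ → EuclideanSpace ℝ (Fin n) → ℝ} {I : Set ℝ} {a : ℝ → ℝ}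
    (ha : ContinuousOn a I)
    (hm : ∀ t ∈ I, AEStronglyMeasurable (v t) volume) (hK : ∀ t ∈ I, ∀ᵐ y, |v t y| ≤ K)
    (hc : ∀ R : ℝ, ∀ σ ∈ I,
      Tendsto (fun t => ∫ y in Metric.ball 0 R, |v t y - v σ y|) (𝓝[I] σ) (𝓝 0)) :
    ContinuousOn (fun t => weakRate p (a t) (v t) g) I := by
  -- The operator is affine in `a`, so the rate is a combination of pairings with fixed functions
  -- whose coefficients are continuous in time.
  have hadj : ∀ c y, adjointOp p c g y = adjointOp p 0 g y
      + c * (adjointOp p 1 g y - adjointOp p 0 g y) := fun c y => by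
    simp only [h.adjointOp_eq]; ring
  have e : ∀ t ∈ I, weakRate p (a t) (v t) g =
      (∫ y, v t y * adjointOp p 0 g y) + a t * ((∫ y, v t y * adjointOp p 1 g y)
        - ∫ y, v t y * adjointOp p 0 g y) + ∫ y, nonlin p (v t y) * g y := fun t ht => by
    have i0 := (h.integrable_rate (a := 0) hb hp hα (hm t ht) (hK t ht)).1
    have i1 := (h.integrable_rate (a := 1) hb hp hα (hm t ht) (hK t ht)).1
    have i2 := (h.integrable_rate (a := 0) hb hp hα (hm t ht) (hK t ht)).2
    have i3 : Integrable fun y =>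
        a t * (v t y * adjointOp p 1 g y - v t y * adjointOp p 0 g y) := (i1.sub i0).const_mul _
    have i4 : Integrable fun y => v t y * adjointOp p 0 g y +
        a t * (v t y * adjointOp p 1 g y - v t y * adjointOp p 0 g y) := i0.add i3
    rw [← integral_sub i1 i0, ← integral_const_mul, ← integral_add i0 i3, ← integral_add i4 i2,
      weakRate]
    refine integral_congr_ae (Eventually.of_forall fun y => ?_)
    simp only
    rw [hadj (a t)]
    ring
  refine ContinuousOn.congr (fun σ hσ => ?_) e
  have c := fun a => continuousWithinAt_integral_mul hα hm hK hσ (fun R => hc R σ hσ)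
    (h.measurable_adjointOp p a).aestronglyMeasurable (h.abs_adjointOp_le (a := a) hb hp)
  exact ((c 0).add ((ha σ hσ).mul ((c 1).sub (c 0)))).add
    (continuousWithinAt_integral_nonlin hp hα hm hK hσ (fun R => hc R σ hσ)
      h.continuous.aestronglyMeasurable hb.fn)

end Rate

/-- A smooth cutoff function, with bounds for two derivatives. -/
lemma exists_cutoff (n : ℕ) : ∃ (χ : EuclideanSpace ℝ (Fin n) → ℝ)
    (G : EuclideanSpace ℝ (Fin n) → EuclideanSpace ℝ (Fin n))
    (H : EuclideanSpace ℝ (Fin n) → EuclideanSpace ℝ (Fin n) →L[ℝ] EuclideanSpace ℝ (Fin n))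
    (C : ℝ), HasGradHess χ G H ∧ ContDiff ℝ ∞ χ ∧ HasCompactSupport χ ∧ χ 0 = 1 ∧
      (∀ y, |χ y| ≤ C) ∧ (∀ y, ‖G y‖ ≤ C) ∧ (∀ y, ‖H y‖ ≤ C) := by
  obtain ⟨χ, hf, hs, hχ0⟩ : ∃ χ : EuclideanSpace ℝ (Fin n) → ℝ,
      ContDiff ℝ ∞ χ ∧ HasCompactSupport χ ∧ χ 0 = 1 := by
    let f : ContDiffBump (0 : EuclideanSpace ℝ (Fin n)) := ⟨1, 2, by norm_num, by norm_num⟩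
    exact ⟨f, f.contDiff, f.hasCompactSupport,
      f.one_of_mem_closedBall (Metric.mem_closedBall_self f.rIn_pos.le)⟩
  have h1 : ContDiff ℝ 1 (fderiv ℝ χ) := hf.fderiv_right (by norm_cast)
  have h2 : ContDiff ℝ 1 fun y => rieszVec (fderiv ℝ χ y) := rieszVec.contDiff.comp h1
  have hs2 : HasCompactSupport fun y => rieszVec (fderiv ℝ χ y) :=
    (hs.fderiv (𝕜 := ℝ)).comp_left (map_zero _)
  obtain ⟨C0, hC0⟩ := hs.exists_bound_of_continuous hf.continuous
  obtain ⟨C1, hC1⟩ := hs2.exists_bound_of_continuous h2.continuous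
  obtain ⟨C2, hC2⟩ := (hs2.fderiv (𝕜 := ℝ)).exists_bound_of_continuous
    (h2.continuous_fderiv (by simp))
  exact ⟨χ, _, _, max C0 (max C1 C2), HasGradHess.of_contDiff hf, hf, hs, hχ0,
    fun y => (hC0 y).trans (le_max_left _ _),
    fun y => (hC1 y).trans (le_max_of_le_right (le_max_left _ _)),
    fun y => (hC2 y).trans (le_max_of_le_right (le_max_right _ _))⟩

lemma contDiff_gtest (a s : ℝ) (S : Matrix (Fin n) (Fin n) ℝ) {k : WithTop ℕ∞} :
    ContDiff ℝ k (gtest a s S) :=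
  (contDiff_const.add (contDiff_quad S)).mul (contDiff_gauss a)

/-- Gaussian bounds persist under multiplication by a function with bounded derivatives. -/
lemma GaussBound.mul {f g : EuclideanSpace ℝ (Fin n) → ℝ}
    {G G' : EuclideanSpace ℝ (Fin n) → EuclideanSpace ℝ (Fin n)}
    {H H' : EuclideanSpace ℝ (Fin n) → EuclideanSpace ℝ (Fin n) →L[ℝ] EuclideanSpace ℝ (Fin n)}
    {C K α : ℝ} (b0 : ∀ y, |f y| ≤ C) (b1 : ∀ y, ‖G y‖ ≤ C) (b2 : ∀ y, ‖H y‖ ≤ C)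
    (hg : GaussBound g G' H' K α) :
    GaussBound (fun y => f y * g y) (fun y => f y • G' y + g y • G y)
      (fun y => (f y • H' y + (innerSL ℝ (G y)).smulRight (G' y))
        + (g y • H y + (innerSL ℝ (G' y)).smulRight (G y))) (4 * (C * K)) α := by
  have hC : 0 ≤ C := (abs_nonneg _).trans (b0 0)
  have hW : ∀ y, 0 ≤ K * momentWeight 2 α y := fun y => (abs_nonneg _).trans (hg.fn y)
  refine ⟨fun y => ?_, fun y => ?_, fun y => ?_⟩
  · have h1 := hg.fn y
    have h0 := hW y
    rw [abs_mul]
    calc _ ≤ C * (K * momentWeight 2 α y) := by gcongr; exact b0 _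
      _ ≤ _ := by nlinarith [mul_nonneg hC h0]
  · have h1 := hg.fn y
    have h2 := hg.grad y
    have h0 := hW y
    have c0 := b0 y
    have c1 := b1 y
    refine (norm_add_le _ _).trans ?_
    rw [norm_smul, norm_smul, Real.norm_eq_abs, Real.norm_eq_abs]
    calc _ ≤ C * (K * momentWeight 2 α y) + (K * momentWeight 2 α y) * C := by gcongr
      _ ≤ _ := by nlinarith [mul_nonneg hC h0]
  · have h1 := hg.fn y
    have h2 := hg.grad y
    have h3 := hg.hess y
    have h0 := hW y
    have c0 := b0 y
    have c1 := b1 y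
    have c2 := b2 y
    refine (norm_add_le_of_le (norm_add_le _ _) (norm_add_le _ _)).trans ?_
    rw [norm_smulRight_innerSL, norm_smulRight_innerSL, norm_smul, norm_smul,
      Real.norm_eq_abs, Real.norm_eq_abs]
    calc _ ≤ (C * (K * momentWeight 2 α y) + C * (K * momentWeight 2 α y))
          + ((K * momentWeight 2 α y) * C + (K * momentWeight 2 α y) * C) := by
          gcongr
      _ = _ := by ring

/-- Multiplication by functions that tend to `1`, together with their derivatives, does not change
the limit of `adjointOp`. -/
lemma tendsto_adjointOp_mul {f : ℕ → EuclideanSpace ℝ (Fin n) → ℝ}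
    {g : EuclideanSpace ℝ (Fin n) → ℝ}
    {G : ℕ → EuclideanSpace ℝ (Fin n) → EuclideanSpace ℝ (Fin n)}
    {G' : EuclideanSpace ℝ (Fin n) → EuclideanSpace ℝ (Fin n)}
    {H : ℕ → EuclideanSpace ℝ (Fin n) → EuclideanSpace ℝ (Fin n) →L[ℝ] EuclideanSpace ℝ (Fin n)}
    {H' : EuclideanSpace ℝ (Fin n) → EuclideanSpace ℝ (Fin n) →L[ℝ] EuclideanSpace ℝ (Fin n)}
    (hf : ∀ N, HasGradHess (f N) (G N) (H N)) (hg : HasGradHess g G' H')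
    (y : EuclideanSpace ℝ (Fin n)) (t0 : Tendsto (fun N => f N y) atTop (𝓝 1))
    (t1 : Tendsto (fun N => G N y) atTop (𝓝 0)) (t2 : Tendsto (fun N => H N y) atTop (𝓝 0))
    (p a : ℝ) :
    Tendsto (fun N => adjointOp p a (fun y => f N y * g y) y) atTop (𝓝 (adjointOp p a g y)) := by
  simp only [fun N => ((hf N).mul hg).adjointOp_eq p a y, hg.adjointOp_eq p a y]
  have s1 : Tendsto (fun N => f N y • G' y + g y • G N y) atTop (𝓝 (G' y)) := by
    simpa using (t0.smul_const (G' y)).add (t1.const_smul (g y))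
  have s2 : Tendsto (fun N => trc ((f N y • H' y + (innerSL ℝ (G N y)).smulRight (G' y))
      + (g y • H N y + (innerSL ℝ (G' y)).smulRight (G N y)))) atTop (𝓝 (trc (H' y))) := by
    simp only [trc_add, trc_smulRight, trc_smul]
    have ht := (continuous_trc.tendsto _).comp t2
    have h0 : trc (0 : EuclideanSpace ℝ (Fin n) →L[ℝ] EuclideanSpace ℝ (Fin n)) = 0 := by
      simp [trc]
    rw [h0] at ht
    have hi : Tendsto (fun N => inner ℝ (G N y) (G' y)) atTop (𝓝 0) := by
      simpa using t1.inner (tendsto_const_nhds (x := G' y))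
    have hi' : Tendsto (fun N => inner ℝ (G' y) (G N y)) atTop (𝓝 0) := by
      simpa using (tendsto_const_nhds (x := G' y)).inner t1
    simpa using ((t0.mul_const (trc (H' y))).add hi).add ((ht.const_mul (g y)).add hi')
  have s3 : Tendsto (fun N => f N y * g y) atTop (𝓝 (g y)) := by
    simpa using t0.mul_const (g y)
  exact (s2.add (((s3.const_mul _).add (s1.inner tendsto_const_nhds)).const_mul _)).sub
    (s3.const_mul _)

/-- Approximation of `gtest` by compactly supported smooth functions. -/
lemma exists_approx_gtest {α : ℝ} (hα : 0 < α) (s : ℝ) {S : Matrix (Fin n) (Fin n) ℝ}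
    (hS : S.IsHermitian) : ∃ (ψ : ℕ → EuclideanSpace ℝ (Fin n) → ℝ)
    (G : ℕ → EuclideanSpace ℝ (Fin n) → EuclideanSpace ℝ (Fin n))
    (H : ℕ → EuclideanSpace ℝ (Fin n) → EuclideanSpace ℝ (Fin n) →L[ℝ] EuclideanSpace ℝ (Fin n))
    (C : ℝ), (∀ N, HasGradHess (ψ N) (G N) (H N)) ∧ (∀ N, ContDiff ℝ ∞ (ψ N)) ∧
      (∀ N, HasCompactSupport (ψ N)) ∧ (∀ N, GaussBound (ψ N) (G N) (H N) C α) ∧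
      (∀ y, Tendsto (fun N => ψ N y) atTop (𝓝 (gtest α s S y))) ∧
      (∀ p a y, Tendsto (fun N => adjointOp p a (ψ N) y) atTop
        (𝓝 (adjointOp p a (gtest α s S) y))) := by
  obtain ⟨χ, Gχ, Hχ, C, hχ, hχs, hχc, hχ0, b0, b1, b2⟩ := exists_cutoff n
  have hg := hasGradHess_gtest α s hS
  obtain ⟨r, hr0, hr1, hrt⟩ : ∃ r : ℕ → ℝ, (∀ N, 0 < r N) ∧ (∀ N, r N ≤ 1) ∧
      Tendsto r atTop (𝓝 0) :=
    ⟨fun N => 1 / ((N : ℝ) + 1), fun N => by positivity, fun N => by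
      rw [div_le_one (by positivity)]; simp, tendsto_one_div_add_atTop_nhds_zero_nat⟩
  have hrG : ∀ N y, ‖r N • Gχ (r N • y)‖ ≤ C := fun N y => by
    rw [norm_smul, Real.norm_eq_abs, abs_of_pos (hr0 N)]
    exact (mul_le_of_le_one_left (norm_nonneg _) (hr1 N)).trans (b1 _)
  have hrH : ∀ N y, ‖(r N * r N) • Hχ (r N • y)‖ ≤ C := fun N y => by
    rw [norm_smul, Real.norm_eq_abs, abs_of_pos (mul_pos (hr0 N) (hr0 N))]
    exact (mul_le_of_le_one_left (norm_nonneg _)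
      (mul_le_one₀ (hr1 N) (hr0 N).le (hr1 N))).trans (b2 _)
  have tχ : ∀ y, Tendsto (fun N => χ (r N • y)) atTop (𝓝 1) := fun y => by
    have h1 : Tendsto (fun N => r N • y) atTop (𝓝 0) := by simpa using hrt.smul_const y
    have h2 := (hχ.continuous.tendsto 0).comp h1
    rw [hχ0] at h2
    exact h2
  have tG : ∀ y, Tendsto (fun N => r N • Gχ (r N • y)) atTop (𝓝 0) := fun y =>
    squeeze_zero_norm (a := fun N => r N * C) (fun N => by
      rw [norm_smul, Real.norm_eq_abs, abs_of_pos (hr0 N)]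
      exact mul_le_mul_of_nonneg_left (b1 _) (hr0 N).le) (by simpa using hrt.mul_const C)
  have tH : ∀ y, Tendsto (fun N => (r N * r N) • Hχ (r N • y)) atTop (𝓝 0) := fun y =>
    squeeze_zero_norm (a := fun N => r N * r N * C) (fun N => by
      rw [norm_smul, Real.norm_eq_abs, abs_of_pos (mul_pos (hr0 N) (hr0 N))]
      exact mul_le_mul_of_nonneg_left (b2 _) (mul_pos (hr0 N) (hr0 N)).le)
      (by simpa using (hrt.mul hrt).mul_const C)
  refine ⟨fun N y => χ (r N • y) * gtest α s S y, _, _, _,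
    fun N => (hχ.comp_smul (r N)).mul hg,
    fun N => (hχs.comp (contDiff_const_smul _)).mul (contDiff_gtest α s S),
    fun N => (hχc.comp_smul (hr0 N).ne').mul_right,
    fun N => GaussBound.mul (fun y => b0 _) (hrG N) (hrH N) (gaussBound_gtest hα s S),
    fun y => ?_, fun p a y => tendsto_adjointOp_mul (fun N => hχ.comp_smul (r N)) hg y
      (tχ y) (tG y) (tH y) p a⟩
  simpa using (tχ y).mul_const (gtest α s S y)

section WeakSolution

variable {p T α s : ℝ} {a : ℝ → ℝ} {v : ℝ → EuclideanSpace ℝ (Fin n) → ℝ}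
  {S : Matrix (Fin n) (Fin n) ℝ}

/-- The weak formulation holds against `gtest`. -/
lemma IsWeakSolution.equation_gtest (hv : IsWeakSolution p T a v) (hp : 1 < p)
    (ha : ContinuousOn a (Set.Icc 0 T)) (hα : 0 < α) (s : ℝ) (hS : S.IsHermitian) {σ τ : ℝ}
    (hσ : σ ∈ Set.Icc 0 T) (hτ : τ ∈ Set.Icc 0 T) :
    (∫ y, v τ y * gtest α s S y) - (∫ y, v σ y * gtest α s S y) =
      ∫ t in σ..τ, weakRate p (a t) (v t) (gtest α s S) := by
  obtain ⟨K, hK⟩ := hv.bounded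
  have hm := hv.aestronglyMeasurable
  -- The approximants obey one Gaussian bound, which dominates the integrals in `y`. The bound on
  -- `a` over `[0, T]` makes the domination uniform in time as well.
  obtain ⟨ψ, G, H, C, hψ, hψs, hψc, hψb, hψt, hψa⟩ := exists_approx_gtest hα s hS
  have hsub : Set.uIoc σ τ ⊆ Set.Icc 0 T := Set.uIoc_subset_uIcc.trans (Set.uIcc_subset_Icc hσ hτ)
  have hw := continuous_momentWeight (n := n)
  obtain ⟨A, hA⟩ := isCompact_Icc.exists_bound_of_continuousOn ha
  have hA0 : 0 ≤ A := (norm_nonneg _).trans (hA σ hσ)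
  have hK0 : 0 ≤ K := by
    obtain ⟨y, hy⟩ := (hK σ hσ).exists
    exact (abs_nonneg _).trans hy
  have hC0 : 0 ≤ C := by
    have := (abs_nonneg _).trans ((hψb 0).fn 0)
    simpa [momentWeight] using this
  have hac : ∀ t ∈ Set.Icc 0 T, adjointConst n p (a t) ≤ adjointConst n p A := fun t ht => by
    have h1 := hA t ht
    have := sub_pos.2 hp
    rw [Real.norm_eq_abs] at h1
    rw [← abs_of_nonneg hA0] at h1
    unfold adjointConst
    gcongr
  -- limits of the two sides
  have lim1 : ∀ t ∈ Set.Icc 0 T, Tendsto (fun N => ∫ y, v t y * ψ N y) atTop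
      (𝓝 (∫ y, v t y * gtest α s S y)) := fun t ht => by
    refine tendsto_integral_of_dominated_convergence (fun y => K * (C * momentWeight 2 α y))
      (fun N => (hm t ht).mul (hψ N).continuous.aestronglyMeasurable)
      (((integrable_momentWeight 2 hα).const_mul C).const_mul K) (fun N => ?_)
      (Eventually.of_forall fun y => (hψt y).const_mul _)
    filter_upwards [hK t ht] with y hy
    rw [Real.norm_eq_abs, abs_mul]
    gcongr
    exact (hψb N).fn y
  have lim2 : ∀ t ∈ Set.Icc 0 T, Tendsto (fun N => weakRate p (a t) (v t) (ψ N)) atTop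
      (𝓝 (weakRate p (a t) (v t) (gtest α s S))) := fun t ht => by
    refine tendsto_integral_of_dominated_convergence
      (fun y => (K * (C * adjointConst n p (a t)) + K ^ (p - 1) * K * C) * momentWeight 3 α y)
      (fun N => ?_) ((integrable_momentWeight 3 hα).const_mul _) (fun N => ?_)
      (Eventually.of_forall fun y => (((hψa p (a t) y).const_mul _).add
        ((hψt y).const_mul _)))
    · have h := (hψ N).integrable_rate (a := a t) (hψb N) hp hα (hm t ht) (hK t ht)
      exact (h.1.add h.2).aestronglyMeasurable
    · filter_upwards [hK t ht] with y hy
      exact (hψ N).abs_rate_integrand_le (hψb N) hp hy y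
  have lim3 : Tendsto (fun N => ∫ t in σ..τ, weakRate p (a t) (v t) (ψ N)) atTop
      (𝓝 (∫ t in σ..τ, weakRate p (a t) (v t) (gtest α s S))) := by
    refine intervalIntegral.tendsto_integral_filter_of_dominated_convergence
      (fun _ => (K * (C * adjointConst n p A) + K ^ (p - 1) * K * C) * moment n 3 α)
      (Eventually.of_forall fun N => ?_) (Eventually.of_forall fun N => ?_)
      intervalIntegrable_const (Eventually.of_forall fun t ht => lim2 t (hsub ht))
    · exact (((hψ N).continuousOn_weakRate (hψb N) hp hα ha hm hK
        hv.continuous_L1loc).mono hsub).aestronglyMeasurable measurableSet_uIoc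
    · refine Eventually.of_forall fun t ht => ?_
      have h := (hψ N).abs_weakRate_le (a := a t) (hψb N) hp hα (hK t (hsub ht))
      have := hac t (hsub ht)
      have := moment_nonneg (n := n) 3 α
      refine h.trans ?_
      gcongr
  refine tendsto_nhds_unique ((lim1 τ hτ).sub (lim1 σ hσ)) (lim3.congr fun N => ?_)
  exact (hv.equation (ψ N) (hψs N) (hψc N) σ hσ τ hτ).symm

/-- The rate is continuous in time, so the fundamental theorem of calculus applies to the integrated
equation, with one-sided derivatives at the endpoints. -/
lemma IsWeakSolution.hasDerivWithinAt_gtest (hv : IsWeakSolution p T a v) (hp : 1 < p)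
    (ha : ContinuousOn a (Set.Icc 0 T)) (hα : 0 < α) (s : ℝ) (hS : S.IsHermitian) {τ : ℝ}
    (hτ : τ ∈ Set.Icc 0 T) :
    HasDerivWithinAt (fun t => ∫ y, v t y * gtest α s S y)
      (weakRate p (a τ) (v τ) (gtest α s S)) (Set.Icc 0 T) τ := by
  obtain ⟨K, hK⟩ := hv.bounded
  have hc := (hasGradHess_gtest α s hS).continuousOn_weakRate (gaussBound_gtest hα s S) hp hα ha
    hv.aestronglyMeasurable hK hv.continuous_L1loc
  have : Fact (τ ∈ Set.Icc 0 T) := ⟨hτ⟩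
  have hd : HasDerivWithinAt (fun t => ∫ t in τ..t, weakRate p (a t) (v t) (gtest α s S))
      (weakRate p (a τ) (v τ) (gtest α s S)) (Set.Icc 0 T) τ :=
    intervalIntegral.integral_hasDerivWithinAt_right (by simp)
      (hc.stronglyMeasurableAtFilter_nhdsWithin measurableSet_Icc τ) (hc τ hτ)
  refine (hd.const_add (∫ y, v τ y * gtest α s S y)).congr (fun t ht => ?_) (by simp)
  rw [← hv.equation_gtest hp ha hα s hS hτ ht]
  ring

end WeakSolution

/-! ### Differentiation of the orthogonality conditions in time -/

/-- Dominated convergence for the difference quotients. A Lipschitz bound based at the single time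
`τ` is enough. -/
lemma hasDerivWithinAt_integral_of_lipschitz {F : ℝ → EuclideanSpace ℝ (Fin n) → ℝ}
    {F' B : EuclideanSpace ℝ (Fin n) → ℝ} {I : Set ℝ} {τ : ℝ} (hτ : τ ∈ I)
    (hFi : ∀ t ∈ I, Integrable (F t)) (hlip : ∀ t ∈ I, ∀ᵐ y, |F t y - F τ y| ≤ |t - τ| * B y)
    (hB : Integrable B) (hd : ∀ y, HasDerivWithinAt (fun t => F t y) (F' y) I τ) :
    HasDerivWithinAt (fun t => ∫ y, F t y) (∫ y, F' y) I τ := by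
  rw [hasDerivWithinAt_iff_tendsto_slope]
  have h : Tendsto (fun t => ∫ y, slope (fun t => F t y) τ t) (𝓝[I \ {τ}] τ) (𝓝 (∫ y, F' y)) := by
    refine tendsto_integral_filter_of_dominated_convergence B ?_ ?_ hB
      (Eventually.of_forall fun y => hasDerivWithinAt_iff_tendsto_slope.1 (hd y))
    · filter_upwards [self_mem_nhdsWithin] with t ht
      simp only [slope, vsub_eq_sub]
      exact (((hFi t ht.1).sub (hFi τ hτ)).smul (t - τ)⁻¹).aestronglyMeasurable
    · filter_upwards [self_mem_nhdsWithin] with t ht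
      filter_upwards [hlip t ht.1] with y hy
      have hne : 0 < |t - τ| := abs_pos.2 (sub_ne_zero.2 ht.2)
      rw [slope_def_field, Real.norm_eq_abs, abs_div, div_le_iff₀ hne, mul_comm]
      exact hy
  refine h.congr' ?_
  filter_upwards [self_mem_nhdsWithin] with t ht
  simp only [slope, vsub_eq_sub, smul_eq_mul]
  rw [integral_const_mul, integral_sub (hFi t ht.1) (hFi τ hτ)]

lemma exists_lipschitz_of_contDiffOn {F : Type*} [NormedAddCommGroup F] [NormedSpace ℝ F]
    {f : ℝ → F} {T : ℝ} (hT : 0 < T) (hf : ContDiffOn ℝ 1 f (Set.Icc 0 T)) :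
    ∃ L, 0 ≤ L ∧ (∀ t ∈ Set.Icc 0 T, ‖derivWithin f (Set.Icc 0 T) t‖ ≤ L) ∧
      ∀ t ∈ Set.Icc 0 T, ∀ τ ∈ Set.Icc 0 T, ‖f t - f τ‖ ≤ L * |t - τ| := by
  obtain ⟨L, hL⟩ := isCompact_Icc.exists_bound_of_continuousOn
    (hf.continuousOn_derivWithin (uniqueDiffOn_Icc hT) (by norm_num))
  refine ⟨L, (norm_nonneg _).trans (hL 0 ⟨le_rfl, hT.le⟩), hL, fun t ht τ hτ => ?_⟩
  exact (convex_Icc 0 T).norm_image_sub_le_of_norm_derivWithin_le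
    (hf.differentiableOn (by norm_num)) hL hτ ht

lemma hasDerivWithinAt_gtest_param {a : ℝ → ℝ} {a' τ : ℝ} {I : Set ℝ}
    (ha : HasDerivWithinAt a a' I τ) (s : ℝ) (S : Matrix (Fin n) (Fin n) ℝ)
    (y : EuclideanSpace ℝ (Fin n)) :
    HasDerivWithinAt (fun t => gtest (a t) s S y)
      (a' * (-(1 / 2) * (‖y‖ ^ 2 * gtest (a τ) s S y))) I τ := by
  have h := (((ha.mul_const (‖y‖ ^ 2)).div_const 2).neg.exp).const_mul (qpoly s S y)
  refine h.congr_deriv ?_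
  simp only [gtest, gauss, Pi.neg_apply]
  ring

lemma abs_sq_mul_gtest_le (a s : ℝ) (S : Matrix (Fin n) (Fin n) ℝ)
    (y : EuclideanSpace ℝ (Fin n)) :
    |‖y‖ ^ 2 * gtest a s S y| ≤ (|s| + ‖S‖) * momentWeight 2 a y := by
  have h1 := abs_gtest_le a s S y
  have h2 := (abs_nonneg _).trans h1
  rw [abs_mul, abs_of_nonneg (sq_nonneg ‖y‖), ← mul_momentWeight]
  calc _ ≤ (1 + ‖y‖ ^ 2) * ((|s| + ‖S‖) * momentWeight 1 a y) := by
        gcongr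
        linarith
    _ = _ := by ring

lemma abs_mul_gtest_deriv_le (a' a s : ℝ) (S : Matrix (Fin n) (Fin n) ℝ)
    (y : EuclideanSpace ℝ (Fin n)) :
    |a' * (-(1 / 2) * (‖y‖ ^ 2 * gtest a s S y))| ≤
      |a'| * (|s| + ‖S‖) * momentWeight 2 a y := by
  have h1 := abs_sq_mul_gtest_le a s S y
  have h3 : |(1 : ℝ) / 2| = 1 / 2 := by norm_num
  rw [abs_mul, abs_mul, abs_neg, h3, mul_assoc |a'|]
  refine mul_le_mul_of_nonneg_left ?_ (abs_nonneg a')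
  linarith [abs_nonneg (‖y‖ ^ 2 * gtest a s S y)]

/-- The mean value inequality in the Gaussian parameter. On `[α, ∞)` the slowest decay `α` dominates
every derivative. -/
lemma abs_gtest_sub_le {α a a' : ℝ} (ha : α ≤ a) (ha' : α ≤ a') (s : ℝ)
    (S : Matrix (Fin n) (Fin n) ℝ) (y : EuclideanSpace ℝ (Fin n)) :
    |gtest a s S y - gtest a' s S y| ≤ |a - a'| * ((|s| + ‖S‖) * momentWeight 2 α y) := by
  have hC : ∀ x ∈ Set.Ici α, ‖x‖ = |x| := fun _ _ => rfl
  have h := (convex_Ici α).norm_image_sub_le_of_norm_hasDerivWithin_le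
    (f := fun x => gtest x s S y)
    (f' := fun x => 1 * (-(1 / 2) * (‖y‖ ^ 2 * gtest x s S y)))
    (C := (|s| + ‖S‖) * momentWeight 2 α y)
    (fun x _ => hasDerivWithinAt_gtest_param (hasDerivWithinAt_id x _) s S y)
    (fun x hx => ?_) ha' ha
  · rw [mul_comm]; exact h
  · have h1 := abs_mul_gtest_deriv_le 1 x s S y
    rw [abs_one, one_mul (|s| + ‖S‖)] at h1
    exact h1.trans (mul_le_mul_of_nonneg_left (momentWeight_anti 2 hx y) (by positivity))

/-! ### Moving test functions and the modulation identity -/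

section Curves

variable {p T α : ℝ} {a : ℝ → ℝ} {b : ℝ → Matrix (Fin n) (Fin n) ℝ}
  {v : ℝ → EuclideanSpace ℝ (Fin n) → ℝ} {S : Matrix (Fin n) (Fin n) ℝ}

/-- The rate of change of the pairing of a weak solution with a moving test function. -/
lemma IsWeakSolution.hasDerivWithinAt_gtest_moving (hv : IsWeakSolution p T a v) (hp : 1 < p)
    (hT : 0 < T) (ha : ContDiffOn ℝ 1 a (Set.Icc 0 T)) (hα : 0 < α)
    (hαa : ∀ t ∈ Set.Icc 0 T, α ≤ a t) (s : ℝ) (hS : S.IsHermitian) {τ : ℝ}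
    (hτ : τ ∈ Set.Icc 0 T) :
    HasDerivWithinAt (fun t => ∫ y, v t y * gtest (a t) s S y)
      (weakRate p (a τ) (v τ) (gtest (a τ) s S)
        + ∫ y, v τ y * (derivWithin a (Set.Icc 0 T) τ
            * (-(1 / 2) * (‖y‖ ^ 2 * gtest (a τ) s S y)))) (Set.Icc 0 T) τ := by
  obtain ⟨K, hK⟩ := hv.bounded
  have hm := hv.aestronglyMeasurable
  obtain ⟨L, hL0, -, hL⟩ := exists_lipschitz_of_contDiffOn hT ha
  have had : HasDerivWithinAt a (derivWithin a (Set.Icc 0 T) τ) (Set.Icc 0 T) τ :=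
    (ha.differentiableOn (by norm_num) τ hτ).hasDerivWithinAt
  have hgm : ∀ t, AEStronglyMeasurable (gtest t s S) volume := fun t =>
    (contDiff_gtest t s S (k := 0)).continuous.aestronglyMeasurable
  set N := |s| + ‖S‖
  have hN : 0 ≤ N := by positivity
  have hgb : ∀ t ∈ Set.Icc 0 T, ∀ y, |gtest (a t) s S y| ≤ N * momentWeight 1 α y :=
    fun t ht y => (abs_gtest_le _ s S y).trans
      (mul_le_mul_of_nonneg_left (momentWeight_anti 1 (hαa t ht) y) hN)
  have hlip : ∀ t ∈ Set.Icc 0 T, ∀ y, |gtest (a t) s S y - gtest (a τ) s S y|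
      ≤ |t - τ| * (L * N * momentWeight 2 α y) := fun t ht y => by
    refine (abs_gtest_sub_le (hαa t ht) (hαa τ hτ) s S y).trans ?_
    have h1 := hL t ht τ hτ
    have h2 := momentWeight_nonneg 2 α y
    rw [Real.norm_eq_abs] at h1
    calc _ ≤ (L * |t - τ|) * (N * momentWeight 2 α y) := by gcongr
      _ = _ := by ring
  have hK0 : 0 ≤ K := by
    obtain ⟨y, hy⟩ := (hK τ hτ).exists
    exact (abs_nonneg _).trans hy
  have hint : ∀ t ∈ Set.Icc 0 T, ∀ t' ∈ Set.Icc 0 T,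
      Integrable fun y => v t y * gtest (a t') s S y := fun t ht t' ht' =>
    integrable_mul_of_le_momentWeight hα (hm t ht) (hK t ht) (hgm _) (hgb t' ht')
  -- the three contributions
  have h1 := hv.hasDerivWithinAt_gtest hp ha.continuousOn (hα.trans_le (hαa τ hτ)) s hS hτ
  have h2 : HasDerivWithinAt (fun t => ∫ y, v τ y * gtest (a t) s S y)
      (∫ y, v τ y * (derivWithin a (Set.Icc 0 T) τ
            * (-(1 / 2) * (‖y‖ ^ 2 * gtest (a τ) s S y)))) (Set.Icc 0 T) τ := by
    refine hasDerivWithinAt_integral_of_lipschitz hτ (hint τ hτ)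
      (B := fun y => K * (L * N * momentWeight 2 α y)) (fun t ht => ?_)
      (((integrable_momentWeight 2 hα).const_mul _).const_mul _)
      (fun y => (hasDerivWithinAt_gtest_param had s S y).const_mul _)
    filter_upwards [hK τ hτ] with y hy
    rw [← mul_sub, abs_mul]
    calc _ ≤ K * (|t - τ| * (L * N * momentWeight 2 α y)) := by
          gcongr
          exact hlip t ht y
      _ = _ := by ring
  -- The solution has no pointwise derivative in time, so the product rule needs this cross term to
  -- be `o(t - τ)`. The increment of the test function is `O(|t - τ|)` in the weight, and the
  -- increment of `v` tends to zero in Gaussian `L¹`.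
  have h3 : HasDerivWithinAt
      (fun t => ∫ y, (v t y - v τ y) * (gtest (a t) s S y - gtest (a τ) s S y)) 0
      (Set.Icc 0 T) τ := by
    rw [hasDerivWithinAt_iff_tendsto_slope]
    have hl := tendsto_integral_abs_sub_mul (u := v) (I := Set.Icc 0 T) (σ := τ) (K := K) (k := 2)
      (C := L * N)
      (F := fun t y => (t - τ)⁻¹ * ((v t y - v τ y) * (gtest (a t) s S y - gtest (a τ) s S y)))
      hα hm hK hτ (fun R => hv.continuous_L1loc R τ hτ) (fun t ht => Eventually.of_forall
        fun y => ?_)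
    · refine (hl.mono_left (nhdsWithin_mono _ Set.sdiff_subset)).congr fun t => ?_
      rw [integral_const_mul, slope, vsub_eq_sub, smul_eq_mul]
      simp
    · rcases eq_or_ne t τ with rfl | hne
      · simp
      · rw [abs_mul, abs_mul, abs_inv, inv_mul_le_iff₀ (abs_pos.2 (sub_ne_zero.2 hne))]
        calc _ ≤ |v t y - v τ y| * (|t - τ| * (L * N * momentWeight 2 α y)) := by
              gcongr
              exact hlip t ht y
          _ = _ := by ring
  have h := (h1.add h2).add h3
  rw [add_zero] at h
  refine (h.sub_const (∫ y, v τ y * gtest (a τ) s S y)).congr (fun t ht => ?_) ?_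
  · have e : ∀ y, v t y * gtest (a t) s S y = ((v t y * gtest (a τ) s S y
        + v τ y * gtest (a t) s S y)
        + (v t y - v τ y) * (gtest (a t) s S y - gtest (a τ) s S y))
        - v τ y * gtest (a τ) s S y := fun y => by ring
    have i1 := hint t ht τ hτ
    have i2 := hint τ hτ t ht
    have i3 := hint τ hτ τ hτ
    have i4 := hint t ht t ht
    have i5 : Integrable fun y =>
        (v t y - v τ y) * (gtest (a t) s S y - gtest (a τ) s S y) := by
      refine (((i4.sub i2).sub i1).add i3).congr (Eventually.of_forall fun y => ?_)
      simp only [Pi.add_apply, Pi.sub_apply]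
      ring
    have i6 : Integrable fun y => v t y * gtest (a τ) s S y + v τ y * gtest (a t) s S y :=
      i1.add i2
    have i7 : Integrable fun y => (v t y * gtest (a τ) s S y + v τ y * gtest (a t) s S y)
        + (v t y - v τ y) * (gtest (a t) s S y - gtest (a τ) s S y) := i6.add i5
    simp only [Pi.add_apply]
    rw [← integral_add i1 i2, ← integral_add i6 i5, ← integral_sub i7 i3]
    exact integral_congr_ae (Eventually.of_forall e)
  · simp

lemma abs_profile_deriv_le {a a' : ℝ} {b b' : Matrix (Fin n) (Fin n) ℝ} {A L L' : ℝ} (hp : 1 < p)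
    (ha : 0 < a) (haA : a ≤ A) (hb : b.PosSemidef) (ha' : |a'| ≤ L) (hb' : ‖b'‖ ≤ L')
    (y : EuclideanSpace ℝ (Fin n)) :
    |profile p a b y * (1 / (p - 1) * (a' / (a + 1 / 2) - quad b' y / den p b y))| ≤
      ((A + 1 / 2) / (p - 1)) ^ (1 / (p - 1)) * (1 / (p - 1) * (2 * L + L' / (p - 1)))
        * (1 + ‖y‖ ^ 2) := by
  have hq := sub_pos.2 hp
  have h0 := profile_pos hp ha hb y
  have h1 : profile p a b y ≤ ((A + 1 / 2) / (p - 1)) ^ (1 / (p - 1)) :=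
    (profile_le hp ha hb y).trans (by gcongr)
  have hd := le_den (p := p) hb y
  have hd0 := den_pos hp hb y
  have hL : 0 ≤ L := (abs_nonneg _).trans ha'
  have hL' : 0 ≤ L' := (norm_nonneg _).trans hb'
  have e1 : |a' / (a + 1 / 2)| ≤ 2 * L * (1 + ‖y‖ ^ 2) := by
    rw [abs_div, abs_of_pos (by positivity : 0 < a + 1 / 2), div_le_iff₀ (by positivity)]
    have : L * 1 ≤ L * (1 + ‖y‖ ^ 2) := by gcongr; simp
    nlinarith [sq_nonneg ‖y‖, mul_nonneg (mul_nonneg hL ha.le) (sq_nonneg ‖y‖), mul_nonneg hL ha.le]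
  have e2 : |quad b' y / den p b y| ≤ L' / (p - 1) * (1 + ‖y‖ ^ 2) := by
    rw [abs_div, abs_of_pos hd0, div_mul_eq_mul_div]
    have := (abs_quad_le b' y)
    gcongr
    refine this.trans ?_
    gcongr
    simp
  have hA0 : 0 ≤ A := ha.le.trans haA
  rw [abs_mul, abs_mul, abs_of_pos h0, abs_of_pos (by positivity : 0 < 1 / (p - 1))]
  calc _ ≤ ((A + 1 / 2) / (p - 1)) ^ (1 / (p - 1)) * (1 / (p - 1) *
        (2 * L * (1 + ‖y‖ ^ 2) + L' / (p - 1) * (1 + ‖y‖ ^ 2))) := by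
        gcongr
        exact (abs_sub _ _).trans (add_le_add e1 e2)
    _ = _ := by ring

lemma continuous_profile {a : ℝ} {b : Matrix (Fin n) (Fin n) ℝ} (hp : 1 < p) (ha : 0 < a)
    (hb : b.PosSemidef) : Continuous (profile p a b) := (hasGradHess_profile hp ha hb).continuous

/-- The rate of change of the pairing of the moving profile with a moving test function. -/
lemma hasDerivWithinAt_profile_gtest (hp : 1 < p) (hT : 0 < T)
    (ha : ContDiffOn ℝ 1 a (Set.Icc 0 T)) (hb : ContDiffOn ℝ 1 b (Set.Icc 0 T)) (hα : 0 < α)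
    (hαa : ∀ t ∈ Set.Icc 0 T, α ≤ a t) (hbp : ∀ t ∈ Set.Icc 0 T, (b t).PosSemidef) (s : ℝ)
    (S : Matrix (Fin n) (Fin n) ℝ) {τ : ℝ} (hτ : τ ∈ Set.Icc 0 T) :
    HasDerivWithinAt (fun t => ∫ y, profile p (a t) (b t) y * gtest (a t) s S y)
      (∫ y, (profile p (a τ) (b τ) y * (1 / (p - 1) *
          (derivWithin a (Set.Icc 0 T) τ / (a τ + 1 / 2)
            - quad (derivWithin b (Set.Icc 0 T) τ) y / den p (b τ) y)) * gtest (a τ) s S y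
        + profile p (a τ) (b τ) y * (derivWithin a (Set.Icc 0 T) τ
            * (-(1 / 2) * (‖y‖ ^ 2 * gtest (a τ) s S y))))) (Set.Icc 0 T) τ := by
  obtain ⟨L, hL0, hLd, hL⟩ := exists_lipschitz_of_contDiffOn hT ha
  obtain ⟨L', hL0', hLd', hL'⟩ := exists_lipschitz_of_contDiffOn hT hb
  obtain ⟨A, hA⟩ := isCompact_Icc.exists_bound_of_continuousOn ha.continuousOn
  have ha0 : ∀ t ∈ Set.Icc 0 T, 0 < a t := fun t ht => hα.trans_le (hαa t ht)
  have haA : ∀ t ∈ Set.Icc 0 T, a t ≤ A := fun t ht => (le_abs_self _).trans (hA t ht)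
  have had : ∀ t ∈ Set.Icc 0 T,
      HasDerivWithinAt a (derivWithin a (Set.Icc 0 T) t) (Set.Icc 0 T) t := fun t ht =>
    (ha.differentiableOn (by norm_num) t ht).hasDerivWithinAt
  have hbd : ∀ t ∈ Set.Icc 0 T,
      HasDerivWithinAt b (derivWithin b (Set.Icc 0 T) t) (Set.Icc 0 T) t := fun t ht =>
    (hb.differentiableOn (by norm_num) t ht).hasDerivWithinAt
  have hq := sub_pos.2 hp
  have hA0 : 0 ≤ A := (ha0 τ hτ).le.trans (haA τ hτ)
  set V := ((A + 1 / 2) / (p - 1)) ^ (1 / (p - 1)) with hV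
  have hV0 : 0 ≤ V := by positivity
  set C := V * (1 / (p - 1) * (2 * L + L' / (p - 1))) with hC
  have hC0 : 0 ≤ C := by positivity
  set N := |s| + ‖S‖
  have hN : 0 ≤ N := by positivity
  have hVb : ∀ t ∈ Set.Icc 0 T, ∀ y, |profile p (a t) (b t) y| ≤ V := fun t ht y => by
    rw [abs_of_pos (profile_pos hp (ha0 t ht) (hbp t ht) y)]
    refine (profile_le hp (ha0 t ht) (hbp t ht) y).trans ?_
    have := haA t ht
    have := ha0 t ht
    rw [hV]
    gcongr
  have hgb : ∀ t ∈ Set.Icc 0 T, ∀ y, |gtest (a t) s S y| ≤ N * momentWeight 1 α y :=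
    fun t ht y => (abs_gtest_le _ s S y).trans
      (mul_le_mul_of_nonneg_left (momentWeight_anti 1 (hαa t ht) y) hN)
  have hVlip : ∀ t ∈ Set.Icc 0 T, ∀ y, |profile p (a t) (b t) y - profile p (a τ) (b τ) y|
      ≤ |t - τ| * (C * (1 + ‖y‖ ^ 2)) := fun t ht y => by
    rw [mul_comm]
    exact (convex_Icc 0 T).norm_image_sub_le_of_norm_hasDerivWithin_le
      (fun x hx => hasDerivWithinAt_profile hp (had x hx) (hbd x hx) (ha0 x hx) (hbp x hx) y)
      (fun x hx => abs_profile_deriv_le hp (ha0 x hx) (haA x hx) (hbp x hx) (hLd x hx)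
        (hLd' x hx) y) hτ ht
  refine hasDerivWithinAt_integral_of_lipschitz hτ
    (B := fun y => (C * N + V * (L * N)) * momentWeight 2 α y) (fun t ht => ?_) (fun t ht => ?_)
    ((integrable_momentWeight 2 hα).const_mul _)
    (fun y => (hasDerivWithinAt_profile hp (had τ hτ) (hbd τ hτ) (ha0 τ hτ) (hbp τ hτ) y).mul
      (hasDerivWithinAt_gtest_param (had τ hτ) s S y))
  · exact integrable_mul_of_le_momentWeight hα
      (continuous_profile hp (ha0 t ht) (hbp t ht)).aestronglyMeasurable
      (Eventually.of_forall (hVb t ht))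
      (contDiff_gtest _ s S (k := 0)).continuous.aestronglyMeasurable (hgb t ht)
  · refine Eventually.of_forall fun y => ?_
    have e : profile p (a t) (b t) y * gtest (a t) s S y
        - profile p (a τ) (b τ) y * gtest (a τ) s S y =
        (profile p (a t) (b t) y - profile p (a τ) (b τ) y) * gtest (a t) s S y
        + profile p (a τ) (b τ) y * (gtest (a t) s S y - gtest (a τ) s S y) := by ring
    rw [e]
    refine (abs_add_le _ _).trans ?_
    rw [abs_mul, abs_mul]
    have h1 := hL t ht τ hτ
    rw [Real.norm_eq_abs] at h1
    have h2 := momentWeight_nonneg 2 α y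
    have h3 := (abs_gtest_sub_le (hαa t ht) (hαa τ hτ) s S y)
    calc _ ≤ |t - τ| * (C * (1 + ‖y‖ ^ 2)) * (N * momentWeight 1 α y)
          + V * ((L * |t - τ|) * (N * momentWeight 2 α y)) := by
          gcongr
          · exact hVlip t ht y
          · exact hgb t ht y
          · exact hVb τ hτ y
          · exact h3.trans (by gcongr)
      _ = |t - τ| * (C * N * ((1 + ‖y‖ ^ 2) * momentWeight 1 α y)
          + V * (L * N) * momentWeight 2 α y) := by ring
      _ = _ := by rw [mul_momentWeight]; ring

/-- The operator `Δ - a y·∇ - 2a/(p-1)`. -/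
noncomputable def linOp (p a : ℝ) (f : EuclideanSpace ℝ (Fin n) → ℝ)
    (y : EuclideanSpace ℝ (Fin n)) : ℝ :=
  Laplacian.laplacian f y - a * fderiv ℝ f y y - 2 * a / (p - 1) * f y

lemma linOp_profile_bound {a : ℝ} {b : Matrix (Fin n) (Fin n) ℝ} (hp : 1 < p) (ha : 0 < a)
    (hb : b.PosSemidef) : Measurable (linOp p a (profile p a b)) ∧
      ∃ C, ∀ y, |linOp p a (profile p a b) y| ≤ C * (1 + ‖y‖ ^ 2) ^ 2 := by
  have h := hasGradHess_profile hp ha hb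
  obtain ⟨K, hK⟩ := profile_grad_hess_bound hp ha hb
  have hq := sub_pos.2 hp
  have e : linOp p a (profile p a b) = fun y => trc (profileHess p a b y)
      - a * inner ℝ (profileGrad p a b y) y - 2 * a / (p - 1) * profile p a b y := by
    ext y; rw [linOp, h.laplacian_eq, h.fderiv_apply]
  rw [e]
  refine ⟨?_, n * K + a * K + 2 * a / (p - 1) * K, fun y => ?_⟩
  · have h1 := continuous_trc.measurable.comp h.measurable_hess
    have h2 := h.continuous
    have h3 := h.continuous_grad
    exact (h1.sub (by fun_prop : Continuous _).measurable).sub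
      (by fun_prop : Continuous _).measurable
  · obtain ⟨k0, k1, k2⟩ := hK y
    have hX : 1 ≤ 1 + ‖y‖ ^ 2 := by simp
    have hy := norm_le_one_add_sq y
    set X := 1 + ‖y‖ ^ 2
    have hKX : 0 ≤ K * X := (abs_nonneg _).trans k0
    have hKX2 : K * X ≤ K * X ^ 2 := by nlinarith
    have t1 : |trc (profileHess p a b y)| ≤ n * (K * X ^ 2) :=
      (abs_trc_le _).trans (by gcongr; exact k2.trans hKX2)
    have t2 : |a * inner ℝ (profileGrad p a b y) y| ≤ a * (K * X ^ 2) := by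
      rw [abs_mul, abs_of_pos ha]
      gcongr
      refine (abs_real_inner_le_norm _ _).trans ?_
      calc _ ≤ (K * X) * X := by gcongr
        _ = _ := by ring
    have t3 : |2 * a / (p - 1) * profile p a b y| ≤ 2 * a / (p - 1) * (K * X ^ 2) := by
      rw [abs_mul, abs_of_pos (by positivity)]
      gcongr
      exact k0.trans hKX2
    refine (abs_sub _ _).trans ((add_le_add_left (abs_sub _ _) _).trans ?_)
    calc _ ≤ n * (K * X ^ 2) + a * (K * X ^ 2) + 2 * a / (p - 1) * (K * X ^ 2) := by gcongr
      _ = _ := by ring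

/-- Differentiation in time of the orthogonality conditions. -/
lemma modulation_identity {ξ : ℝ → EuclideanSpace ℝ (Fin n) → ℝ} (hp : 1 < p) (hT : 0 < T)
    (ha : ContDiffOn ℝ 1 a (Set.Icc 0 T)) (hb : ContDiffOn ℝ 1 b (Set.Icc 0 T))
    (ha0 : ∀ t ∈ Set.Icc 0 T, 0 < a t) (hbp : ∀ t ∈ Set.Icc 0 T, (b t).PosSemidef)
    (hv : IsWeakSolution p T a fun τ y => profile p (a τ) (b τ) y + ξ τ y)
    (ho : ∀ t ∈ Set.Icc 0 T, ∀ (s : ℝ) (S : Matrix (Fin n) (Fin n) ℝ), S.IsHermitian →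
      ∫ y, ξ t y * gtest (a t) s S y = 0) (s : ℝ) (hS : S.IsHermitian) {τ : ℝ}
    (hτ : τ ∈ Set.Icc 0 T) :
    ∫ y, (source p (a τ) (b τ) (derivWithin a (Set.Icc 0 T) τ) (derivWithin b (Set.Icc 0 T) τ) y
        + (nonlin p (profile p (a τ) (b τ) y + ξ τ y) - profile p (a τ) (b τ) y ^ p))
        * gtest (a τ) s S y =
      derivWithin a (Set.Icc 0 T) τ * (1 / 2 * ∫ y, ξ τ y * (‖y‖ ^ 2 * gtest (a τ) s S y)) := by
  -- The minimum of `a` on `[0, T]` is positive and serves as a common Gaussian rate for all times.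
  obtain ⟨t₀, ht₀, hmin⟩ := isCompact_Icc.exists_isMinOn ⟨τ, hτ⟩ ha.continuousOn
  have hα := ha0 t₀ ht₀
  have hαa : ∀ t ∈ Set.Icc 0 T, a t₀ ≤ a t := fun t ht => hmin ht
  obtain ⟨K, hK⟩ := hv.bounded
  have hm := hv.aestronglyMeasurable
  have hq := sub_pos.2 hp
  have hVc : ∀ t ∈ Set.Icc 0 T, Continuous (profile p (a t) (b t)) := fun t ht =>
    continuous_profile hp (ha0 t ht) (hbp t ht)
  have hgc : ∀ t, Continuous (gtest t s S) := fun t => (contDiff_gtest t s S (k := 0)).continuous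
  have hVb : ∀ t ∈ Set.Icc 0 T, ∀ᵐ y, |profile p (a t) (b t) y|
      ≤ ((a t + 1 / 2) / (p - 1)) ^ (1 / (p - 1)) := fun t ht => Eventually.of_forall fun y => by
    rw [abs_of_pos (profile_pos hp (ha0 t ht) (hbp t ht) y)]
    exact profile_le hp (ha0 t ht) (hbp t ht) y
  have iV : ∀ t ∈ Set.Icc 0 T, Integrable fun y => profile p (a t) (b t) y * gtest (a t) s S y :=
    fun t ht => integrable_mul_of_le_momentWeight (ha0 t ht) (hVc t ht).aestronglyMeasurable
      (hVb t ht) (hgc _).aestronglyMeasurable (abs_gtest_le _ s S)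
  have iv : ∀ t ∈ Set.Icc 0 T,
      Integrable fun y => (profile p (a t) (b t) y + ξ t y) * gtest (a t) s S y :=
    fun t ht => integrable_mul_of_le_momentWeight (ha0 t ht) (hm t ht)
      (hK t ht) (hgc _).aestronglyMeasurable (abs_gtest_le _ s S)
  -- Since `ξ` pairs to zero, one function of time has two expressions. Comparing its two
  -- derivatives avoids any differentiation of `ξ`.
  have hsame : ∀ t ∈ Set.Icc 0 T, ∫ y, profile p (a t) (b t) y * gtest (a t) s S y =
      ∫ y, (profile p (a t) (b t) y + ξ t y) * gtest (a t) s S y := fun t ht => by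
    have h := ho t ht s S hS
    have e : ∫ y, ξ t y * gtest (a t) s S y =
        ∫ y, ((profile p (a t) (b t) y + ξ t y) * gtest (a t) s S y
          - profile p (a t) (b t) y * gtest (a t) s S y) :=
      integral_congr_ae (Eventually.of_forall fun y => by ring)
    rw [e, integral_sub (iv t ht) (iV t ht)] at h
    linarith
  have d1 := hv.hasDerivWithinAt_gtest_moving hp hT ha hα hαa s hS hτ
  have d2 := (hasDerivWithinAt_profile_gtest hp hT ha hb hα hαa hbp s S hτ).congr
    (fun t ht => (hsame t ht).symm) (hsame τ hτ).symm
  have huniq := (uniqueDiffOn_Icc hT τ hτ).eq_deriv _ d1 d2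
  set a' := derivWithin a (Set.Icc 0 T) τ
  set b' := derivWithin b (Set.Icc 0 T) τ
  have hpos := ha0 τ hτ
  have hbτ := hbp τ hτ
  -- integrability of all the terms
  set V := profile p (a τ) (b τ)
  set ψ := gtest (a τ) s S
  obtain ⟨j1, j2⟩ := (hasGradHess_gtest (a τ) s hS).integrable_rate (a := a τ)
    (gaussBound_gtest hpos s S) hp hpos (hm τ hτ) (hK τ hτ)
  have j3 : Integrable fun y => V y * adjointOp p (a τ) ψ y :=
    ((hasGradHess_gtest (a τ) s hS).integrable_rate (a := a τ)
      (gaussBound_gtest hpos s S) hp hpos (hVc τ hτ).aestronglyMeasurable (hVb τ hτ)).1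
  obtain ⟨hlm, C, hlC⟩ := linOp_profile_bound hp hpos hbτ
  have j4 : Integrable fun y => linOp p (a τ) V y * ψ y := by
    refine integrable_of_le_momentWeight (k := 3) (K := C * (|s| + ‖S‖)) hpos
      (hlm.aestronglyMeasurable.mul (hgc _).aestronglyMeasurable) (Eventually.of_forall fun y => ?_)
    rw [abs_mul, ← mul_momentWeight, ← mul_momentWeight]
    have h1 := hlC y
    have h2 := (abs_nonneg _).trans h1
    calc _ ≤ (C * (1 + ‖y‖ ^ 2) ^ 2) * ((|s| + ‖S‖) * momentWeight 1 (a τ) y) := by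
          gcongr
          exact abs_gtest_le _ s S y
      _ = _ := by ring
  have j5 : Integrable fun y => V y * (a' * (-(1 / 2) * (‖y‖ ^ 2 * ψ y))) := by
    refine integrable_mul_of_le_momentWeight hpos (hVc τ hτ).aestronglyMeasurable (hVb τ hτ)
      (k := 2) (C := |a'| * (|s| + ‖S‖)) ?_ fun y => ?_
    · have := hgc (a τ)
      exact (by fun_prop : Continuous _).aestronglyMeasurable
    · exact abs_mul_gtest_deriv_le a' (a τ) s S y
  have j6 : Integrable fun y => (V y + ξ τ y) * (a' * (-(1 / 2) * (‖y‖ ^ 2 * ψ y))) := by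
    refine integrable_mul_of_le_momentWeight hpos (hm τ hτ) (hK τ hτ)
      (k := 2) (C := |a'| * (|s| + ‖S‖)) ?_ fun y => ?_
    · have := hgc (a τ)
      exact (by fun_prop : Continuous _).aestronglyMeasurable
    · exact abs_mul_gtest_deriv_le a' (a τ) s S y
  have j7 : Integrable fun y =>
      V y * (1 / (p - 1) * (a' / (a τ + 1 / 2) - quad b' y / den p (b τ) y)) * ψ y := by
    refine integrable_of_le_momentWeight (k := 2) (K := (((a τ + 1 / 2) / (p - 1)) ^ (1 / (p - 1))
      * (1 / (p - 1) * (2 * |a'| + ‖b'‖ / (p - 1)))) * (|s| + ‖S‖)) hpos ?_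
      (Eventually.of_forall fun y => ?_)
    · have h1 := hVc τ hτ
      have h2 := hgc (a τ)
      have h3 := continuous_quad b'
      have h4 := (continuous_den p (b τ))
      have h5 : Continuous fun y => quad b' y / den p (b τ) y :=
        h3.div h4 fun y => (den_pos hp hbτ y).ne'
      exact (by fun_prop : Continuous _).aestronglyMeasurable
    · rw [abs_mul, ← mul_momentWeight]
      have h1 := abs_profile_deriv_le (a' := a') (b' := b') hp hpos le_rfl hbτ le_rfl le_rfl y
      have h2 := (abs_nonneg _).trans h1
      refine (mul_le_mul h1 (abs_gtest_le _ s S y) (abs_nonneg _) h2).trans_eq ?_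
      ring
  have j8 : Integrable fun y => ξ τ y * adjointOp p (a τ) ψ y :=
    (j1.sub j3).congr (Eventually.of_forall fun y => by simp only [Pi.sub_apply]; ring)
  -- The adjoint operator maps `ψ` to another test function of the same kind, so orthogonality
  -- removes the linear term in `ξ`.
  have z1 : ∫ y, ξ τ y * adjointOp p (a τ) ψ y = 0 := by
    rw [← ho τ hτ (2 * S.trace - 2 * a τ / (p - 1) * s) ((-(2 * a τ + 2 * a τ / (p - 1))) • S)
      (by rw [Matrix.IsHermitian, Matrix.conjTranspose_smul, hS.eq, star_trivial])]
    exact integral_congr_ae (Eventually.of_forall fun y => by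
      simp only [ψ, adjointOp_gtest p (a τ) s hS y])
  have z2 : ∫ y, (V y * adjointOp p (a τ) ψ y - linOp p (a τ) V y * ψ y) = 0 :=
    integral_profile_adjointOp hp hpos hbτ s hS
  have k1 : Integrable fun y => (V y + ξ τ y) * adjointOp p (a τ) ψ y
      + nonlin p (V y + ξ τ y) * ψ y := j1.add j2
  have k2 : Integrable fun y => V y * adjointOp p (a τ) ψ y - linOp p (a τ) V y * ψ y := j3.sub j4
  have k3 : Integrable fun y => ((V y + ξ τ y) * adjointOp p (a τ) ψ y
      + nonlin p (V y + ξ τ y) * ψ y)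
      - (V y * adjointOp p (a τ) ψ y - linOp p (a τ) V y * ψ y) := k1.sub k2
  have k4 : Integrable fun y => (((V y + ξ τ y) * adjointOp p (a τ) ψ y
      + nonlin p (V y + ξ τ y) * ψ y)
      - (V y * adjointOp p (a τ) ψ y - linOp p (a τ) V y * ψ y))
      - ξ τ y * adjointOp p (a τ) ψ y := k3.sub j8
  have hfin : ∫ y, (source p (a τ) (b τ) a' b' y + (nonlin p (V y + ξ τ y) - V y ^ p)) * ψ y =
      ∫ y, (((((V y + ξ τ y) * adjointOp p (a τ) ψ y + nonlin p (V y + ξ τ y) * ψ y)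
      - (V y * adjointOp p (a τ) ψ y - linOp p (a τ) V y * ψ y))
      - ξ τ y * adjointOp p (a τ) ψ y)
      - V y * (1 / (p - 1) * (a' / (a τ + 1 / 2) - quad b' y / den p (b τ) y)) * ψ y) := by
    refine integral_congr_ae (Eventually.of_forall fun y => ?_)
    simp only
    rw [source_eq_expanded hp hpos hbτ, ← source_eq hp hpos hbτ]
    simp only [linOp, V]
    ring
  -- The motion of the Gaussian contributes to both derivatives. Only the part paired with `ξ`
  -- survives in the difference.
  have hx : ∫ y, ξ τ y * (‖y‖ ^ 2 * ψ y) * (a' * -(1 / 2)) =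
      ∫ y, ((V y + ξ τ y) * (a' * (-(1 / 2) * (‖y‖ ^ 2 * ψ y)))
        - V y * (a' * (-(1 / 2) * (‖y‖ ^ 2 * ψ y)))) :=
    integral_congr_ae (Eventually.of_forall fun y => by ring)
  rw [integral_mul_const, integral_sub j6 j5] at hx
  rw [hfin, integral_sub k4 j7, integral_sub k3 j8, integral_sub k1 k2, z1, z2]
  rw [integral_add j7 j5] at huniq
  simp only [weakRate] at huniq
  linarith

end Curves

/-! ### The remainder of the linearisation of the nonlinearity -/

/-- Subadditivity of `x ↦ x ^ r`, applied to the larger number as the smaller one plus the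
difference. -/
lemma abs_rpow_sub_rpow_le_of_le_one {r A B : ℝ} (hr0 : 0 ≤ r) (hr1 : r ≤ 1) (hA : 0 ≤ A)
    (hB : 0 ≤ B) : |A ^ r - B ^ r| ≤ |A - B| ^ r := by
  have key : ∀ A B : ℝ, 0 ≤ A → 0 ≤ B → A ≤ B → |A ^ r - B ^ r| ≤ |A - B| ^ r := by
    intro A B hA hB h
    have h1 : A ^ r ≤ B ^ r := Real.rpow_le_rpow hA h hr0
    have h2 := Real.rpow_add_le_add_rpow hA (sub_nonneg.2 h) hr0 hr1
    rw [add_sub_cancel] at h2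
    rw [abs_of_nonpos (by linarith), abs_of_nonpos (by linarith), neg_sub, neg_sub]
    linarith
  rcases le_total A B with h | h
  · exact key A B hA hB h
  · rw [abs_sub_comm, abs_sub_comm A B]
    exact key B A hB hA h

lemma abs_rpow_sub_rpow_le_of_one_le {r A B M : ℝ} (hr : 1 ≤ r) (hA : 0 ≤ A) (hB : 0 ≤ B)
    (hAM : A ≤ M) (hBM : B ≤ M) : |A ^ r - B ^ r| ≤ r * M ^ (r - 1) * |A - B| := by
  have h := (convex_Icc 0 M).norm_image_sub_le_of_norm_hasDerivWithin_le
    (f := fun x : ℝ => x ^ r) (f' := fun x => r * x ^ (r - 1)) (C := r * M ^ (r - 1))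
    (fun x _ => (Real.hasDerivAt_rpow_const (Or.inr hr)).hasDerivWithinAt) (fun x hx => ?_)
    ⟨hB, hBM⟩ ⟨hA, hAM⟩
  · exact h
  · have h0 := Real.rpow_nonneg hx.1 (r - 1)
    rw [Real.norm_eq_abs, abs_of_nonneg (by positivity)]
    have := hx.2
    have := hx.1
    gcongr

lemma add_rpow_le_two_rpow {s A B : ℝ} (hs : 0 ≤ s) (hA : 0 ≤ A) (hB : 0 ≤ B) :
    (A + B) ^ s ≤ 2 ^ s * (A ^ s + B ^ s) := by
  have key : ∀ A B : ℝ, 0 ≤ A → 0 ≤ B → A ≤ B → (A + B) ^ s ≤ 2 ^ s * (A ^ s + B ^ s) := by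
    intro A B hA hB h
    calc (A + B) ^ s ≤ (2 * B) ^ s := by gcongr; linarith
      _ = 2 ^ s * B ^ s := Real.mul_rpow (by norm_num) hB
      _ ≤ _ := by
        gcongr
        have := Real.rpow_nonneg hA s
        linarith
  rcases le_total A B with h | h
  · exact key A B hA hB h
  · rw [add_comm A, add_comm (A ^ s)]
    exact key B A hB hA h

/-- The derivative of the left-hand side in `x` is `p (|u|^{p-1} - V^{p-1})` at `u = V + x`. For `p
≤ 2` Hölder continuity bounds it by a multiple of `|x|^{p-1}`. For `p ≥ 2` the mean value theorem
bounds it by a multiple of `(V₁ + |x|)^{p-2} |x|`. No bound on `x` is assumed, which is why both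
powers appear. -/
lemma abs_nonlin_sub_linear_le {p V₁ : ℝ} (hp : 1 < p) (hV₁ : 0 ≤ V₁) :
    ∃ C, 0 ≤ C ∧ ∀ V x : ℝ, 0 < V → V ≤ V₁ →
      |nonlin p (V + x) - V ^ p - p * V ^ (p - 1) * x| ≤ C * (|x| ^ 2 + |x| ^ p) := by
  have hp0 : 0 < p := by linarith
  -- the difference of the derivatives
  obtain ⟨C, hC, hd⟩ : ∃ C, 0 ≤ C ∧ ∀ V u d : ℝ, 0 < V → V ≤ V₁ → 0 ≤ d → |u - V| ≤ d →
      |(|u|) ^ (p - 1) - V ^ (p - 1)| * d ≤ C * (d ^ 2 + d ^ p) := by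
    have hstep : ∀ d : ℝ, 0 ≤ d → ∀ r : ℝ, 0 ≤ r → d ^ r * d = d ^ (r + 1) := fun d hd r hr => by
      rw [Real.rpow_add_one' hd (by linarith)]
    rcases le_total (p - 1) 1 with h1 | h1
    · refine ⟨1, zero_le_one, fun V u d hV _ hd h => ?_⟩
      have h2 := abs_rpow_sub_rpow_le_of_le_one (sub_nonneg.2 hp.le) h1 (abs_nonneg u) hV.le
      have h3 : |(|u|) - V| ≤ d := by
        have := abs_abs_sub_abs_le u V
        rw [abs_of_pos hV] at this
        exact this.trans h
      have h4 : |(|u|) - V| ^ (p - 1) ≤ d ^ (p - 1) :=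
        Real.rpow_le_rpow (abs_nonneg _) h3 (sub_nonneg.2 hp.le)
      calc _ ≤ d ^ (p - 1) * d := by gcongr; exact h2.trans h4
        _ = d ^ p := by rw [hstep d hd _ (sub_nonneg.2 hp.le), sub_add_cancel]
        _ ≤ _ := by nlinarith [sq_nonneg d]
    · have hs : 0 ≤ p - 1 - 1 := by linarith
      refine ⟨(p - 1) * (2 ^ (p - 1 - 1) * (V₁ ^ (p - 1 - 1) + 1)), by positivity,
        fun V u d hV hVV hd h => ?_⟩
      have h3 : |(|u|) - V| ≤ d := by
        have := abs_abs_sub_abs_le u V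
        rw [abs_of_pos hV] at this
        exact this.trans h
      have h2 := abs_rpow_sub_rpow_le_of_one_le (M := V₁ + d) h1 (abs_nonneg u) hV.le
        (by linarith [(abs_le.1 h3).2]) (by linarith)
      have h4 := add_rpow_le_two_rpow hs hV₁ hd
      have h5 : 0 ≤ d ^ (p - 1 - 1) := Real.rpow_nonneg hd _
      have h6 : 0 ≤ V₁ ^ (p - 1 - 1) := Real.rpow_nonneg hV₁ _
      have e : d ^ (p - 1 - 1) * d * d = d ^ p := by
        rw [hstep d hd _ hs, hstep d hd _ (by linarith)]; congr 1; ring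
      have hdp : 0 ≤ d ^ p := Real.rpow_nonneg hd _
      have hp1 : 0 ≤ p - 1 := by linarith
      calc _ ≤ ((p - 1) * (V₁ + d) ^ (p - 1 - 1) * |(|u|) - V|) * d := by gcongr
        _ ≤ ((p - 1) * (2 ^ (p - 1 - 1) * (V₁ ^ (p - 1 - 1) + d ^ (p - 1 - 1))) * d) * d := by
          gcongr
        _ = (p - 1) * 2 ^ (p - 1 - 1) * (V₁ ^ (p - 1 - 1) * d ^ 2 + d ^ (p - 1 - 1) * d * d) := by
          ring
        _ = (p - 1) * 2 ^ (p - 1 - 1) * (V₁ ^ (p - 1 - 1) * d ^ 2 + d ^ p) := by rw [e]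
        _ ≤ (p - 1) * 2 ^ (p - 1 - 1) * ((V₁ ^ (p - 1 - 1) + 1) * (d ^ 2 + d ^ p)) := by
          gcongr
          nlinarith [sq_nonneg d, mul_nonneg h6 hdp]
        _ = _ := by ring
  refine ⟨p * C, by positivity, fun V x hV hVV => ?_⟩
  have h := (convex_closedBall V |x|).norm_image_sub_le_of_norm_hasDerivWithin_le
    (f := fun u => nonlin p u - p * V ^ (p - 1) * u)
    (f' := fun u => p * |u| ^ (p - 1) - p * V ^ (p - 1) * 1)
    -- The bound `hd` controls the derivative only after multiplication by `|x|`. With the supremum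
    -- as constant, the division by `|x|` is postponed until `x = 0` has been set aside.
    (C := sSup ((fun u => ‖p * |u| ^ (p - 1) - p * V ^ (p - 1) * 1‖) '' Metric.closedBall V |x|))
    (fun u _ => ((hasDerivAt_nonlin hp u).sub
      ((hasDerivAt_id u).const_mul _)).hasDerivWithinAt) (fun u hu => ?_)
    (Metric.mem_closedBall_self (abs_nonneg x)) (y := V + x) (by simp)
  · have e : nonlin p (V + x) - V ^ p - p * V ^ (p - 1) * x =
        nonlin p (V + x) - p * V ^ (p - 1) * (V + x) - (nonlin p V - p * V ^ (p - 1) * V) := by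
      rw [nonlin_of_pos hV]; ring
    rw [e]
    refine h.trans ?_
    rw [add_sub_cancel_left, Real.norm_eq_abs]
    rcases (abs_nonneg x).eq_or_lt with hx | hx
    · rw [← hx, mul_zero]
      positivity
    rw [← le_div_iff₀ hx]
    refine csSup_le (Set.Nonempty.image _ ⟨V, Metric.mem_closedBall_self hx.le⟩) ?_
    rintro _ ⟨u, hu, rfl⟩
    simp only
    rw [le_div_iff₀ hx, mul_one, ← mul_sub, Real.norm_eq_abs, abs_mul, abs_of_pos hp0, mul_assoc,
      mul_assoc]
    refine mul_le_mul_of_nonneg_left ?_ hp0.le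
    exact hd V u |x| hV hVV hx.le (by simpa [Real.dist_eq] using hu)
  · refine le_csSup ?_ ⟨u, hu, rfl⟩
    refine ((isCompact_closedBall V |x|).image_of_continuousOn ?_).bddAbove
    have hc : Continuous fun x : ℝ => |x| ^ (p - 1) :=
      continuous_abs.rpow_const fun _ => Or.inr (by linarith)
    exact (((hc.const_mul p).sub continuous_const).norm).continuousOn

/-! ### Coercivity -/

/-- Polarisation. Symmetry is essential, since an antisymmetric matrix has a vanishing quadratic
form. -/
lemma eq_zero_of_quad_eq_zero {S : Matrix (Fin n) (Fin n) ℝ} (hS : S.IsHermitian)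
    (h : ∀ y, quad S y = 0) : S = 0 := by
  have h1 : ∀ x y, inner ℝ x (act S y) = (0 : ℝ) := fun x y => by
    have h2 := h (x + y)
    have h3 := h x
    have h4 := h y
    rw [quad_eq_inner] at h2 h3 h4
    simp only [map_add, inner_add_left, inner_add_right] at h2
    have h5 : inner ℝ y (act S x) = (inner ℝ x (act S y) : ℝ) := by
      rw [← inner_act_comm hS, real_inner_comm]
    simp only [act] at *
    linarith
  have h2 : act S = 0 := by
    ext1 y
    have := h1 (act S y) y
    rw [real_inner_self_eq_norm_sq] at this
    simpa using this
  exact (Matrix.toEuclideanCLM (𝕜 := ℝ)).injective (h2.trans (map_zero _).symm)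

lemma qpoly_smul (r s : ℝ) (S : Matrix (Fin n) (Fin n) ℝ) (y : EuclideanSpace ℝ (Fin n)) :
    qpoly (r * s) (r • S) y = r * qpoly s S y := by
  simp only [qpoly, quad_smul]; ring

lemma continuous_qpoly_uncurry : Continuous
    fun x : (ℝ × Matrix (Fin n) (Fin n) ℝ) × EuclideanSpace ℝ (Fin n) =>
      qpoly x.1.1 x.1.2 x.2 := by
  unfold qpoly quad
  refine (by fun_prop : Continuous _).add (continuous_finsetSum _ fun i _ =>
    continuous_finsetSum _ fun j _ => ?_)
  have h : Continuous fun x : (ℝ × Matrix (Fin n) (Fin n) ℝ) × EuclideanSpace ℝ (Fin n) =>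
      x.1.2 i j := (by fun_prop : Continuous fun x : (ℝ × Matrix (Fin n) (Fin n) ℝ)
        × EuclideanSpace ℝ (Fin n) => x.1.2).matrix_elem i j
  fun_prop

/-- Both sides are homogeneous of degree two, so a minimum over the compact set `|s| + ‖S‖ = 1`
suffices. It is positive because a quadratic polynomial that vanishes on the open unit ball has `s =
0` at the origin and `S = 0` by scaling and polarisation. -/
lemma exists_qpoly_lower_bound (n : ℕ) : ∃ δ > 0, ∀ (s : ℝ) (S : Matrix (Fin n) (Fin n) ℝ),
    S.IsHermitian →
      δ * (|s| + ‖S‖) ^ 2 ≤ ∫ y in Metric.closedBall (0 : EuclideanSpace ℝ (Fin n)) 1,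
        qpoly s S y ^ 2 := by
  let f : ℝ × Matrix (Fin n) (Fin n) ℝ → ℝ := fun x =>
    ∫ y in Metric.closedBall (0 : EuclideanSpace ℝ (Fin n)) 1, qpoly x.1 x.2 y ^ 2
  have hfc : Continuous f := continuous_parametric_integral_of_continuous
    (f := fun (x : ℝ × Matrix (Fin n) (Fin n) ℝ) y => qpoly x.1 x.2 y ^ 2)
    (continuous_qpoly_uncurry.pow 2) (isCompact_closedBall _ _)
  have hqc : ∀ s (S : Matrix (Fin n) (Fin n) ℝ), Continuous (qpoly s S) := fun s S =>
    continuous_const.add (continuous_quad S)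
  let Z : Set (ℝ × Matrix (Fin n) (Fin n) ℝ) := {x | |x.1| + ‖x.2‖ = 1 ∧ x.2.IsHermitian}
  have hZc : IsCompact Z := by
    refine Metric.isCompact_of_isClosed_isBounded ?_ ?_
    · refine (isClosed_eq (by fun_prop) (by fun_prop)).inter ?_
      exact isClosed_eq (continuous_snd.matrix_conjTranspose) continuous_snd
    · refine (Metric.isBounded_closedBall (x := (0 : ℝ × Matrix (Fin n) (Fin n) ℝ)) (r := 1)).subset
        fun x hx => ?_
      rw [mem_closedBall_zero_iff, Prod.norm_def]
      have h1 : |x.1| + ‖x.2‖ = 1 := hx.1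
      have h2 := abs_nonneg x.1
      have h3 := norm_nonneg x.2
      exact max_le (by rw [Real.norm_eq_abs]; linarith) (by linarith)
  obtain ⟨x₀, hx₀, hmin⟩ := hZc.exists_isMinOn
    ⟨((1 : ℝ), (0 : Matrix (Fin n) (Fin n) ℝ)), by simp [Z]⟩ hfc.continuousOn
  have hpos : 0 < f x₀ := by
    refine lt_of_le_of_ne (integral_nonneg fun y => sq_nonneg _) fun h0 => ?_
    have hae := (setIntegral_eq_zero_iff_of_nonneg_ae (Eventually.of_forall fun y => sq_nonneg _)
      (((hqc x₀.1 x₀.2).pow 2).continuousOn.integrableOn_compact (isCompact_closedBall _ _))).1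
      h0.symm
    have hae2 : (fun y => qpoly x₀.1 x₀.2 y ^ 2)
        =ᵐ[volume.restrict (Metric.ball (0 : EuclideanSpace ℝ (Fin n)) 1)] fun _ => (0 : ℝ) :=
      ae_restrict_of_ae_restrict_of_subset Metric.ball_subset_closedBall hae
    have hzero := Measure.eqOn_open_of_ae_eq hae2 Metric.isOpen_ball
      ((hqc x₀.1 x₀.2).pow 2).continuousOn continuousOn_const
    have hq : ∀ y ∈ Metric.ball (0 : EuclideanSpace ℝ (Fin n)) 1, qpoly x₀.1 x₀.2 y = 0 :=
      fun y hy => pow_eq_zero_iff (two_ne_zero) |>.1 (hzero hy)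
    have hs : x₀.1 = 0 := by
      have := hq 0 (by simp)
      simpa [qpoly, quad_eq_inner] using this
    have hS : x₀.2 = 0 := by
      refine eq_zero_of_quad_eq_zero hx₀.2 fun y => ?_
      have h1 : (0 : ℝ) < 1 + ‖y‖ := by positivity
      -- Dividing by `1 + |y|` brings any point into the open ball, including `y = 0`.
      have h2 := hq ((1 + ‖y‖)⁻¹ • y) (by
        rw [mem_ball_zero_iff, norm_smul, norm_inv, Real.norm_eq_abs, abs_of_pos h1,
          inv_mul_lt_iff₀ h1]
        linarith)
      rw [qpoly, hs, zero_add, quad_eq_inner, map_smul, inner_smul_left, inner_smul_right,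
        ← quad_eq_inner] at h2
      simpa [h1.ne'] using h2
    have := hx₀.1
    rw [hs, hS] at this
    simp at this
  refine ⟨f x₀, hpos, fun s S hS => ?_⟩
  set N := |s| + ‖S‖ with hN
  have hN0 : 0 ≤ N := by positivity
  rcases hN0.eq_or_lt with h0 | h0
  · rw [← h0]
    simpa using integral_nonneg fun y => sq_nonneg _
  have hmem : (N⁻¹ * s, N⁻¹ • S) ∈ Z := by
    refine ⟨?_, ?_⟩
    · simp only [abs_mul, norm_smul, norm_inv, Real.norm_eq_abs, abs_inv, abs_of_pos h0]
      rw [← mul_add, ← hN, inv_mul_cancel₀ h0.ne']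
    · rw [Matrix.IsHermitian, Matrix.conjTranspose_smul, hS.eq, star_trivial]
  have h1 : f x₀ ≤ f (N⁻¹ * s, N⁻¹ • S) := hmin hmem
  simp only [f, qpoly_smul, mul_pow] at h1 ⊢
  rw [integral_const_mul, inv_pow, ← div_eq_inv_mul, le_div_iff₀ (by positivity)] at h1
  exact h1

/-! ### The linear system for the remainders -/

section Kernel

variable {p a : ℝ} {b : Matrix (Fin n) (Fin n) ℝ}

/-- The weight `V_{ab} / ((p - 1)(p - 1 + y b y))` of the linear system. -/
noncomputable def kern (p a : ℝ) (b : Matrix (Fin n) (Fin n) ℝ)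
    (y : EuclideanSpace ℝ (Fin n)) : ℝ := profile p a b y / ((p - 1) * den p b y)

/-- The cubic term of the source. -/
noncomputable def cubicTerm (p : ℝ) (b : Matrix (Fin n) (Fin n) ℝ)
    (y : EuclideanSpace ℝ (Fin n)) : ℝ :=
  4 * p / (p - 1) ^ 2 * ‖act b y‖ ^ 2 * quad b y / den p b y

/-- An upper bound for the profile when `a ≤ 1`. -/
noncomputable def profileMax (p : ℝ) : ℝ := (3 / 2 / (p - 1)) ^ (1 / (p - 1))

lemma profileMax_nonneg (hp : 1 < p) : 0 ≤ profileMax p := by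
  have := sub_pos.2 hp
  unfold profileMax; positivity

lemma profile_le_max (hp : 1 < p) (ha : 0 < a) (ha1 : a ≤ 1) (hb : b.PosSemidef)
    (y : EuclideanSpace ℝ (Fin n)) : profile p a b y ≤ profileMax p := by
  have hq := sub_pos.2 hp
  refine (profile_le hp ha hb y).trans ?_
  unfold profileMax
  gcongr
  linarith

lemma continuous_kern (hp : 1 < p) (ha : 0 < a) (hb : b.PosSemidef) : Continuous (kern p a b) :=
  (continuous_profile hp ha hb).div (continuous_const.mul (continuous_den p b)) fun y =>
    (mul_pos (sub_pos.2 hp) (den_pos hp hb y)).ne'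

lemma kern_pos (hp : 1 < p) (ha : 0 < a) (hb : b.PosSemidef) (y : EuclideanSpace ℝ (Fin n)) :
    0 < kern p a b y :=
  div_pos (profile_pos hp ha hb y) (mul_pos (sub_pos.2 hp) (den_pos hp hb y))

lemma kern_le (hp : 1 < p) (ha : 0 < a) (ha1 : a ≤ 1) (hb : b.PosSemidef)
    (y : EuclideanSpace ℝ (Fin n)) : kern p a b y ≤ profileMax p / ((p - 1) * (p - 1)) := by
  have hq := sub_pos.2 hp
  have := profile_le_max hp ha ha1 hb y
  have := profileMax_nonneg hp
  have := le_den (p := p) hb y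
  unfold kern
  gcongr

lemma abs_kern_le (hp : 1 < p) (ha : 0 < a) (ha1 : a ≤ 1) (hb : b.PosSemidef)
    (y : EuclideanSpace ℝ (Fin n)) : |kern p a b y| ≤ profileMax p / ((p - 1) * (p - 1)) := by
  rw [abs_of_pos (kern_pos hp ha hb y)]
  exact kern_le hp ha ha1 hb y

lemma exists_kern_lower_bound (hp : 1 < p) : ∃ δ > 0, ∀ (n : ℕ) (a : ℝ)
    (b : Matrix (Fin n) (Fin n) ℝ) (y : EuclideanSpace ℝ (Fin n)), 0 < a → a ≤ 1 →
    b.PosSemidef → ‖b‖ ≤ 1 → ‖y‖ ≤ 1 → δ ≤ kern p a b y * gauss a y := by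
  have hq := sub_pos.2 hp
  have hp0 : 0 < p := by linarith
  -- On the unit ball, with `‖b‖ ≤ 1` and `0 < a ≤ 1`, one has `den ≤ p`, `a + 1/2 ≥ 1/2` and `a
  -- |y|² / 2 ≤ 1/2`.
  refine ⟨(1 / 2 / p) ^ (1 / (p - 1)) / ((p - 1) * p) * Real.exp (-(1 / 2)), by positivity,
    fun n a b y ha ha1 hb hb1 hy => ?_⟩
  have hd : den p b y ≤ p := by
    have h1 := (le_abs_self _).trans (abs_quad_le b y)
    have h2 : ‖b‖ * ‖y‖ ^ 2 ≤ 1 * 1 ^ 2 := by gcongr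
    unfold den
    linarith
  have hd0 := den_pos hp hb y
  have h1 : (1 / 2 / p) ^ (1 / (p - 1)) ≤ profile p a b y := by
    rw [profile_eq]
    gcongr
    linarith
  have h2 : Real.exp (-(1 / 2)) ≤ gauss a y := by
    unfold gauss
    gcongr
    have : a * ‖y‖ ^ 2 ≤ 1 * 1 ^ 2 := by gcongr
    linarith
  have h3 := profile_pos hp ha hb y
  unfold kern
  gcongr

lemma abs_cubicTerm_le (hp : 1 < p) (hb : b.PosSemidef) (y : EuclideanSpace ℝ (Fin n)) :
    |cubicTerm p b y| ≤ 4 * p / (p - 1) ^ 3 * ‖b‖ ^ 3 * (1 + ‖y‖ ^ 2) ^ 2 := by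
  have hq := sub_pos.2 hp
  have hp0 : 0 < p := by linarith
  have h1 := norm_act_le b y
  have h2 := abs_quad_le b y
  have h3 := le_den (p := p) hb y
  have h4 := den_pos hp hb y
  have h5 : ‖y‖ ^ 2 ≤ 1 + ‖y‖ ^ 2 := by linarith
  unfold cubicTerm
  rw [abs_div, abs_mul, abs_of_nonneg (by positivity : 0 ≤ 4 * p / (p - 1) ^ 2 * ‖act b y‖ ^ 2),
    abs_of_pos h4]
  calc _ ≤ 4 * p / (p - 1) ^ 2 * (‖b‖ * ‖y‖) ^ 2 * (‖b‖ * ‖y‖ ^ 2) / (p - 1) := by gcongr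
    _ = 4 * p / (p - 1) ^ 3 * ‖b‖ ^ 3 * (‖y‖ ^ 2) ^ 2 := by field_simp
    _ ≤ _ := by gcongr

lemma continuous_cubicTerm (hp : 1 < p) (hb : b.PosSemidef) : Continuous (cubicTerm p b) := by
  unfold cubicTerm
  refine Continuous.div ?_ (continuous_den p b) fun y => (den_pos hp hb y).ne'
  have := continuous_quad b
  fun_prop

lemma source_velocity_eq (hp : 1 < p) (ha : 0 < a) (hb : b.PosSemidef) (ra : ℝ)
    (rb : Matrix (Fin n) (Fin n) ℝ) (y : EuclideanSpace ℝ (Fin n)) :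
    source p a b (velocityA p a b ra) (velocityB p a b rb) y =
      -(kern p a b y * (qpoly ((p - 1) * ra) (ra • b - rb) y + cubicTerm p b y)) :=
  source_velocity hp ha hb ra rb y

/-- Fixing the decay rate at `1/4` makes all later constants independent of `a`. -/
lemma abs_gtest_le_quarter (ha : 1 / 4 ≤ a) (s : ℝ) (S : Matrix (Fin n) (Fin n) ℝ)
    (y : EuclideanSpace ℝ (Fin n)) :
    |gtest a s S y| ≤ (|s| + ‖S‖) * momentWeight 1 (1 / 4) y :=
  (abs_gtest_le a s S y).trans
    (mul_le_mul_of_nonneg_left (momentWeight_anti 1 ha y) (by positivity))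

lemma continuous_gtest (a s : ℝ) (S : Matrix (Fin n) (Fin n) ℝ) : Continuous (gtest a s S) :=
  (contDiff_gtest a s S (k := 0)).continuous

lemma integrable_kern_qpoly_gtest (hp : 1 < p) (ha : 1 / 4 ≤ a) (ha1 : a ≤ 1) (hb : b.PosSemidef)
    (s s' : ℝ) (S S' : Matrix (Fin n) (Fin n) ℝ) :
    Integrable fun y => kern p a b y * qpoly s S y * gtest a s' S' y := by
  have ha0 : 0 < a := by linarith
  have hqc : Continuous (qpoly s S) := continuous_const.add (continuous_quad S)
  have hkc := continuous_kern hp ha0 hb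
  have hgc := continuous_gtest a s' S'
  refine integrable_of_le_momentWeight (k := 2) (a := 1 / 4)
    (K := profileMax p / ((p - 1) * (p - 1)) * (|s| + ‖S‖) * (|s'| + ‖S'‖)) (by norm_num)
    (by fun_prop : Continuous _).aestronglyMeasurable (Eventually.of_forall fun y => ?_)
  rw [abs_mul, abs_mul, ← mul_momentWeight]
  have h0 := abs_kern_le hp ha0 ha1 hb y
  have h1 := (abs_nonneg _).trans h0
  calc _ ≤ profileMax p / ((p - 1) * (p - 1)) * ((|s| + ‖S‖) * (1 + ‖y‖ ^ 2))
        * ((|s'| + ‖S'‖) * momentWeight 1 (1 / 4) y) := by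
        gcongr
        · exact abs_qpoly_le s S y
        · exact abs_gtest_le_quarter ha s' S' y
    _ = _ := by ring

/-- Coercivity of the linear system in the absence of a fluctuation. -/
lemma exists_coercive (n : ℕ) (hp : 1 < p) : ∃ δ > 0, ∀ (a : ℝ) (b : Matrix (Fin n) (Fin n) ℝ),
    1 / 4 ≤ a → a ≤ 1 → b.PosSemidef → ‖b‖ ≤ 1 → ∀ (s : ℝ) (S : Matrix (Fin n) (Fin n) ℝ),
      S.IsHermitian →
        δ * (|s| + ‖S‖) ^ 2 ≤ ∫ y, kern p a b y * qpoly s S y * gtest a s S y := by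
  obtain ⟨δ₁, hδ₁, h₁⟩ := exists_kern_lower_bound hp
  obtain ⟨δ₂, hδ₂, h₂⟩ := exists_qpoly_lower_bound n
  refine ⟨δ₁ * δ₂, by positivity, fun a b ha ha1 hb hb1 s S hS => ?_⟩
  have ha0 : 0 < a := by linarith
  have hqc : Continuous (qpoly s S) := continuous_const.add (continuous_quad S)
  have hint := integrable_kern_qpoly_gtest hp ha ha1 hb s s S S
  have hsq : ∀ y, kern p a b y * qpoly s S y * gtest a s S y
      = kern p a b y * gauss a y * qpoly s S y ^ 2 := fun y => by rw [gtest]; ring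
  calc δ₁ * δ₂ * (|s| + ‖S‖) ^ 2 = δ₁ * (δ₂ * (|s| + ‖S‖) ^ 2) := by ring
    _ ≤ δ₁ * ∫ y in Metric.closedBall (0 : EuclideanSpace ℝ (Fin n)) 1, qpoly s S y ^ 2 := by
      gcongr; exact h₂ s S hS
    _ = ∫ y in Metric.closedBall (0 : EuclideanSpace ℝ (Fin n)) 1, δ₁ * qpoly s S y ^ 2 := by
      rw [integral_const_mul]
    _ ≤ ∫ y in Metric.closedBall (0 : EuclideanSpace ℝ (Fin n)) 1,
        kern p a b y * qpoly s S y * gtest a s S y := by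
      refine setIntegral_mono_on ?_ hint.integrableOn measurableSet_closedBall fun y hy => ?_
      · exact ((continuous_const.mul (hqc.pow 2)).continuousOn.integrableOn_compact
          (isCompact_closedBall _ _))
      · rw [hsq]
        gcongr
        exact h₁ n a b y ha0 ha1 hb hb1 (by simpa using hy)
    _ ≤ _ := by
      refine setIntegral_le_integral hint (Eventually.of_forall fun y => ?_)
      simp only [hsq, Pi.zero_apply]
      have := kern_pos hp ha0 hb y
      have := gauss_pos a y
      positivity

lemma abs_integral_kern_cubic_le (n : ℕ) (hp : 1 < p) : ∃ C, 0 ≤ C ∧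
    ∀ (a : ℝ) (b : Matrix (Fin n) (Fin n) ℝ), 1 / 4 ≤ a → a ≤ 1 → b.PosSemidef →
      ∀ (s : ℝ) (S : Matrix (Fin n) (Fin n) ℝ),
        Integrable (fun y => kern p a b y * cubicTerm p b y * gtest a s S y) ∧
        |∫ y, kern p a b y * cubicTerm p b y * gtest a s S y| ≤ C * ‖b‖ ^ 3 * (|s| + ‖S‖) := by
  have hq := sub_pos.2 hp
  have hp0 : 0 < p := by linarith
  have hm := profileMax_nonneg hp
  refine ⟨profileMax p / ((p - 1) * (p - 1)) * (4 * p / (p - 1) ^ 3) * moment n 3 (1 / 4),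
    by have := moment_nonneg (n := n) 3 (1 / 4); positivity, fun a b ha ha1 hb s S => ?_⟩
  have ha0 : 0 < a := by linarith
  have hbd : ∀ y, |kern p a b y * cubicTerm p b y * gtest a s S y| ≤
      (profileMax p / ((p - 1) * (p - 1)) * (4 * p / (p - 1) ^ 3) * ‖b‖ ^ 3 * (|s| + ‖S‖))
        * momentWeight 3 (1 / 4) y := fun y => by
    rw [abs_mul, abs_mul, ← mul_momentWeight, ← mul_momentWeight]
    have h0 := abs_kern_le hp ha0 ha1 hb y
    calc _ ≤ profileMax p / ((p - 1) * (p - 1))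
          * (4 * p / (p - 1) ^ 3 * ‖b‖ ^ 3 * (1 + ‖y‖ ^ 2) ^ 2)
          * ((|s| + ‖S‖) * momentWeight 1 (1 / 4) y) := by
          gcongr
          · exact abs_cubicTerm_le hp hb y
          · exact abs_gtest_le_quarter ha s S y
      _ = _ := by ring
  refine ⟨integrable_of_le_momentWeight (by norm_num : (0 : ℝ) < 1 / 4) ?_
    (Eventually.of_forall hbd), ?_⟩
  · have h1 := continuous_kern hp ha0 hb
    have h2 := continuous_cubicTerm hp hb
    have h3 := continuous_gtest a s S
    exact (by fun_prop : Continuous _).aestronglyMeasurable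
  · refine (abs_integral_le_moment (by norm_num) (Eventually.of_forall hbd)).trans_eq ?_
    ring

end Kernel

/-! ### Pairings that involve the fluctuation -/

section Fluctuation

variable {p : ℝ}

/-- This controls the coefficient of `a'` that the motion of the Gaussian produces. -/
lemma abs_integral_sq_mul_le (n : ℕ) : ∃ C, 0 ≤ C ∧ ∀ (ζ : EuclideanSpace ℝ (Fin n) → ℝ) (m : ℝ),
    (∀ᵐ y, |ζ y| ≤ m * (1 + ‖y‖ ^ 2) ^ 2) → ∀ (a : ℝ), 1 / 4 ≤ a →
      ∀ (s : ℝ) (S : Matrix (Fin n) (Fin n) ℝ),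
        |1 / 2 * ∫ y, ζ y * (‖y‖ ^ 2 * gtest a s S y)| ≤ C * m * (|s| + ‖S‖) := by
  refine ⟨moment n 4 (1 / 4), moment_nonneg _ _, fun ζ m hζ a ha s S => ?_⟩
  have h := abs_integral_le_moment (n := n) (k := 4) (a := 1 / 4) (K := m * (|s| + ‖S‖))
    (f := fun y => ζ y * (‖y‖ ^ 2 * gtest a s S y)) (by norm_num) (by
      filter_upwards [hζ] with y hy
      rw [abs_mul, ← mul_momentWeight, ← mul_momentWeight]
      have h1 := (abs_sq_mul_gtest_le a s S y).trans
        (mul_le_mul_of_nonneg_left (momentWeight_anti 2 ha y) (by positivity))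
      have h2 := (abs_nonneg _).trans hy
      calc _ ≤ (m * (1 + ‖y‖ ^ 2) ^ 2) * ((|s| + ‖S‖) * momentWeight 2 (1 / 4) y) := by gcongr
        _ = _ := by ring)
  have h3 : |(1 : ℝ) / 2| = 1 / 2 := by norm_num
  rw [abs_mul, h3]
  have := abs_nonneg (∫ y, ζ y * (‖y‖ ^ 2 * gtest a s S y))
  linarith

lemma one_le_one_add_sq (y : EuclideanSpace ℝ (Fin n)) : 1 ≤ 1 + ‖y‖ ^ 2 := by simp

/-- The pairing of the nonlinear term with a test function. -/
lemma abs_integral_nonlin_le (n : ℕ) (hp : 1 < p) : ∃ C, 0 ≤ C ∧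
    ∀ (ζ : EuclideanSpace ℝ (Fin n) → ℝ) (m : ℝ), 0 ≤ m → AEStronglyMeasurable ζ volume →
    (∀ᵐ y, |ζ y| ≤ m * (1 + ‖y‖ ^ 2) ^ 2) →
    ∀ (a : ℝ) (b : Matrix (Fin n) (Fin n) ℝ), 1 / 4 ≤ a → a ≤ 1 → b.PosSemidef →
      ∀ (s : ℝ) (S : Matrix (Fin n) (Fin n) ℝ), ∫ y, ζ y * gtest a s S y = 0 →
        Integrable (fun y =>
          (nonlin p (profile p a b y + ζ y) - profile p a b y ^ p) * gtest a s S y) ∧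
        |∫ y, (nonlin p (profile p a b y + ζ y) - profile p a b y ^ p) * gtest a s S y| ≤
          C * (‖b‖ * m + m ^ 2 + m ^ p) * (|s| + ‖S‖) := by
  have hq := sub_pos.2 hp
  have hp0 : 0 < p := by linarith
  obtain ⟨C, hC, hlin⟩ := abs_nonlin_sub_linear_le hp (profileMax_nonneg hp)
  -- A natural exponent such that `X ^ (k + 4)` dominates both `(X²)²` and `(X²)^p` for `X = 1 +
  -- |y|²`.
  set k := ⌈2 * p⌉₊ with hk
  set l := k + 5 with hl
  have hM4 := moment_nonneg (n := n) 4 (1 / 4)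
  have hMl := moment_nonneg (n := n) l (1 / 4)
  refine ⟨C * moment n l (1 / 4) + p * (3 / 2) / (p - 1) ^ 2 * moment n 4 (1 / 4), by positivity,
    fun ζ m hm hζm hζ a b ha ha1 hb s S horth => ?_⟩
  have ha0 : 0 < a := by linarith
  have hVc := continuous_profile hp ha0 hb
  have hgc := continuous_gtest a s S
  have hdc := continuous_den p b
  have hqc := continuous_quad b
  have hdne : ∀ y, den p b y ≠ 0 := fun y => (den_pos hp hb y).ne'
  set N := |s| + ‖S‖ with hN
  have hN0 : 0 ≤ N := by positivity
  -- the quadratic part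
  let R : EuclideanSpace ℝ (Fin n) → ℝ := fun y => (nonlin p (profile p a b y + ζ y)
    - profile p a b y ^ p - p * profile p a b y ^ (p - 1) * ζ y) * gtest a s S y
  have hRb : ∀ᵐ y, |R y| ≤ (C * (m ^ 2 + m ^ p) * N) * momentWeight l (1 / 4) y := by
    filter_upwards [hζ] with y hy
    have h1 := hlin _ (ζ y) (profile_pos hp ha0 hb y) (profile_le_max hp ha0 ha1 hb y)
    have hX := one_le_one_add_sq y
    have h2 := abs_gtest_le_quarter ha s S y
    set X := 1 + ‖y‖ ^ 2 with hXd
    have h3 : |ζ y| ^ 2 ≤ m ^ 2 * X ^ (k + 4) := by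
      calc |ζ y| ^ 2 ≤ (m * X ^ 2) ^ 2 := by gcongr
        _ = m ^ 2 * X ^ 4 := by ring
        _ ≤ _ := by (gcongr; omega)
    have h4 : |ζ y| ^ p ≤ m ^ p * X ^ (k + 4) := by
      calc |ζ y| ^ p ≤ (m * X ^ 2) ^ p := by gcongr
        _ = m ^ p * X ^ (2 * p) := by
          rw [Real.mul_rpow hm (by positivity), ← Real.rpow_natCast_mul (by positivity)]
          norm_num
        _ ≤ m ^ p * X ^ (((k + 4 : ℕ) : ℝ)) := by
          gcongr
          have := Nat.le_ceil (2 * p)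
          push_cast
          linarith
        _ = _ := by rw [Real.rpow_natCast]
    have h5 : 0 ≤ m ^ p := Real.rpow_nonneg hm p
    have e : momentWeight l (1 / 4) y = X ^ (k + 4) * momentWeight 1 (1 / 4) y := by
      rw [momentWeight, momentWeight, hl, ← hXd]; ring
    simp only [R]
    rw [abs_mul, e]
    calc _ ≤ (C * (|ζ y| ^ 2 + |ζ y| ^ p)) * (N * momentWeight 1 (1 / 4) y) := by gcongr
      _ ≤ (C * (m ^ 2 * X ^ (k + 4) + m ^ p * X ^ (k + 4)))
          * (N * momentWeight 1 (1 / 4) y) := by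
        have := (abs_nonneg _).trans h2
        gcongr
      _ = _ := by ring
  have hRi : Integrable R := by
    refine integrable_of_le_momentWeight (by norm_num : (0 : ℝ) < 1 / 4) ?_ hRb
    have hnl : AEStronglyMeasurable (fun y => nonlin p (profile p a b y + ζ y)) volume :=
      (continuous_nonlin hp).comp_aestronglyMeasurable (hVc.aestronglyMeasurable.add hζm)
    have hp1 : Continuous fun y => profile p a b y ^ p :=
      hVc.rpow_const fun y => Or.inr hp0.le
    have hp2 : Continuous fun y => p * profile p a b y ^ (p - 1) :=
      continuous_const.mul (hVc.rpow_const fun y => Or.inr hq.le)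
    exact (((hnl.sub hp1.aestronglyMeasurable).sub (hp2.aestronglyMeasurable.mul hζm))).mul
      hgc.aestronglyMeasurable
  -- the linear part
  let P : EuclideanSpace ℝ (Fin n) → ℝ := fun y =>
    -(p * (a + 1 / 2) / (p - 1)) * (quad b y / den p b y) * ζ y * gtest a s S y
  have hPb : ∀ᵐ y, |P y| ≤ (p * (3 / 2) / (p - 1) ^ 2 * (‖b‖ * m) * N)
      * momentWeight 4 (1 / 4) y := by
    filter_upwards [hζ] with y hy
    have h2 := abs_gtest_le_quarter ha s S y
    have h3 := le_den (p := p) hb y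
    have h4 := den_pos hp hb y
    have h5 : |quad b y / den p b y| ≤ ‖b‖ * (1 + ‖y‖ ^ 2) / (p - 1) := by
      rw [abs_div, abs_of_pos h4]
      have := abs_quad_le b y
      gcongr
      refine this.trans ?_
      gcongr
      linarith
    have h6 : |-(p * (a + 1 / 2) / (p - 1))| ≤ p * (3 / 2) / (p - 1) := by
      rw [abs_neg, abs_of_pos (by positivity)]
      gcongr
      linarith
    simp only [P]
    rw [abs_mul, abs_mul, abs_mul, ← mul_momentWeight, ← mul_momentWeight, ← mul_momentWeight]
    calc _ ≤ p * (3 / 2) / (p - 1) * (‖b‖ * (1 + ‖y‖ ^ 2) / (p - 1)) * (m * (1 + ‖y‖ ^ 2) ^ 2)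
          * (N * momentWeight 1 (1 / 4) y) := by gcongr
      _ = _ := by field_simp
  have hPi : Integrable P := by
    refine integrable_of_le_momentWeight (by norm_num : (0 : ℝ) < 1 / 4) ?_ hPb
    have hc1 : Continuous fun y => -(p * (a + 1 / 2) / (p - 1)) * (quad b y / den p b y) :=
      continuous_const.mul (hqc.div hdc hdne)
    exact (hc1.aestronglyMeasurable.mul hζm).mul hgc.aestronglyMeasurable
  have hZi : Integrable fun y => p * (a + 1 / 2) / (p - 1) * (ζ y * gtest a s S y) := by
    refine Integrable.const_mul ?_ _
    refine integrable_of_le_momentWeight (k := 3) (K := m * N) (by norm_num : (0 : ℝ) < 1 / 4)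
      (hζm.mul hgc.aestronglyMeasurable) ?_
    filter_upwards [hζ] with y hy
    rw [abs_mul, ← mul_momentWeight, ← mul_momentWeight]
    have h2 := abs_gtest_le_quarter ha s S y
    calc _ ≤ (m * (1 + ‖y‖ ^ 2) ^ 2) * (N * momentWeight 1 (1 / 4) y) := by gcongr
      _ = _ := by ring
  -- Here `V^{p-1} = (a + 1/2) / den` is split as `(a + 1/2) / (p - 1) · (1 - quad / den)`. The
  -- constant part pairs to zero with `ζ`, and the other part carries a factor `‖b‖`.
  have hdecomp : (fun y =>
      (nonlin p (profile p a b y + ζ y) - profile p a b y ^ p) * gtest a s S y) =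
      fun y => R y + P y + p * (a + 1 / 2) / (p - 1) * (ζ y * gtest a s S y) := by
    ext y
    have h4 := den_pos hp hb y
    have e : quad b y = den p b y - (p - 1) := by unfold den; ring
    simp only [R, P]
    rw [profile_rpow_sub_one hp ha0 hb, e]
    field_simp
    ring
  have hRPi : Integrable fun y => R y + P y := hRi.add hPi
  rw [hdecomp]
  refine ⟨hRPi.add hZi, ?_⟩
  rw [integral_add hRPi hZi, integral_add hRi hPi, integral_const_mul, horth, mul_zero, add_zero]
  refine (abs_add_le _ _).trans ((add_le_add (abs_integral_le_moment (by norm_num) hRb)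
    (abs_integral_le_moment (by norm_num) hPb)).trans ?_)
  have h5 : 0 ≤ m ^ p := Real.rpow_nonneg hm p
  have h6 : 0 ≤ C * moment n l (1 / 4) * (‖b‖ * m) * N := by positivity
  have h7 : 0 ≤ p * (3 / 2) / (p - 1) ^ 2 * moment n 4 (1 / 4) * (m ^ 2 + m ^ p) * N := by
    positivity
  nlinarith [h6, h7]

end Fluctuation

/-! ### Solving the linear system -/

/-- `ra`, `rb` are the remainders of the effective equations at a fluctuation `ζ`: the projections
of the equation on the test functions vanish. -/
def IsRemainder (p : ℝ) (ζ : EuclideanSpace ℝ (Fin n) → ℝ) (a : ℝ) (b : Matrix (Fin n) (Fin n) ℝ)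
    (ra : ℝ) (rb : Matrix (Fin n) (Fin n) ℝ) : Prop :=
  rb.IsHermitian ∧ ∀ (s : ℝ) (S : Matrix (Fin n) (Fin n) ℝ), S.IsHermitian →
    ∫ y, (source p a b (velocityA p a b ra) (velocityB p a b rb) y
      + (nonlin p (profile p a b y + ζ y) - profile p a b y ^ p)) * gtest a s S y
      = velocityA p a b ra * (1 / 2 * ∫ y, ζ y * (‖y‖ ^ 2 * gtest a s S y))

/-- `ζ` is orthogonal to the test functions and bounded by `m (1 + |y|²)²`. -/
structure IsFluctuation (m a : ℝ) (ζ : EuclideanSpace ℝ (Fin n) → ℝ) : Prop where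
  nonneg : 0 ≤ m
  aestronglyMeasurable : AEStronglyMeasurable ζ volume
  bound : ∀ᵐ y, |ζ y| ≤ m * (1 + ‖y‖ ^ 2) ^ 2
  orthogonal : ∀ (s : ℝ) (S : Matrix (Fin n) (Fin n) ℝ), S.IsHermitian →
    ∫ y, ζ y * gtest a s S y = 0

lemma isFluctuation_zero (a : ℝ) :
    IsFluctuation 0 a (0 : EuclideanSpace ℝ (Fin n) → ℝ) where
  nonneg := le_rfl
  aestronglyMeasurable := aestronglyMeasurable_const
  bound := by simp
  orthogonal := by simp

section System

variable {p a m : ℝ} {b : Matrix (Fin n) (Fin n) ℝ} {ζ : EuclideanSpace ℝ (Fin n) → ℝ}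

/-- The pairing of the equation with a test function in terms of the unknown remainders. -/
lemma integral_source_add_nonlin (hp : 1 < p) (ha : 1 / 4 ≤ a) (ha1 : a ≤ 1) (hb : b.PosSemidef)
    (hζ : IsFluctuation m a ζ) (ra : ℝ) (rb : Matrix (Fin n) (Fin n) ℝ) (s : ℝ)
    {S : Matrix (Fin n) (Fin n) ℝ} (hS : S.IsHermitian) :
    ∫ y, (source p a b (velocityA p a b ra) (velocityB p a b rb) y
      + (nonlin p (profile p a b y + ζ y) - profile p a b y ^ p)) * gtest a s S y =
    (∫ y, (nonlin p (profile p a b y + ζ y) - profile p a b y ^ p) * gtest a s S y)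
      - (∫ y, kern p a b y * cubicTerm p b y * gtest a s S y)
      - ∫ y, kern p a b y * qpoly ((p - 1) * ra) (ra • b - rb) y * gtest a s S y := by
  have ha0 : 0 < a := by linarith
  obtain ⟨C, -, h1⟩ := abs_integral_nonlin_le n hp
  obtain ⟨C', -, h2⟩ := abs_integral_kern_cubic_le n hp
  have i1 := (h1 ζ m hζ.nonneg hζ.aestronglyMeasurable hζ.bound a b ha ha1 hb s S
    (hζ.orthogonal s S hS)).1
  have i2 := (h2 a b ha ha1 hb s S).1
  have i3 := integrable_kern_qpoly_gtest hp ha ha1 hb ((p - 1) * ra) s (ra • b - rb) S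
  have i12 : Integrable fun y =>
      (nonlin p (profile p a b y + ζ y) - profile p a b y ^ p) * gtest a s S y
      - kern p a b y * cubicTerm p b y * gtest a s S y := i1.sub i2
  rw [← integral_sub i1 i2, ← integral_sub i12 i3]
  refine integral_congr_ae (Eventually.of_forall fun y => ?_)
  simp only [source_velocity_eq hp ha0 hb]
  ring

lemma IsRemainder.pairing_eq (hp : 1 < p) (ha : 1 / 4 ≤ a) (ha1 : a ≤ 1) (hb : b.PosSemidef)
    (hζ : IsFluctuation m a ζ) {ra : ℝ} {rb : Matrix (Fin n) (Fin n) ℝ}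
    (h : IsRemainder p ζ a b ra rb) (s : ℝ)
    {S : Matrix (Fin n) (Fin n) ℝ} (hS : S.IsHermitian) :
    ∫ y, kern p a b y * qpoly ((p - 1) * ra) (ra • b - rb) y * gtest a s S y =
    (∫ y, (nonlin p (profile p a b y + ζ y) - profile p a b y ^ p) * gtest a s S y)
      - (∫ y, kern p a b y * cubicTerm p b y * gtest a s S y)
      - velocityA p a b ra * (1 / 2 * ∫ y, ζ y * (‖y‖ ^ 2 * gtest a s S y)) := by
  have := h.2 s S hS
  rw [integral_source_add_nonlin hp ha ha1 hb hζ ra rb s hS] at this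
  linarith

lemma isHermitian_smul_sub {r : ℝ} {B R : Matrix (Fin n) (Fin n) ℝ} (hB : B.IsHermitian)
    (hR : R.IsHermitian) : (r • B - R).IsHermitian :=
  (hB.smul (IsSelfAdjoint.all r)).sub hR

/-- For a small fluctuation, the remainders are unique. -/
lemma exists_isRemainder_unique (n : ℕ) (hp : 1 < p) : ∃ m₀ > 0,
    ∀ (m a : ℝ) (b : Matrix (Fin n) (Fin n) ℝ) (ζ : EuclideanSpace ℝ (Fin n) → ℝ),
      m ≤ m₀ → 1 / 4 ≤ a → a ≤ 1 → b.PosSemidef → ‖b‖ ≤ 1 → IsFluctuation m a ζ →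
      ∀ ra ra' rb rb', IsRemainder p ζ a b ra rb → IsRemainder p ζ a b ra' rb' →
        ra = ra' ∧ rb = rb' := by
  have hq := sub_pos.2 hp
  obtain ⟨δ, hδ, hco⟩ := exists_coercive n hp
  obtain ⟨C, hC, hsq⟩ := abs_integral_sq_mul_le n
  -- With this threshold the term with `ra` on the right-hand side is at most half of the coercive
  -- one: `(3/2) · N / (p - 1) · δ (p - 1) / 3 · N = (δ/2) N²`.
  refine ⟨δ * (p - 1) / (3 * (C + 1)), by positivity,
    fun m a b ζ hm ha ha1 hb hb1 hζ ra ra' rb rb' h h' => ?_⟩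
  have hS := (isHermitian_smul_sub (r := ra) hb.isHermitian h.1).sub
    (isHermitian_smul_sub (r := ra') hb.isHermitian h'.1)
  set s := (p - 1) * ra - (p - 1) * ra' with hs
  set S := (ra • b - rb) - (ra' • b - rb') with hSd
  set N := |s| + ‖S‖ with hN
  have hN0 : 0 ≤ N := by positivity
  -- The system is tested with the difference of the two solutions. All data cancel except the
  -- dependence of `a'` on the remainder.
  have key : ∫ y, kern p a b y * qpoly s S y * gtest a s S y =
      -((a + 1 / 2) * (ra - ra') * (1 / 2 * ∫ y, ζ y * (‖y‖ ^ 2 * gtest a s S y))) := by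
    have e1 := h.pairing_eq hp ha ha1 hb hζ s hS
    have e2 := h'.pairing_eq hp ha ha1 hb hζ s hS
    have e3 : ∫ y, kern p a b y * qpoly s S y * gtest a s S y =
        (∫ y, kern p a b y * qpoly ((p - 1) * ra) (ra • b - rb) y * gtest a s S y)
        - ∫ y, kern p a b y * qpoly ((p - 1) * ra') (ra' • b - rb') y * gtest a s S y := by
      rw [← integral_sub (integrable_kern_qpoly_gtest hp ha ha1 hb _ _ _ _)
        (integrable_kern_qpoly_gtest hp ha ha1 hb _ _ _ _)]
      refine integral_congr_ae (Eventually.of_forall fun y => ?_)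
      simp only [hs, hSd, qpoly, quad_sub (ra • b - rb)]
      ring
    rw [e3, e1, e2, velocityA, velocityA]
    ring
  have h1 := hco a b ha ha1 hb hb1 s S hS
  have h2 := hsq ζ m hζ.bound a ha s S
  have h3 : (p - 1) * |ra - ra'| ≤ N := by
    have : |s| = (p - 1) * |ra - ra'| := by
      rw [hs, ← mul_sub, abs_mul, abs_of_pos hq]
    rw [← this, hN]
    linarith [norm_nonneg S]
  have h4 : δ * N ^ 2 ≤ δ / 2 * N ^ 2 := by
    rw [key] at h1
    refine h1.trans ((le_abs_self _).trans ?_)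
    rw [abs_neg, abs_mul, abs_mul, abs_of_pos (by linarith : 0 < a + 1 / 2)]
    have h5 : |ra - ra'| ≤ N / (p - 1) := by rw [le_div_iff₀ hq]; linarith
    have hm0 := hζ.nonneg
    have h6 : m * (C + 1) ≤ δ * (p - 1) / 3 := by
      calc m * (C + 1) ≤ δ * (p - 1) / (3 * (C + 1)) * (C + 1) := by gcongr
        _ = _ := by field_simp
    calc _ ≤ (1 + 1 / 2) * (N / (p - 1)) * (C * m * N) := by gcongr
      _ ≤ (1 + 1 / 2) * (N / (p - 1)) * ((δ * (p - 1) / 3) * N) := by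
        gcongr
        linarith
      _ = _ := by field_simp; ring
  have h5 : N ^ 2 ≤ 0 := by nlinarith
  have h6 : N = 0 := by simpa using le_antisymm h5 (sq_nonneg N)
  have h7 : |s| = 0 := by linarith [abs_nonneg s, norm_nonneg S]
  have h8 : ‖S‖ = 0 := by linarith [abs_nonneg s, norm_nonneg S]
  have h9 : ra = ra' := by
    have : s = 0 := by simpa using h7
    rw [hs, ← mul_sub] at this
    have := (mul_eq_zero.1 this).resolve_left hq.ne'
    linarith
  refine ⟨h9, ?_⟩
  have h10 : S = 0 := by simpa using h8
  rw [hSd, h9, sub_sub_sub_cancel_left, sub_eq_zero] at h10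
  exact h10.symm

/-- The size of the remainders for a small fluctuation. -/
lemma exists_isRemainder_bound (n : ℕ) (hp : 1 < p) : ∃ m₀ > 0, ∃ C, 0 < C ∧
    ∀ (m a : ℝ) (b : Matrix (Fin n) (Fin n) ℝ) (ζ : EuclideanSpace ℝ (Fin n) → ℝ),
      m ≤ m₀ → 1 / 4 ≤ a → a ≤ 1 → b.PosSemidef → ‖b‖ ≤ 1 → IsFluctuation m a ζ →
      ∀ ra rb, IsRemainder p ζ a b ra rb →
        |ra| ≤ C * (‖b‖ ^ 3 + ‖b‖ * m + m ^ 2 + m ^ p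
          + |a - 1 / 2 + 2 * b.trace / (p - 1)| * m) ∧
        ‖rb‖ ≤ C * (‖b‖ ^ 3 + ‖b‖ * m + m ^ 2 + m ^ p
          + |a - 1 / 2 + 2 * b.trace / (p - 1)| * m) := by
  have hq := sub_pos.2 hp
  obtain ⟨δ, hδ, hco⟩ := exists_coercive n hp
  obtain ⟨C₁, hC₁, hnl⟩ := abs_integral_nonlin_le n hp
  obtain ⟨C₂, hC₂, hcu⟩ := abs_integral_kern_cubic_le n hp
  obtain ⟨C₃, hC₃, hsq⟩ := abs_integral_sq_mul_le n
  set C₄ := C₁ + C₂ + 3 / 2 * C₃ with hC₄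
  refine ⟨δ * (p - 1) / (3 * (C₃ + 1)), by positivity, (1 / (p - 1) + 1) * (2 * C₄ / δ + 1),
    by positivity, fun m a b ζ hm ha ha1 hb hb1 hζ ra rb h => ?_⟩
  have hm0 := hζ.nonneg
  have hS := isHermitian_smul_sub (r := ra) hb.isHermitian h.1
  set w := |a - 1 / 2 + 2 * b.trace / (p - 1)| with hw
  set E := ‖b‖ ^ 3 + ‖b‖ * m + m ^ 2 + m ^ p + w * m with hE
  have hmp : 0 ≤ m ^ p := Real.rpow_nonneg hm0 p
  have hw0 : 0 ≤ w := abs_nonneg _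
  have hE0 : 0 ≤ E := by positivity
  set s := (p - 1) * ra with hs
  set S := ra • b - rb with hSd
  set N := |s| + ‖S‖ with hN
  have hN0 : 0 ≤ N := by positivity
  have h1 := hco a b ha ha1 hb hb1 s S hS
  rw [h.pairing_eq hp ha ha1 hb hζ s hS] at h1
  have h2 := hsq ζ m hζ.bound a ha s S
  have h3 := (hcu a b ha ha1 hb s S).2
  have h4 := (hnl ζ m hm0 hζ.aestronglyMeasurable hζ.bound a b ha ha1 hb s S
    (hζ.orthogonal s S hS)).2
  have h5 : |ra| ≤ N / (p - 1) := by
    rw [le_div_iff₀ hq]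
    have : |s| = (p - 1) * |ra| := by rw [hs, abs_mul, abs_of_pos hq]
    linarith [norm_nonneg S]
  -- The velocity of `a` consists of the quantity measured by `A` and of the unknown `ra`. The first
  -- becomes data, and the second is absorbed.
  have h6 : |velocityA p a b ra| ≤ (1 + 1 / 2) * (w + N / (p - 1)) := by
    rw [velocityA, abs_mul, abs_of_pos (by linarith : 0 < a + 1 / 2)]
    have : |1 / 2 - a - 2 / (p - 1) * b.trace + ra| ≤ w + N / (p - 1) := by
      refine (abs_add_le _ _).trans (add_le_add (le_of_eq ?_) h5)
      rw [hw, ← abs_neg]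
      ring_nf
    gcongr
  have h7 : m * (C₃ + 1) ≤ δ * (p - 1) / 3 := by
    calc m * (C₃ + 1) ≤ δ * (p - 1) / (3 * (C₃ + 1)) * (C₃ + 1) := by gcongr
      _ = _ := by field_simp
  have h8 : δ * N ^ 2 ≤ (C₄ * E + δ / 2 * N) * N := by
    have h9 : |velocityA p a b ra * (1 / 2 * ∫ y, ζ y * (‖y‖ ^ 2 * gtest a s S y))| ≤
        3 / 2 * C₃ * (w * m) * N + δ / 2 * N * N := by
      rw [abs_mul]
      calc _ ≤ (1 + 1 / 2) * (w + N / (p - 1)) * (C₃ * m * N) := by gcongr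
        _ = 3 / 2 * C₃ * (w * m) * N + (1 + 1 / 2) * (N / (p - 1)) * ((m * C₃) * N) := by ring
        _ ≤ 3 / 2 * C₃ * (w * m) * N + (1 + 1 / 2) * (N / (p - 1)) * ((δ * (p - 1) / 3) * N) := by
          gcongr
          linarith
        _ = _ := by field_simp; ring
    have h10 : C₁ * (‖b‖ * m + m ^ 2 + m ^ p) + C₂ * ‖b‖ ^ 3 + 3 / 2 * C₃ * (w * m)
        ≤ C₄ * E := by
      have e1 : ‖b‖ * m + m ^ 2 + m ^ p ≤ E := by
        have : 0 ≤ ‖b‖ ^ 3 + w * m := by positivity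
        linarith
      have e2 : ‖b‖ ^ 3 ≤ E := by
        have : 0 ≤ ‖b‖ * m + m ^ 2 + m ^ p + w * m := by positivity
        linarith
      have e3 : w * m ≤ E := by
        have : 0 ≤ ‖b‖ ^ 3 + ‖b‖ * m + m ^ 2 + m ^ p := by positivity
        linarith
      calc _ ≤ C₁ * E + C₂ * E + 3 / 2 * C₃ * E := by gcongr
        _ = _ := by rw [hC₄]; ring
    have h11 := mul_le_mul_of_nonneg_right h10 hN0
    have h12 := neg_le_of_abs_le h3
    have h13 := neg_le_of_abs_le h9
    have h14 := le_of_abs_le h4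
    linarith
  have h9 : N ≤ 2 * C₄ / δ * E := by
    rcases hN0.eq_or_lt with h0 | h0
    · rw [← h0]; positivity
    · have : δ * N ≤ C₄ * E + δ / 2 * N := by
        refine le_of_mul_le_mul_right ?_ h0
        linarith
      rw [div_mul_eq_mul_div, le_div_iff₀ hδ]
      linarith
  have h10 : N ≤ (2 * C₄ / δ + 1) * E := by linarith
  have h11 : |ra| ≤ (1 / (p - 1)) * ((2 * C₄ / δ + 1) * E) := by
    refine h5.trans ?_
    rw [div_eq_mul_one_div, mul_comm]
    gcongr
  -- The coercive unknown is `ra b - rb`, so `rb` is recovered from it and from the bound on `ra`.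
  have h12 : ‖rb‖ ≤ |ra| + N := by
    have : rb = ra • b - S := by rw [hSd]; abel
    rw [this]
    refine (norm_sub_le _ _).trans (add_le_add ?_ ?_)
    · rw [norm_smul, Real.norm_eq_abs]
      exact mul_le_of_le_one_right (abs_nonneg _) hb1
    · rw [hN]; linarith [abs_nonneg s]
  have h13 : 0 ≤ (2 * C₄ / δ + 1) * E := by positivity
  constructor
  · linarith
  · linarith

end System

/-- In the absence of a fluctuation, the remainders exist. -/
lemma exists_isRemainder_zero {p a : ℝ} {b : Matrix (Fin n) (Fin n) ℝ} (hp : 1 < p)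
    (ha : 1 / 4 ≤ a) (ha1 : a ≤ 1) (hb : b.PosSemidef) (hb1 : ‖b‖ ≤ 1) :
    ∃ ra rb, IsRemainder p 0 a b ra rb := by
  have hq := sub_pos.2 hp
  have ha0 : 0 < a := by linarith
  obtain ⟨δ, hδ, hco⟩ := exists_coercive n hp
  -- The form is degenerate on antisymmetric matrices, so the system is posed on symmetric ones.
  let H : Submodule ℝ (Matrix (Fin n) (Fin n) ℝ) := selfAdjoint.submodule ℝ _
  have hH : ∀ S : H, (S : Matrix (Fin n) (Fin n) ℝ).IsHermitian := fun S => S.2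
  have hI := fun (s s' : ℝ) (S S' : Matrix (Fin n) (Fin n) ℝ) =>
    integrable_kern_qpoly_gtest hp ha ha1 hb s s' S S'
  obtain ⟨_, -, hcu⟩ := abs_integral_kern_cubic_le n hp
  let B : (ℝ × H) →ₗ[ℝ] Module.Dual ℝ (ℝ × H) := LinearMap.mk₂ ℝ
    (fun x z => ∫ y, kern p a b y * qpoly x.1 x.2 y * gtest a z.1 z.2 y)
    (fun x x' z => by
      rw [← integral_add (hI _ _ _ _) (hI _ _ _ _)]
      congr 1; ext y
      simp only [qpoly, Prod.fst_add, Prod.snd_add, Submodule.coe_add, quad_add]; ring)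
    (fun r x z => by
      rw [smul_eq_mul, ← integral_const_mul]
      congr 1; ext y
      simp only [Prod.smul_fst, Prod.smul_snd, Submodule.coe_smul, smul_eq_mul, qpoly_smul]; ring)
    (fun x z z' => by
      rw [← integral_add (hI _ _ _ _) (hI _ _ _ _)]
      congr 1; ext y
      simp only [gtest, qpoly, Prod.fst_add, Prod.snd_add, Submodule.coe_add, quad_add]; ring)
    (fun r x z => by
      rw [smul_eq_mul, ← integral_const_mul]
      congr 1; ext y
      simp only [gtest, Prod.smul_fst, Prod.smul_snd, Submodule.coe_smul, smul_eq_mul, qpoly_smul]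
      ring)
  have hB : ∀ x z, B x z = ∫ y, kern p a b y * qpoly x.1 x.2 y * gtest a z.1 z.2 y :=
    fun x z => rfl
  let ℓ : Module.Dual ℝ (ℝ × H) :=
    { toFun := fun z => -∫ y, kern p a b y * cubicTerm p b y * gtest a z.1 z.2 y
      map_add' := fun z z' => by
        rw [← neg_add, ← integral_add (hcu a b ha ha1 hb _ _).1 (hcu a b ha ha1 hb _ _).1]
        congr 2; ext y
        simp only [gtest, qpoly, Prod.fst_add, Prod.snd_add, Submodule.coe_add, quad_add]; ring
      map_smul' := fun r z => by
        rw [RingHom.id_apply, smul_neg, smul_eq_mul, ← integral_const_mul]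
        congr 2; ext y
        simp only [gtest, Prod.smul_fst, Prod.smul_snd, Submodule.coe_smul, smul_eq_mul,
          qpoly_smul]
        ring }
  have hinj : Function.Injective B := by
    rw [injective_iff_map_eq_zero]
    intro x hx
    have h1 := hco a b ha ha1 hb hb1 x.1 x.2 (hH _)
    rw [← hB x x, hx, LinearMap.zero_apply] at h1
    have h2 : (|x.1| + ‖(x.2 : Matrix (Fin n) (Fin n) ℝ)‖) ^ 2 ≤ 0 :=
      nonpos_of_mul_nonpos_right h1 hδ
    have h3 : |x.1| + ‖(x.2 : Matrix (Fin n) (Fin n) ℝ)‖ = 0 := by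
      simpa using le_antisymm h2 (sq_nonneg _)
    have h4 := abs_nonneg x.1
    have h5 := norm_nonneg (x.2 : Matrix (Fin n) (Fin n) ℝ)
    refine Prod.ext ?_ (Subtype.ext ?_)
    · exact abs_eq_zero.1 (by linarith)
    · exact norm_eq_zero.1 (by linarith)
  -- A space and its dual have the same finite dimension, so injectivity is enough.
  have hsurj : Function.Surjective B :=
    (LinearMap.injective_iff_surjective_of_finrank_eq_finrank
      (Subspace.dual_finrank_eq (K := ℝ) (V := ℝ × H)).symm).1 hinj
  obtain ⟨x, hx⟩ := hsurj ℓ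
  -- The substitution `s = (p - 1) ra`, `S = ra b - rb` is inverted.
  refine ⟨x.1 / (p - 1), (x.1 / (p - 1)) • b - x.2,
    isHermitian_smul_sub hb.isHermitian (hH _), fun s S hS => ?_⟩
  rw [integral_source_add_nonlin hp ha ha1 hb (isFluctuation_zero a) _ _ s hS]
  have h1 : ∀ y, nonlin p (profile p a b y + 0)
      - profile p a b y ^ p = 0 := fun y => by
    rw [add_zero, nonlin_of_pos (profile_pos hp ha0 hb y), sub_self]
  have h2 := LinearMap.congr_fun hx (s, ⟨S, hS⟩)
  rw [hB] at h2
  simp only [Pi.zero_apply, h1, zero_mul, integral_zero, mul_zero, sub_sub_cancel,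
    mul_div_cancel₀ _ hq.ne']
  have h3 : ℓ (s, ⟨S, hS⟩) = -∫ y, kern p a b y * cubicTerm p b y * gtest a s S y := rfl
  rw [h3] at h2
  simp only at h2
  linarith

/-- The remainders of the effective equations (zero if they are not determined). -/
noncomputable def remainders (p : ℝ) (ζ : EuclideanSpace ℝ (Fin n) → ℝ) (a : ℝ)
    (b : Matrix (Fin n) (Fin n) ℝ) : ℝ × Matrix (Fin n) (Fin n) ℝ :=
  open Classical in
  if h : ∃ r : ℝ × Matrix (Fin n) (Fin n) ℝ, IsRemainder p ζ a b r.1 r.2 then h.choose else 0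

lemma isRemainder_remainders {p : ℝ} {ζ : EuclideanSpace ℝ (Fin n) → ℝ} {a : ℝ}
    {b : Matrix (Fin n) (Fin n) ℝ} {ra : ℝ} {rb : Matrix (Fin n) (Fin n) ℝ}
    (h : IsRemainder p ζ a b ra rb) :
    IsRemainder p ζ a b (remainders p ζ a b).1 (remainders p ζ a b).2 := by
  have h' : ∃ r : ℝ × Matrix (Fin n) (Fin n) ℝ, IsRemainder p ζ a b r.1 r.2 := ⟨(ra, rb), h⟩
  rw [remainders, dif_pos h']
  exact h'.choose_spec

/-! ### The majorants -/

section Beta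

variable {p τ : ℝ} {M b₀ : Matrix (Fin n) (Fin n) ℝ}

lemma _root_.Matrix.PosSemidef.nonneg_of_mem_spectrum (hM : M.PosSemidef) {μ : ℝ}
    (hμ : μ ∈ spectrum ℝ M) : 0 ≤ μ := by
  rw [hM.isHermitian.spectrum_real_eq_range_eigenvalues] at hμ
  obtain ⟨i, rfl⟩ := hμ
  exact hM.eigenvalues_nonneg i

lemma _root_.Matrix.PosDef.pos_of_mem_spectrum (hM : M.PosDef) {μ : ℝ}
    (hμ : μ ∈ spectrum ℝ M) : 0 < μ := by
  rw [hM.isHermitian.spectrum_real_eq_range_eigenvalues] at hμ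
  obtain ⟨i, rfl⟩ := hμ
  exact hM.eigenvalues_pos i

lemma le_norm_of_mem_spectrum {μ : ℝ} (hμ : μ ∈ spectrum ℝ M) : μ ≤ ‖M‖ := by
  rcases Nat.eq_zero_or_pos n with rfl | hn
  · simp [spectrum.of_subsingleton] at hμ
  have : Nonempty (Fin n) := ⟨⟨0, hn⟩⟩
  rw [Matrix.l2_opNorm_def]
  rw [← AlgEquiv.spectrum_eq (Matrix.toEuclideanCLM (n := Fin n) (𝕜 := ℝ)) M] at hμ
  exact (le_abs_self μ).trans (spectrum.norm_le_norm_of_mem hμ)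

/-- The norm of a positive matrix is its largest eigenvalue. -/
lemma isGreatest_norm_spectrum (hn : 0 < n) (hM : M.PosSemidef) :
    IsGreatest (spectrum ℝ M) ‖M‖ := by
  refine ⟨?_, fun μ hμ => le_norm_of_mem_spectrum hμ⟩
  have : Nonempty (Fin n) := ⟨⟨0, hn⟩⟩
  have hne : (spectrum ℝ M).Nonempty := by
    rw [hM.isHermitian.spectrum_real_eq_range_eigenvalues]
    exact Set.range_nonempty _
  have hs := AlgEquiv.spectrum_eq (Matrix.toEuclideanCLM (n := Fin n) (𝕜 := ℝ)) M
  have hsa : IsSelfAdjoint (act M) := hM.isHermitian.isSelfAdjoint.map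
    (Matrix.toEuclideanCLM (n := Fin n) (𝕜 := ℝ))
  -- The norm of a self-adjoint operator is its spectral radius, which is attained in absolute
  -- value. Positivity then fixes the sign.
  obtain ⟨k, hk, hkr⟩ := spectrum.exists_nnnorm_eq_spectralRadius_of_nonempty
    (𝕜 := ℝ) (a := act M) (hs.symm ▸ hne)
  replace hkr := hkr.trans (ContinuousLinearMap.spectralRadius_eq_nnnorm (act M) hsa)
  have hk' : k ∈ spectrum ℝ M := hs ▸ hk
  have h1 : ‖k‖ = ‖M‖ := by
    rw [Matrix.cstar_norm_def]
    exact congrArg NNReal.toReal (ENNReal.coe_inj.1 hkr)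
  rw [Real.norm_of_nonneg (hM.nonneg_of_mem_spectrum hk')] at h1
  exact h1 ▸ hk'

lemma shift_nonneg (hp : 1 < p) (hτ : 0 ≤ τ) : 0 ≤ 4 * p * τ / (p - 1) ^ 2 := by
  have : 0 < p := by linarith
  positivity

lemma posDef_inv_add (hb₀ : b₀.PosDef) {t : ℝ} (ht : 0 ≤ t) :
    (b₀⁻¹ + t • (1 : Matrix (Fin n) (Fin n) ℝ)).PosDef :=
  hb₀.inv.add_posSemidef (Matrix.PosSemidef.one.smul ht)

lemma posDef_betaTilde (hp : 1 < p) (hb₀ : b₀.PosDef) (hτ : 0 ≤ τ) :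
    (betaTilde p b₀ τ).PosDef :=
  (posDef_inv_add hb₀ (shift_nonneg hp hτ)).inv

lemma beta_eq_norm (hn : 0 < n) (hp : 1 < p) (hb₀ : b₀.PosDef) (hτ : 0 ≤ τ) :
    beta p b₀ τ = ‖betaTilde p b₀ τ‖ :=
  (isGreatest_norm_spectrum hn (posDef_betaTilde hp hb₀ hτ).posSemidef).csSup_eq

/-- An eigenvalue `μ` of `β̃` satisfies `1/μ = ν + t`, where `ν > 0` is an eigenvalue of `b₀⁻¹` and
`t ≥ 0`. Hence `μ ≤ 1/ν ≤ ‖b₀‖`, and the smallness of `b(0)` is passed on to `β` at all times. -/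
lemma beta_le_norm (hn : 0 < n) (hp : 1 < p) (hb₀ : b₀.PosDef) (hτ : 0 ≤ τ) :
    beta p b₀ τ ≤ ‖b₀‖ := by
  have ht := shift_nonneg hp hτ
  rw [beta_eq_norm hn hp hb₀ hτ]
  have h1 := (isGreatest_norm_spectrum hn (posDef_betaTilde hp hb₀ hτ).posSemidef).1
  have h0 := (posDef_betaTilde hp hb₀ hτ).pos_of_mem_spectrum h1
  set μ := ‖betaTilde p b₀ τ‖
  unfold betaTilde at h1
  set t := 4 * p * τ / (p - 1) ^ 2
  obtain ⟨u, hu⟩ := (posDef_inv_add hb₀ ht).isUnit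
  obtain ⟨w, hw⟩ := hb₀.isUnit
  rw [← hu, ← Matrix.coe_units_inv, ← spectrum.map_inv, Set.mem_inv, hu,
    ← Algebra.algebraMap_eq_smul_one, ← spectrum.add_singleton_eq, Set.mem_add] at h1
  obtain ⟨ν, hν, t', ht', he⟩ := h1
  rw [Set.mem_singleton_iff] at ht'
  subst ht'
  have hν0 := hb₀.inv.pos_of_mem_spectrum hν
  rw [← hw, ← Matrix.coe_units_inv, ← spectrum.map_inv, Set.mem_inv, hw] at hν
  refine le_trans ?_ (le_norm_of_mem_spectrum hν)
  rw [← inv_inv μ]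
  exact inv_anti₀ hν0 (by linarith)

lemma beta_pos (hn : 0 < n) (hp : 1 < p) (hb₀ : b₀.PosDef) (hτ : 0 ≤ τ) : 0 < beta p b₀ τ := by
  have h := posDef_betaTilde hp hb₀ hτ
  rw [beta_eq_norm hn hp hb₀ hτ]
  exact h.pos_of_mem_spectrum (isGreatest_norm_spectrum hn h.posSemidef).1

/-- `β` is bounded below on bounded time intervals. -/
lemma exists_beta_lower_bound (hn : 0 < n) (hp : 1 < p) (hb₀ : b₀.PosDef) (T : ℝ) :
    ∃ δ > 0, ∀ t ∈ Set.Icc 0 T, δ ≤ beta p b₀ t := by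
  have hp0 : 0 < p := by linarith
  rcases lt_or_ge T 0 with hT | hT
  · exact ⟨1, one_pos, fun t ht => absurd (ht.1.trans ht.2) (not_le.2 hT)⟩
  have : Nonempty (Fin n) := ⟨⟨0, hn⟩⟩
  have hK := shift_nonneg hp hT
  refine ⟨1 / (‖b₀⁻¹‖ + 4 * p * T / (p - 1) ^ 2 + 1), by positivity, fun t ht => ?_⟩
  have ht0 := shift_nonneg hp ht.1
  rw [div_le_iff₀ (by positivity), beta_eq_norm hn hp hb₀ ht.1]
  have hM := (posDef_inv_add hb₀ ht0)
  -- Submultiplicativity applied to `1 = β̃ β̃⁻¹` bounds `β` below by the reciprocal of the norm of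
  -- the inverse, which is bounded on `[0, T]`.
  have h1 : betaTilde p b₀ t * (b₀⁻¹ + (4 * p * t / (p - 1) ^ 2) • 1) = 1 :=
    Matrix.nonsing_inv_mul _ ((Matrix.isUnit_iff_isUnit_det _).1 hM.isUnit)
  have h2 : ‖(1 : Matrix (Fin n) (Fin n) ℝ)‖ = 1 := norm_one
  have h3 : ‖b₀⁻¹ + (4 * p * t / (p - 1) ^ 2) • (1 : Matrix (Fin n) (Fin n) ℝ)‖
      ≤ ‖b₀⁻¹‖ + 4 * p * T / (p - 1) ^ 2 + 1 := by
    refine (norm_add_le _ _).trans ?_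
    rw [norm_smul, h2, mul_one, Real.norm_of_nonneg ht0]
    have : 4 * p * t / (p - 1) ^ 2 ≤ 4 * p * T / (p - 1) ^ 2 := by
      have := ht.2
      gcongr
    linarith
  calc (1 : ℝ) = ‖(1 : Matrix (Fin n) (Fin n) ℝ)‖ := h2.symm
    _ ≤ ‖betaTilde p b₀ t‖
        * ‖b₀⁻¹ + (4 * p * t / (p - 1) ^ 2) • (1 : Matrix (Fin n) (Fin n) ℝ)‖ := by
      have h4 := Matrix.l2_opNorm_mul (betaTilde p b₀ t)
        (b₀⁻¹ + (4 * p * t / (p - 1) ^ 2) • (1 : Matrix (Fin n) (Fin n) ℝ))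
      rwa [h1] at h4
    _ ≤ _ := by gcongr

end Beta

/-! ### From the weighted norm to pointwise bounds -/

section WeightedNorm

variable {f : EuclideanSpace ℝ (Fin n) → ℝ} {K : ℝ}

lemma eLpNorm_weight_mul_le (hf : ∀ᵐ y, |f y| ≤ K) :
    eLpNorm (fun y => (Real.sqrt (1 + ‖y‖ ^ 2) ^ 3)⁻¹ * f y) ⊤ volume ≤ ENNReal.ofReal K := by
  rw [eLpNorm_exponent_top]
  refine eLpNormEssSup_le_of_ae_bound ?_
  filter_upwards [hf] with y hy
  have h1 : 1 ≤ Real.sqrt (1 + ‖y‖ ^ 2) := Real.one_le_sqrt.2 (one_le_one_add_sq y)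
  rw [norm_mul, norm_inv, Real.norm_of_nonneg (by positivity), Real.norm_eq_abs]
  exact (mul_le_of_le_one_left (abs_nonneg _) (inv_le_one_of_one_le₀ (one_le_pow₀ h1))).trans hy

lemma weightedNorm_le (hK : 0 ≤ K) (hf : ∀ᵐ y, |f y| ≤ K) : weightedNorm f ≤ K :=
  ENNReal.toReal_le_of_le_ofReal hK (eLpNorm_weight_mul_le hf)

lemma weightedNorm_nonneg (f : EuclideanSpace ℝ (Fin n) → ℝ) : 0 ≤ weightedNorm f :=
  ENNReal.toReal_nonneg

/-- Boundedness of `f` makes the essential supremum finite, so that its real value is meaningful.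
The weight `⟨y⟩³` is then enlarged to the polynomial `⟨y⟩⁴`. -/
lemma ae_abs_le_weightedNorm_mul (hf : ∀ᵐ y, |f y| ≤ K) :
    ∀ᵐ y, |f y| ≤ weightedNorm f * (1 + ‖y‖ ^ 2) ^ 2 := by
  have hfin := ne_top_of_le_ne_top ENNReal.ofReal_ne_top (eLpNorm_weight_mul_le hf)
  have h := enorm_ae_le_eLpNormEssSup
    (fun y => (Real.sqrt (1 + ‖y‖ ^ 2) ^ 3)⁻¹ * f y) (volume : Measure (EuclideanSpace ℝ (Fin n)))
  rw [← eLpNorm_exponent_top] at h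
  filter_upwards [h] with y hy
  have h0 := ENNReal.toReal_mono hfin hy
  rw [toReal_enorm] at h0
  have h1 : 1 ≤ Real.sqrt (1 + ‖y‖ ^ 2) := Real.one_le_sqrt.2 (one_le_one_add_sq y)
  rw [norm_mul, norm_inv, Real.norm_of_nonneg (by positivity), Real.norm_eq_abs,
    inv_mul_le_iff₀ (by positivity)] at h0
  have h2 : Real.sqrt (1 + ‖y‖ ^ 2) ^ 3 ≤ (1 + ‖y‖ ^ 2) ^ 2 := by
    calc Real.sqrt (1 + ‖y‖ ^ 2) ^ 3 ≤ Real.sqrt (1 + ‖y‖ ^ 2) ^ 4 :=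
          pow_le_pow_right₀ h1 (by norm_num)
      _ = (Real.sqrt (1 + ‖y‖ ^ 2) ^ 2) ^ 2 := by ring
      _ = _ := by rw [Real.sq_sqrt (by positivity)]
  refine h0.trans ?_
  rw [mul_comm]
  exact mul_le_mul_of_nonneg_left h2 (weightedNorm_nonneg f)

end WeightedNorm

/-! ### Pointwise consequences of the majorants -/

section Majorants

variable {p T : ℝ} {a : ℝ → ℝ} {b : ℝ → Matrix (Fin n) (Fin n) ℝ}
  {ξ : ℝ → EuclideanSpace ℝ (Fin n) → ℝ}

/-- The real supremum of an unbounded set is zero by convention, so an upper bound must be supplied.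
For the three majorants it comes from the lower bound on `β` and from boundedness of `ξ`, `a` and
`b` on `[0, T]`. -/
lemma le_sSup_image_Icc {f : ℝ → ℝ} {K τ : ℝ} (hτ : τ ∈ Set.Icc 0 T)
    (hf : ∀ t ∈ Set.Icc 0 T, f t ≤ K) : f τ ≤ sSup (f '' Set.Icc 0 τ) := by
  refine le_csSup ⟨K, ?_⟩ ⟨τ, ⟨hτ.1, le_rfl⟩, rfl⟩
  rintro _ ⟨t, ht, rfl⟩
  exact hf t ⟨ht.1, ht.2.trans hτ.2⟩

lemma exists_bound_fluctuation (hp : 1 < p) (ha : ContinuousOn a (Set.Icc 0 T))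
    (ha0 : ∀ t ∈ Set.Icc 0 T, 0 < a t) (hbp : ∀ t ∈ Set.Icc 0 T, (b t).PosSemidef)
    (hv : IsWeakSolution p T a fun τ y => profile p (a τ) (b τ) y + ξ τ y) :
    ∃ K, 0 ≤ K ∧ ∀ t ∈ Set.Icc 0 T, ∀ᵐ y, |ξ t y| ≤ K := by
  have hq := sub_pos.2 hp
  obtain ⟨K, hK⟩ := hv.bounded
  obtain ⟨A, hA⟩ := isCompact_Icc.exists_bound_of_continuousOn ha
  refine ⟨|K| + ((|A| + 1 / 2) / (p - 1)) ^ (1 / (p - 1)), by positivity, fun t ht => ?_⟩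
  filter_upwards [hK t ht] with y hy
  have h1 := profile_pos hp (ha0 t ht) (hbp t ht) y
  have h2 := ha0 t ht
  have h3 : profile p (a t) (b t) y ≤ ((|A| + 1 / 2) / (p - 1)) ^ (1 / (p - 1)) := by
    refine (profile_le hp (ha0 t ht) (hbp t ht) y).trans ?_
    have := (le_abs_self _).trans ((hA t ht).trans (le_abs_self A))
    gcongr
  have h4 : |ξ t y| ≤ |profile p (a t) (b t) y + ξ t y| + |profile p (a t) (b t) y| := by
    have := abs_sub (profile p (a t) (b t) y + ξ t y) (profile p (a t) (b t) y)
    rwa [add_sub_cancel_left] at this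
  rw [abs_of_pos h1] at h4
  linarith [le_abs_self K]

lemma weightedNorm_le_majorantM (hn : 0 < n) (hp : 1 < p) (hb₀ : (b 0).PosDef)
    {K : ℝ} (hK : ∀ t ∈ Set.Icc 0 T, ∀ᵐ y, |ξ t y| ≤ K)
    {τ : ℝ} (hτ : τ ∈ Set.Icc 0 T) :
    weightedNorm (ξ τ) ≤ beta p (b 0) τ ^ 2 * majorantM p b ξ τ := by
  obtain ⟨δ, hδ, hβ⟩ := exists_beta_lower_bound hn hp hb₀ T
  have hβ0 := beta_pos hn hp hb₀ hτ.1
  have h := le_sSup_image_Icc (f := fun s => (beta p (b 0) s ^ 2)⁻¹ * weightedNorm (ξ s))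
    (K := (δ ^ 2)⁻¹ * |K|) hτ fun t ht => by
      have h1 := hβ t ht
      have h2 := weightedNorm_le (abs_nonneg K)
        ((hK t ht).mono fun y hy => hy.trans (le_abs_self K))
      have h3 := weightedNorm_nonneg (ξ t)
      gcongr
  rwa [inv_mul_le_iff₀ (by positivity)] at h

lemma le_majorantA (hn : 0 < n) (hp : 1 < p) (hb₀ : (b 0).PosDef)
    (ha : ContinuousOn a (Set.Icc 0 T)) (hb : ContinuousOn b (Set.Icc 0 T))
    {τ : ℝ} (hτ : τ ∈ Set.Icc 0 T) :
    |a τ - 1 / 2 + 2 * (b τ).trace / (p - 1)| ≤ beta p (b 0) τ ^ 2 * majorantA p a b τ := by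
  obtain ⟨δ, hδ, hβ⟩ := exists_beta_lower_bound hn hp hb₀ T
  have hβ0 := beta_pos hn hp hb₀ hτ.1
  have htr : ContinuousOn (fun t => (b t).trace) (Set.Icc 0 T) :=
    (continuous_id.matrix_trace).comp_continuousOn hb
  obtain ⟨K, hK⟩ := isCompact_Icc.exists_bound_of_continuousOn
    ((ha.sub (continuousOn_const (c := (1 / 2 : ℝ)))).add
      ((continuousOn_const (c := (2 : ℝ)).mul htr).div_const (p - 1)))
  have h := le_sSup_image_Icc
    (f := fun s => (beta p (b 0) s ^ 2)⁻¹ * |a s - 1 / 2 + 2 * (b s).trace / (p - 1)|)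
    (K := (δ ^ 2)⁻¹ * K) hτ fun t ht => by
      have h1 := hβ t ht
      have h2 : |a t - 1 / 2 + 2 * (b t).trace / (p - 1)| ≤ K := hK t ht
      gcongr
  rwa [inv_mul_le_iff₀ (by positivity)] at h

lemma norm_sub_betaTilde_le_majorantB (hn : 0 < n) (hp : 1 < p) (hb₀ : (b 0).PosDef)
    (hb : ContinuousOn b (Set.Icc 0 T))
    {τ : ℝ} (hτ : τ ∈ Set.Icc 0 T) :
    ‖b τ - betaTilde p (b 0) τ‖ ≤ beta p (b 0) τ ^ (1 + kappa p) * majorantB p b τ := by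
  obtain ⟨δ, hδ, hβ⟩ := exists_beta_lower_bound hn hp hb₀ T
  have hβ0 := beta_pos hn hp hb₀ hτ.1
  have hκ : 0 < kappa p := lt_min (by norm_num) (by linarith)
  obtain ⟨K, hK⟩ := isCompact_Icc.exists_bound_of_continuousOn hb
  have h := le_sSup_image_Icc
    (f := fun s => beta p (b 0) s ^ (-(1 + kappa p)) * ‖b s - betaTilde p (b 0) s‖)
    (K := δ ^ (-(1 + kappa p)) * (K + ‖b 0‖)) hτ fun t ht => by
      have h1 := hβ t ht
      have h2 : ‖b t - betaTilde p (b 0) t‖ ≤ K + ‖b 0‖ := by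
        refine (norm_sub_le _ _).trans (add_le_add (hK t ht) ?_)
        rw [← beta_eq_norm hn hp hb₀ ht.1]
        exact beta_le_norm hn hp hb₀ ht.1
      have h3 : beta p (b 0) t ^ (-(1 + kappa p)) ≤ δ ^ (-(1 + kappa p)) :=
        Real.rpow_le_rpow_of_nonpos hδ h1 (by linarith)
      gcongr
  rwa [Real.rpow_neg hβ0.le, inv_mul_le_iff₀ (by positivity)] at h

end Majorants

/-! ### The orthogonality conditions -/

section Orthogonality

variable {a p : ℝ} {f : EuclideanSpace ℝ (Fin n) → ℝ}

/-- The symmetric matrix of the quadratic form `y_i y_j`. -/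
noncomputable def symmSingle (i j : Fin n) : Matrix (Fin n) (Fin n) ℝ :=
  (1 / 2 : ℝ) • (Matrix.single i j 1 + Matrix.single j i 1)

lemma isHermitian_symmSingle (i j : Fin n) : (symmSingle i j).IsHermitian := by
  rw [Matrix.IsHermitian, symmSingle, Matrix.conjTranspose_smul, Matrix.conjTranspose_add,
    Matrix.conjTranspose_single, Matrix.conjTranspose_single, star_one, star_trivial, add_comm]

lemma quad_single (i j : Fin n) (y : EuclideanSpace ℝ (Fin n)) :
    quad (Matrix.single i j 1) y = y i * y j := by
  rw [quad, Finset.sum_eq_single i, Finset.sum_eq_single j]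
  · simp
  · intro k _ hk; simp [hk.symm]
  · simp
  · intro k _ hk; simp [hk.symm]
  · simp

lemma quad_symmSingle (i j : Fin n) (y : EuclideanSpace ℝ (Fin n)) :
    quad (symmSingle i j) y = y i * y j := by
  rw [symmSingle, quad_smul, quad_add, quad_single, quad_single]; ring

lemma gaussInner_phi_zero_zero (a : ℝ) (f : EuclideanSpace ℝ (Fin n) → ℝ) :
    gaussInner a f (phi a 0 0) = ∫ y, f y * gtest a 1 0 y := by
  unfold gaussInner
  congr 1; ext y
  simp [phi, gtest, qpoly, gauss, quad_zero]

lemma gaussInner_phi_succ_succ (ha : 0 ≤ a) (f : EuclideanSpace ℝ (Fin n) → ℝ) (i j : Fin n) :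
    gaussInner a f (phi a i.succ j.succ) = a * ∫ y, f y * gtest a 0 (symmSingle i j) y := by
  unfold gaussInner
  rw [← integral_const_mul]
  congr 1; ext y
  simp only [phi, Fin.cons_succ, gtest, qpoly, gauss, quad_symmSingle, zero_add]
  have := Real.mul_self_sqrt ha
  calc _ = f y * ((Real.sqrt a * Real.sqrt a) * (y i * y j)) * Real.exp (-(a * ‖y‖ ^ 2 / 2)) := by
        ring
    _ = _ := by rw [this]; ring

lemma gtest_eq_sum (a s : ℝ) (S : Matrix (Fin n) (Fin n) ℝ) (y : EuclideanSpace ℝ (Fin n)) :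
    gtest a s S y = s * gtest a 1 0 y + ∑ i, ∑ j, S i j * gtest a 0 (symmSingle i j) y := by
  simp only [gtest, qpoly, quad_symmSingle, quad_zero, zero_add, add_zero, one_mul, add_mul]
  congr 1
  rw [quad, Finset.sum_mul]
  refine Finset.sum_congr rfl fun i _ => ?_
  rw [Finset.sum_mul]
  exact Finset.sum_congr rfl fun j _ => by ring

/-- Orthogonality to the vectors `φ_a^{(ij)}` implies orthogonality to the test functions. -/
lemma integral_mul_gtest_eq_zero (ha : 0 < a)
    (hf : ∀ (s : ℝ) (S : Matrix (Fin n) (Fin n) ℝ), Integrable fun y => f y * gtest a s S y)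
    (h : ∀ i j, gaussInner a f (phi a i j) = 0) (s : ℝ) (S : Matrix (Fin n) (Fin n) ℝ) :
    ∫ y, f y * gtest a s S y = 0 := by
  have h0 : ∫ y, f y * gtest a 1 0 y = 0 := by rw [← gaussInner_phi_zero_zero, h]
  have h1 : ∀ i j, ∫ y, f y * gtest a 0 (symmSingle i j) y = 0 := fun i j => by
    have := h i.succ j.succ
    rw [gaussInner_phi_succ_succ ha.le] at this
    exact (mul_eq_zero.1 this).resolve_left ha.ne'
  have e : ∀ y, f y * gtest a s S y = s * (f y * gtest a 1 0 y)
      + ∑ i, ∑ j, S i j * (f y * gtest a 0 (symmSingle i j) y) := fun y => by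
    rw [gtest_eq_sum, mul_add, Finset.mul_sum]
    congr 1
    · ring
    · refine Finset.sum_congr rfl fun i _ => ?_
      rw [Finset.mul_sum]
      exact Finset.sum_congr rfl fun j _ => by ring
  have hi : ∀ i j, Integrable fun y => S i j * (f y * gtest a 0 (symmSingle i j) y) :=
    fun i j => (hf _ _).const_mul _
  simp only [e]
  rw [integral_add ((hf _ _).const_mul _)
    (integrable_finsetSum _ fun i _ => integrable_finsetSum _ fun j _ => hi i j),
    integral_const_mul, h0, integral_finsetSum _ fun i _ =>
      integrable_finsetSum _ fun j _ => hi i j]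
  simp_rw [integral_finsetSum _ fun j _ => hi _ j, integral_const_mul, h1]
  simp

/-- Reflection preserves the measure. Integrability plays no role, because the Bochner integral is
zero without it. -/
lemma integral_eq_zero_of_odd {g : EuclideanSpace ℝ (Fin n) → ℝ} (hg : ∀ y, g (-y) = -g y) :
    ∫ y, g y = 0 := by
  have h := integral_neg_eq_self g volume
  simp only [hg, integral_neg] at h
  linarith

/-- An even function that is orthogonal to the test functions is orthogonal to the vectors
`φ_a^{(ij)}`. -/
lemma gaussInner_phi_eq_zero (ha : 0 ≤ a) (hf : ∀ y, f (-y) = f y)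
    (h : ∀ (s : ℝ) (S : Matrix (Fin n) (Fin n) ℝ), S.IsHermitian →
      ∫ y, f y * gtest a s S y = 0) (i j : Fin (n + 1)) :
    gaussInner a f (phi a i j) = 0 := by
  refine Fin.cases (Fin.cases ?_ (fun j => ?_) j) (fun i => Fin.cases ?_ (fun j => ?_) j) i
  · rw [gaussInner_phi_zero_zero, h 1 0 Matrix.isHermitian_zero]
  · exact integral_eq_zero_of_odd fun y => by simp [phi, hf]
  · exact integral_eq_zero_of_odd fun y => by simp [phi, hf]
  · rw [gaussInner_phi_succ_succ ha, h _ _ (isHermitian_symmSingle i j), mul_zero]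

lemma source_neg {b : Matrix (Fin n) (Fin n) ℝ} (hp : 1 < p) (ha : 0 < a) (hb : b.PosSemidef)
    (ra : ℝ) (rb : Matrix (Fin n) (Fin n) ℝ) (y : EuclideanSpace ℝ (Fin n)) :
    source p a b (velocityA p a b ra) (velocityB p a b rb) (-y) =
      source p a b (velocityA p a b ra) (velocityB p a b rb) y := by
  rw [source_velocity_eq hp ha hb, source_velocity_eq hp ha hb]
  simp only [kern, profile_eq, den, qpoly, cubicTerm, quad_neg_arg, map_neg, norm_neg]

end Orthogonality

/-! ### The effective equations -/

section Effective

variable {p T : ℝ} {a : ℝ → ℝ} {b : ℝ → Matrix (Fin n) (Fin n) ℝ}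
  {ξ : ℝ → EuclideanSpace ℝ (Fin n) → ℝ}

/-- Differentiation commutes with the adjoint. This makes the remainder `rb` of a solution
symmetric, as the uniqueness argument requires. -/
lemma isHermitian_derivWithin {I : Set ℝ} {τ : ℝ} (hτ : τ ∈ I)
    (hb : ∀ t ∈ I, (b t).IsHermitian) : (derivWithin b I τ).IsHermitian := by
  have h := derivWithin.star (𝕜 := ℝ) (f := b) (s := I) (x := τ)
  have e : derivWithin (fun t => star (b t)) I τ = derivWithin b I τ :=
    derivWithin_congr (fun t ht => hb t ht) (hb τ hτ)
  exact h.symm.trans e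

lemma isHermitian_velocityB (p α : ℝ) {B R : Matrix (Fin n) (Fin n) ℝ} (hB : B.IsHermitian)
    (hR : R.IsHermitian) : (velocityB p α B R).IsHermitian := by
  have h1 : (B * B).IsHermitian := by
    rw [Matrix.IsHermitian, Matrix.conjTranspose_mul, hB.eq]
  exact ((((h1.smul (IsSelfAdjoint.all _)).neg.sub (hB.smul (IsSelfAdjoint.all _))).add
    (hB.smul (IsSelfAdjoint.all _)))).add hR

/-- The velocities of the parameters of a solution satisfy the linear system. -/
lemma isRemainder_of_isWeakSolution (hp : 1 < p) (hT : 0 < T)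
    (ha : ContDiffOn ℝ 1 a (Set.Icc 0 T)) (hb : ContDiffOn ℝ 1 b (Set.Icc 0 T))
    (ha0 : ∀ t ∈ Set.Icc 0 T, 0 < a t) (hbp : ∀ t ∈ Set.Icc 0 T, (b t).PosSemidef)
    (hv : IsWeakSolution p T a fun τ y => profile p (a τ) (b τ) y + ξ τ y)
    (ho : ∀ t ∈ Set.Icc 0 T, ∀ (s : ℝ) (S : Matrix (Fin n) (Fin n) ℝ), S.IsHermitian →
      ∫ y, ξ t y * gtest (a t) s S y = 0) {τ : ℝ} (hτ : τ ∈ Set.Icc 0 T) :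
    ∃ ra rb, IsRemainder p (ξ τ) (a τ) (b τ) ra rb ∧
      derivWithin a (Set.Icc 0 T) τ = velocityA p (a τ) (b τ) ra ∧
      derivWithin b (Set.Icc 0 T) τ = velocityB p (a τ) (b τ) rb := by
  have hc : a τ + 1 / 2 ≠ 0 := by linarith [ha0 τ hτ]
  -- Both velocities are affine in the remainders with invertible leading coefficient, so the
  -- remainders can simply be defined by (2).
  have eA : derivWithin a (Set.Icc 0 T) τ = velocityA p (a τ) (b τ)
      (derivWithin a (Set.Icc 0 T) τ / (a τ + 1 / 2)
        - ((1 / 2 - a τ) - 2 / (p - 1) * (b τ).trace)) := by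
    rw [velocityA, add_sub_cancel, mul_div_cancel₀ _ hc]
  have eB : derivWithin b (Set.Icc 0 T) τ = velocityB p (a τ) (b τ)
      (derivWithin b (Set.Icc 0 T) τ - velocityB p (a τ) (b τ) 0) := by
    rw [velocityB, velocityB, add_zero, add_sub_cancel]
  refine ⟨_, _, ⟨?_, fun s S hS => ?_⟩, eA, eB⟩
  · exact (isHermitian_derivWithin hτ fun t ht => (hbp t ht).isHermitian).sub
      (isHermitian_velocityB p _ (hbp τ hτ).isHermitian Matrix.isHermitian_zero)
  · rw [← eA, ← eB]
    exact modulation_identity hp hT ha hb ha0 hbp hv ho s hS hτ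

end Effective

/-- With `m = β² M`, each term of the abstract bound becomes one of `remainderSize`. The factor `8`
comes from `(2β)³`, and the product `w m` is even of order `β⁴ M A`, with one power of `β` to spare.
-/
lemma remainder_terms_le {β M A B w m p : ℝ} (hβ : 0 < β) (hβ1 : β ≤ 1)
    (hM : 0 ≤ M) (hA : 0 ≤ A) (hB0 : 0 ≤ B) (hB : B ≤ 2 * β) (hm : m = β ^ 2 * M)
    (hw : w ≤ β ^ 2 * A) :
    B ^ 3 + B * m + m ^ 2 + m ^ p + w * m ≤
      8 * (β ^ 3 + β ^ 3 * M * (1 + A) + β ^ 4 * M ^ 2 + β ^ (2 * p) * M ^ p) := by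
  have h1 : m ^ p = β ^ (2 * p) * M ^ p := by
    rw [hm, Real.mul_rpow (by positivity) hM, ← Real.rpow_natCast_mul hβ.le]
    norm_num
  have h2 : B ^ 3 ≤ 8 * β ^ 3 := by
    calc B ^ 3 ≤ (2 * β) ^ 3 := by gcongr
      _ = _ := by ring
  have hm0 : 0 ≤ m := by rw [hm]; positivity
  have h3 : B * m ≤ 2 * (β ^ 3 * M) := by
    calc B * m ≤ (2 * β) * m := by gcongr
      _ = _ := by rw [hm]; ring
  have h4 : w * m ≤ β ^ 3 * M * A := by
    calc w * m ≤ (β ^ 2 * A) * m := by gcongr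
      _ = β * (β ^ 3 * M * A) := by rw [hm]; ring
      _ ≤ 1 * (β ^ 3 * M * A) := by gcongr
      _ = _ := one_mul _
  have h5 : m ^ 2 = β ^ 4 * M ^ 2 := by rw [hm]; ring
  have h6 : 0 ≤ β ^ 3 * M * A := by positivity
  have h7 : 0 ≤ β ^ 3 * M := by positivity
  have h8 : 0 ≤ β ^ 4 * M ^ 2 := by positivity
  have h9 : 0 ≤ β ^ (2 * p) * M ^ p := mul_nonneg (by positivity) (Real.rpow_nonneg hM p)
  rw [h1, h5]
  linarith

end BlowupHeat

/-! ### Choice of the constants and conclusion -/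

open BlowupHeat in
theorem proposition7p2 (n : ℕ) (hn : 0 < n) (p : ℝ) (hp : 1 < p) :
    ∃ ε > 0, ∃ C > 0,
      ∃ Rb : (EuclideanSpace ℝ (Fin n) → ℝ) → ℝ → Matrix (Fin n) (Fin n) ℝ →
        Matrix (Fin n) (Fin n) ℝ,
      ∃ Ra : (EuclideanSpace ℝ (Fin n) → ℝ) → ℝ → Matrix (Fin n) (Fin n) ℝ → ℝ,
      ∀ (T : ℝ) (a : ℝ → ℝ) (b : ℝ → Matrix (Fin n) (Fin n) ℝ)
        (ξ : ℝ → EuclideanSpace ℝ (Fin n) → ℝ),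
        0 < T →
        ContDiffOn ℝ 1 a (Set.Icc 0 T) →
        ContDiffOn ℝ 1 b (Set.Icc 0 T) →
        (∀ τ ∈ Set.Icc 0 T, 0 < a τ) →
        (∀ τ ∈ Set.Icc 0 T, (b τ).PosSemidef) →
        (b 0).PosDef →
        ‖b 0‖ ≤ ε →
        1 / 2 ≤ a 0 + 1 / 2 → a 0 + 1 / 2 ≤ 2 →
        -- `v = V_{ab} + ξ` solves the rescaled equation
        BlowupHeat.IsWeakSolution p T a
          (fun τ y => BlowupHeat.profile p (a τ) (b τ) y + ξ τ y) →
        -- the orthogonality conditions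
        (∀ τ ∈ Set.Icc 0 T, ∀ i j : Fin (n + 1),
          BlowupHeat.gaussInner (a τ) (ξ τ) (BlowupHeat.phi (a τ) i j) = 0) →
        -- the majorants are controlled
        (∀ τ ∈ Set.Icc 0 T,
          BlowupHeat.majorantA p a b τ
            ≤ BlowupHeat.beta p (b 0) τ ^ (-(BlowupHeat.kappa p / 2))) →
        (∀ τ ∈ Set.Icc 0 T,
          BlowupHeat.majorantM p b ξ τ
            ≤ BlowupHeat.beta p (b 0) τ ^ (-(BlowupHeat.kappa p / 2))) →
        (∀ τ ∈ Set.Icc 0 T,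
          BlowupHeat.majorantB p b τ
            ≤ BlowupHeat.beta p (b 0) τ ^ (-(BlowupHeat.kappa p / 2))) →
        ∀ τ ∈ Set.Icc 0 T,
          -- the effective equations
          derivWithin b (Set.Icc 0 T) τ =
            -((4 * p / (p - 1) ^ 2) • (b τ * b τ)) - (2 / (p - 1) * (b τ).trace) • b τ
              + ((a τ + 1 / 2) - 2 * a τ) • b τ + Rb (ξ τ) (a τ) (b τ) ∧
          derivWithin a (Set.Icc 0 T) τ / (a τ + 1 / 2) =
            (1 / 2 - a τ) - 2 / (p - 1) * (b τ).trace + Ra (ξ τ) (a τ) (b τ) ∧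
          -- the size of the remainders
          ‖Rb (ξ τ) (a τ) (b τ)‖ ≤ C * BlowupHeat.remainderSize p a b ξ τ ∧
          |Ra (ξ τ) (a τ) (b τ)| ≤ C * BlowupHeat.remainderSize p a b ξ τ ∧
          -- the remainders in the absence of a fluctuation
          ‖Rb 0 (a τ) (b τ)‖ ≤ C * BlowupHeat.beta p (b 0) τ ^ 3 ∧
          |Ra 0 (a τ) (b τ)| ≤ C * BlowupHeat.beta p (b 0) τ ^ 3 ∧
          (∀ i j : Fin (n + 1),
            BlowupHeat.gaussInner (a τ)
              (BlowupHeat.source p (a τ) (b τ)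
                (BlowupHeat.velocityA p (a τ) (b τ) (Ra 0 (a τ) (b τ)))
                (BlowupHeat.velocityB p (a τ) (b τ) (Rb 0 (a τ) (b τ))))
              (BlowupHeat.phi (a τ) i j) = 0) := by

  have hq := sub_pos.2 hp
  have hκ : 0 < kappa p := lt_min (by norm_num) (by linarith)
  have hκ1 : kappa p ≤ 1 / 2 := min_le_left _ _
  obtain ⟨m₁, hm₁, huniq⟩ := exists_isRemainder_unique n hp
  obtain ⟨m₂, hm₂, C, hC, hbound⟩ := exists_isRemainder_bound n hp
  set L := 1 + 4 * n / (p - 1) with hL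
  have hL0 : 0 < L := by positivity
  -- Since `β ≤ ‖b 0‖ ≤ ε`, the first bound gives `‖b‖ ≤ 2β ≤ 1`. The second makes `m ≤ β`
  -- admissible for uniqueness and for the estimate, and the third gives `|a - 1/2| ≤ L β ≤ 1/4`.
  refine ⟨min (1 / 2) (min (min m₁ m₂) (1 / (4 * L))), by positivity, C * 8, by positivity,
    fun ζ α B => (remainders p ζ α B).2, fun ζ α B => (remainders p ζ α B).1, ?_⟩
  intro T a b ξ hT ha hb ha0 hbp hb0 hε _ _ hv ho hA hM hB τ hτ
  -- the size of the parameters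
  set β := beta p (b 0) τ with hβd
  have hβ : 0 < β := beta_pos hn hp hb0 hτ.1
  have hβε := (beta_le_norm hn hp hb0 hτ.1).trans hε
  rw [← hβd, le_min_iff, le_min_iff, le_min_iff] at hβε
  obtain ⟨hβ2, ⟨hβm₁, hβm₂⟩, hβL⟩ := hβε
  have hβ1 : β ≤ 1 := by linarith
  -- The exponent `2 - κ/2` is at least `1` because `κ ≤ 1/2`. The allowed growth of `A` and `M₁`
  -- thus costs less than one power of `β`.
  have hsmall : β ^ 2 * β ^ (-(kappa p / 2)) ≤ β := by
    rw [← Real.rpow_natCast, ← Real.rpow_add hβ]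
    calc _ ≤ β ^ (1 : ℝ) := Real.rpow_le_rpow_of_exponent_ge hβ hβ1 (by push_cast; linarith)
      _ = β := Real.rpow_one β
  obtain ⟨K, hK, hξK⟩ := exists_bound_fluctuation hp ha.continuousOn ha0 hbp hv
  -- The bound on `B` leaves `β^{1 + κ/2} ≤ β` for the distance of `b` to `β̃`, whose norm is `β`.
  have hbn : ‖b τ‖ ≤ 2 * β := by
    have h1 := norm_sub_betaTilde_le_majorantB hn hp hb0 hb.continuousOn hτ
    have h2 : β ^ (1 + kappa p) * majorantB p b τ ≤ β := by
      calc _ ≤ β ^ (1 + kappa p) * β ^ (-(kappa p / 2)) := by gcongr; exact hB τ hτ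
        _ = β ^ (1 + kappa p / 2) := by rw [← Real.rpow_add hβ]; ring_nf
        _ ≤ β ^ (1 : ℝ) := Real.rpow_le_rpow_of_exponent_ge hβ hβ1 (by linarith)
        _ = β := Real.rpow_one β
    have h3 := beta_eq_norm hn hp hb0 hτ.1
    have h4 := norm_le_norm_sub_add (b τ) (betaTilde p (b 0) τ)
    linarith
  have hw := le_majorantA hn hp hb0 ha.continuousOn hb.continuousOn hτ
  rw [← hβd] at hw
  have hwβ : |a τ - 1 / 2 + 2 * (b τ).trace / (p - 1)| ≤ β :=
    (hw.trans (mul_le_mul_of_nonneg_left (hA τ hτ) (by positivity))).trans hsmall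
  have haτ : |a τ - 1 / 2| ≤ 1 / 4 := by
    have h1 : |2 * (b τ).trace / (p - 1)| ≤ 4 * n / (p - 1) * β := by
      rw [abs_div, abs_mul, abs_two, abs_of_pos hq, div_mul_eq_mul_div]
      have h1 := abs_trace_le (b τ)
      have h2 : n * ‖b τ‖ ≤ n * (2 * β) := by gcongr
      exact div_le_div_of_nonneg_right (by linarith) hq.le
    have h2 := abs_sub (a τ - 1 / 2 + 2 * (b τ).trace / (p - 1)) (2 * (b τ).trace / (p - 1))
    rw [add_sub_cancel_right] at h2
    have h3 : L * β ≤ 1 / 4 := by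
      calc L * β ≤ L * (1 / (4 * L)) := by gcongr
        _ = 1 / 4 := by field_simp
    have h4 : L * β = β + 4 * n / (p - 1) * β := by rw [hL]; ring
    linarith
  have ha1 : 1 / 4 ≤ a τ := by linarith [neg_le_of_abs_le haτ]
  have ha2 : a τ ≤ 1 := by linarith [le_of_abs_le haτ]
  have hb1 : ‖b τ‖ ≤ 1 := by linarith
  -- the fluctuation
  have hξm : ∀ t ∈ Set.Icc 0 T, AEStronglyMeasurable (ξ t) volume := fun t ht => by
    have h := (hv.aestronglyMeasurable t ht).sub
      (continuous_profile hp (ha0 t ht) (hbp t ht)).aestronglyMeasurable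
    refine h.congr (Eventually.of_forall fun y => ?_)
    simp
  have horth : ∀ t ∈ Set.Icc 0 T, ∀ (s : ℝ) (S : Matrix (Fin n) (Fin n) ℝ), S.IsHermitian →
      ∫ y, ξ t y * gtest (a t) s S y = 0 := fun t ht s S _ =>
    integral_mul_gtest_eq_zero (ha0 t ht)
      (fun s S => integrable_mul_of_le_momentWeight (ha0 t ht) (hξm t ht) (hξK t ht)
        (continuous_gtest _ _ _).aestronglyMeasurable (abs_gtest_le (a t) s S))
      (ho t ht) s S
  have hM0 := weightedNorm_le_majorantM hn hp hb0 hξK hτ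
  rw [← hβd] at hM0
  set m := β ^ 2 * majorantM p b ξ τ with hm
  have hm0 : 0 ≤ m := (weightedNorm_nonneg _).trans hM0
  have hmβ : m ≤ β := (mul_le_mul_of_nonneg_left (hM τ hτ) (by positivity)).trans hsmall
  have hfl : IsFluctuation m (a τ) (ξ τ) :=
    { nonneg := hm0
      aestronglyMeasurable := hξm τ hτ
      bound := by
        filter_upwards [ae_abs_le_weightedNorm_mul (hξK τ hτ)] with y hy
        exact hy.trans (mul_le_mul_of_nonneg_right hM0 (by positivity))
      orthogonal := horth τ hτ }
  have hMn : 0 ≤ majorantM p b ξ τ := nonneg_of_mul_nonneg_right hm0 (by positivity)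
  have hAn : 0 ≤ majorantA p a b τ :=
    nonneg_of_mul_nonneg_right ((abs_nonneg _).trans hw) (by positivity)
  -- the remainders
  obtain ⟨ra, rb, hr, eA, eB⟩ :=
    isRemainder_of_isWeakSolution hp hT ha hb ha0 hbp hv horth hτ
  have hR := isRemainder_remainders hr
  -- Uniqueness identifies the remainders read off from the velocities with those chosen from `(ξ,
  -- a, b)` alone.
  obtain ⟨e1, e2⟩ := huniq m (a τ) (b τ) (ξ τ) (hmβ.trans hβm₁) ha1 ha2 (hbp τ hτ) hb1 hfl
    _ _ _ _ hr hR
  obtain ⟨h1, h2⟩ := hbound m (a τ) (b τ) (ξ τ) (hmβ.trans hβm₂) ha1 ha2 (hbp τ hτ) hb1 hfl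
    _ _ hR
  obtain ⟨ra₀, rb₀, hr₀⟩ := exists_isRemainder_zero hp ha1 ha2 (hbp τ hτ) hb1
  have hR₀ := isRemainder_remainders hr₀
  -- The zero fluctuation has size `m = 0`, so only `‖b‖³` remains in the bound.
  obtain ⟨h3, h4⟩ := hbound 0 (a τ) (b τ) 0 hm₂.le ha1 ha2 (hbp τ hτ) hb1
    (isFluctuation_zero (a τ)) _ _ hR₀
  have hsize := remainder_terms_le hβ hβ1 hMn hAn (norm_nonneg (b τ)) hbn hm hw (p := p)
  have hsize0 : ‖b τ‖ ^ 3 + ‖b τ‖ * 0 + 0 ^ 2 + (0 : ℝ) ^ p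
      + |a τ - 1 / 2 + 2 * (b τ).trace / (p - 1)| * 0 ≤ 8 * β ^ 3 := by
    rw [Real.zero_rpow (by linarith)]
    calc _ = ‖b τ‖ ^ 3 := by ring
      _ ≤ (2 * β) ^ 3 := by gcongr
      _ = _ := by ring
  have hc : a τ + 1 / 2 ≠ 0 := by linarith
  refine ⟨?_, ?_, ?_, ?_, ?_, ?_, ?_⟩
  · rw [eB, e2, velocityB]
  · rw [eA, e1, velocityA, mul_div_cancel_left₀ _ hc]
  · rw [mul_assoc]
    exact h2.trans (mul_le_mul_of_nonneg_left hsize hC.le)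
  · rw [mul_assoc]
    exact h1.trans (mul_le_mul_of_nonneg_left hsize hC.le)
  · rw [mul_assoc]
    exact h4.trans (mul_le_mul_of_nonneg_left hsize0 hC.le)
  · rw [mul_assoc]
    exact h3.trans (mul_le_mul_of_nonneg_left hsize0 hC.le)
  -- The system only tests against even polynomials. Evenness of the source supplies the relations
  -- with `φ^{(0i)}`.
  · refine gaussInner_phi_eq_zero (by linarith)
      (source_neg hp (by linarith) (hbp τ hτ) _ _) fun s S hS => ?_
    have h5 := hR₀.2 s S hS
    simp only [Pi.zero_apply, zero_mul, integral_zero, mul_zero, add_zero] at h5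
    rw [← h5]
    congr 1; ext y
    rw [nonlin_of_pos (profile_pos hp (ha0 τ hτ) (hbp τ hτ) y), sub_self, add_zero]
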